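/- Let $\Sigma$ be a smooth closed oriented surface, let $K$ be a (finite-dimensional, e.g. compact) Lie group with Lie algebra $\mathfrak k$, let $B$ be an $\mathrm{Ad}(K)$-invariant positive-definite inner product on $\mathfrak k$, and let $E_K\to\Sigma$ be a smooth principal $K$-bundle. Let $\mathcal J$ be the space of complex structures on $\Sigma$ compatible with the orientation (with $T_J\mathcal J=\{\dot J\in\Omega^0(\operatorname{End}T\Sigma): \dot JJ=-J\dot J\}$), let $\mathcal A$ be the space of connections on $E_K$, and put $\mathcal X=\mathcal J\times\mathcal A\times\Omega^1(\Sigma,E_K(\mathfrak k))\ni(J,A,\psi)$, fibred over $\mathcal J$. For a one-form $a$ and an endomorphism field $C$ write $a(C)=a\circ C$ and $Ja=-a\circ J$. Endow $\mathcal X$ with the complex structure $$\mathbb I(\dot J,a,\dot\psi)=(J\dot J,\,Ja,\,-J\dot\psi+\psi(\dot J)),$$ and its fibres with the Kähler forms $$\widehat{\boldsymbol\omega}_{\mathbf I}((0,a_1,\dot\psi_1),(0,a_2,\dot\psi_2))=\int_\Sigma B(a_1\wedge a_2)-\int_\Sigma B(\dot\psi_1\wedge\dot\psi_2).$$ Let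 $\Gamma^{\mathbb I}$ be the Ehresmann connection on $\mathcal X\to\mathcal J$ with horizontal space $H^{\mathbb I}=\{(\dot J,0,-\tfrac12\psi(J\dot J)) : \dot J\in T_J\mathcal J\}$, and denote also by $\Gamma^{\mathbb I}$ its vertical projection. Then: 1. $\Gamma^{\mathbb I}$ is a Kähler connection for $(\mathcal X,\mathbb I,\widehat{\boldsymbol\omega}_{\mathbf I})$, in the following sense: $H^{\mathbb I}$ is preserved by $\mathbb I$; every smooth path in $\mathcal J$ has a unique horizontal lift through each point of the fibre over any of its points; and the resulting parallel transport between the fibres is smooth and preserves the fibrewise Kähler forms $\widehat{\boldsymbol\omega}_{\mathbf I}$. 2. With $\mu((\dot J_1,a_1,\dot\psi_1),(\dot J_2,a_2,\dot\psi_2))=\frac14\int_\Sigma B(\psi(\dot J_1)\wedge\psi(\dot J_2))$, the form $$\boldsymbol\sigma^{\mathbb I}:=\widehat{\boldsymbol\omega}_{\mathbf I}(\Gamma^{\mathbb I},\Gamma^{\mathbb I})-\mu$$ is a coupling form for $\Gamma^{\mathbb I}$: it is a smooth closed real $2$-form on $\mathcal X$, of type $(1,1)$ with respect to $\mathbb I$,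 which restricts to $\widehat{\boldsymbol\omega}_{\mathbf I}$ on the fibres, and $H^{\mathbb I}$ is the $\boldsymbol\sigma^{\mathbb I}$-orthogonal complement of the vertical bundle. 3. Explicitly, for $v_j=(\dot J_j,a_j,\dot\psi_j)\in T_{(J,A,\psi)}\mathcal X$, $$\begin{aligned}\boldsymbol\sigma^{\mathbb I}(v_1,v_2)&=\int_\Sigma B(a_1\wedge a_2)-\int_\Sigma B\big((\dot\psi_1+\tfrac12\psi(J\dot J_1))\wedge(\dot\psi_2+\tfrac12\psi(J\dot J_2))\big)-\tfrac14\int_\Sigma B(\psi(\dot J_1)\wedge\psi(\dot J_2))\\&=\int_\Sigma B(a_1\wedge a_2)-\int_\Sigma B(\dot\psi_1\wedge\dot\psi_2)-\tfrac12\int_\Sigma B(\psi(J\dot J_1)\wedge\dot\psi_2)-\tfrac12\int_\Sigma B(\dot\psi_1\wedge\psi(J\dot J_2))-\tfrac12\int_\Sigma B(\psi(\dot J_1)\wedge\psi(\dot J_2)).\end{aligned}$$ -/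

import Mathlib

open scoped Manifold ContDiff Bundle

namespace HiggsFibration

/-! ### Composition, addition and scaling of smooth families of bundle maps -/

section HomBundles

open Bundle ContinuousLinearMap

variable {S N F₁ F₂ F₃ EB EN HB HN : Type*}
  {E₁ : S → Type*} {E₂ : S → Type*} {E₃ : S → Type*}
  [∀ x, AddCommGroup (E₁ x)] [∀ x, Module ℝ (E₁ x)] [NormedAddCommGroup F₁] [NormedSpace ℝ F₁]
  [TopologicalSpace (TotalSpace F₁ E₁)] [∀ x, TopologicalSpace (E₁ x)]
  [∀ x, AddCommGroup (E₂ x)] [∀ x, Module ℝ (E₂ x)] [NormedAddCommGroup F₂] [NormedSpace ℝ F₂]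
  [TopologicalSpace (TotalSpace F₂ E₂)] [∀ x, TopologicalSpace (E₂ x)]
  [∀ x, AddCommGroup (E₃ x)] [∀ x, Module ℝ (E₃ x)] [NormedAddCommGroup F₃] [NormedSpace ℝ F₃]
  [TopologicalSpace (TotalSpace F₃ E₃)] [∀ x, TopologicalSpace (E₃ x)]
  [NormedAddCommGroup EB] [NormedSpace ℝ EB] [TopologicalSpace HB] {IB : ModelWithCorners ℝ EB HB}
  [TopologicalSpace S] [ChartedSpace HB S]
  [NormedAddCommGroup EN] [NormedSpace ℝ EN] [TopologicalSpace HN] {IN : ModelWithCorners ℝ EN HN}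
  [TopologicalSpace N] [ChartedSpace HN N]
  [FiberBundle F₁ E₁] [VectorBundle ℝ F₁ E₁] [FiberBundle F₂ E₂] [VectorBundle ℝ F₂ E₂]
  [FiberBundle F₃ E₃] [VectorBundle ℝ F₃ E₃]
  [∀ x, IsTopologicalAddGroup (E₂ x)] [∀ x, ContinuousSMul ℝ (E₂ x)]
  [∀ x, IsTopologicalAddGroup (E₃ x)] [∀ x, ContinuousSMul ℝ (E₃ x)]
  {n : WithTop ℕ∞} {b : N → S}

theorem contMDiff_hom_comp {L : ∀ m, E₂ (b m) →L[ℝ] E₃ (b m)} {R : ∀ m, E₁ (b m) →L[ℝ] E₂ (b m)}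
    (hL : ContMDiff IN (IB.prod 𝓘(ℝ, F₂ →L[ℝ] F₃)) n
      (fun m => TotalSpace.mk' (F₂ →L[ℝ] F₃) (E := fun x => E₂ x →L[ℝ] E₃ x) (b m) (L m)))
    (hR : ContMDiff IN (IB.prod 𝓘(ℝ, F₁ →L[ℝ] F₂)) n
      (fun m => TotalSpace.mk' (F₁ →L[ℝ] F₂) (E := fun x => E₁ x →L[ℝ] E₂ x) (b m) (R m))) :
    ContMDiff IN (IB.prod 𝓘(ℝ, F₁ →L[ℝ] F₃)) n
      (fun m => TotalSpace.mk' (F₁ →L[ℝ] F₃) (E := fun x => E₁ x →L[ℝ] E₃ x) (b m)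
        ((L m).comp (R m))) := by
  intro m₀
  obtain ⟨hb, hL'⟩ := (contMDiffAt_hom_bundle _).1 (hL m₀)
  obtain ⟨-, hR'⟩ := (contMDiffAt_hom_bundle _).1 (hR m₀)
  refine (contMDiffAt_hom_bundle _).2 ⟨hb, ?_⟩
  refine (hL'.clm_comp hR').congr_of_eventuallyEq ?_
  have h2 : ∀ᶠ m in nhds m₀, b m ∈ (trivializationAt F₂ E₂ (b m₀)).baseSet :=
    hb.continuousAt ((trivializationAt F₂ E₂ (b m₀)).open_baseSet.mem_nhds
      (FiberBundle.mem_baseSet_trivializationAt' (b m₀)))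
  have h1 : ∀ᶠ m in nhds m₀, b m ∈ (trivializationAt F₁ E₁ (b m₀)).baseSet :=
    hb.continuousAt ((trivializationAt F₁ E₁ (b m₀)).open_baseSet.mem_nhds
      (FiberBundle.mem_baseSet_trivializationAt' (b m₀)))
  have h3 : ∀ᶠ m in nhds m₀, b m ∈ (trivializationAt F₃ E₃ (b m₀)).baseSet :=
    hb.continuousAt ((trivializationAt F₃ E₃ (b m₀)).open_baseSet.mem_nhds
      (FiberBundle.mem_baseSet_trivializationAt' (b m₀)))
  filter_upwards [h1, h2, h3] with m hm1 hm2 hm3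
  rw [inCoordinates_eq hm1 hm3, inCoordinates_eq hm2 hm3, inCoordinates_eq hm1 hm2]
  ext w
  simp only [coe_comp, Function.comp_apply, ContinuousLinearEquiv.coe_coe,
    ContinuousLinearEquiv.symm_apply_apply]

theorem contMDiff_hom_add {L R : ∀ m, E₁ (b m) →L[ℝ] E₂ (b m)}
    (hL : ContMDiff IN (IB.prod 𝓘(ℝ, F₁ →L[ℝ] F₂)) n
      (fun m => TotalSpace.mk' (F₁ →L[ℝ] F₂) (E := fun x => E₁ x →L[ℝ] E₂ x) (b m) (L m)))
    (hR : ContMDiff IN (IB.prod 𝓘(ℝ, F₁ →L[ℝ] F₂)) n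
      (fun m => TotalSpace.mk' (F₁ →L[ℝ] F₂) (E := fun x => E₁ x →L[ℝ] E₂ x) (b m) (R m))) :
    ContMDiff IN (IB.prod 𝓘(ℝ, F₁ →L[ℝ] F₂)) n
      (fun m => TotalSpace.mk' (F₁ →L[ℝ] F₂) (E := fun x => E₁ x →L[ℝ] E₂ x) (b m)
        (L m + R m)) := by
  intro m₀
  obtain ⟨hb, hL'⟩ := (contMDiffAt_hom_bundle _).1 (hL m₀)
  obtain ⟨-, hR'⟩ := (contMDiffAt_hom_bundle _).1 (hR m₀)
  refine (contMDiffAt_hom_bundle _).2 ⟨hb, ?_⟩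
  refine (hL'.add hR').congr_of_eventuallyEq ?_
  have h2 : ∀ᶠ m in nhds m₀, b m ∈ (trivializationAt F₂ E₂ (b m₀)).baseSet :=
    hb.continuousAt ((trivializationAt F₂ E₂ (b m₀)).open_baseSet.mem_nhds
      (FiberBundle.mem_baseSet_trivializationAt' (b m₀)))
  have h1 : ∀ᶠ m in nhds m₀, b m ∈ (trivializationAt F₁ E₁ (b m₀)).baseSet :=
    hb.continuousAt ((trivializationAt F₁ E₁ (b m₀)).open_baseSet.mem_nhds
      (FiberBundle.mem_baseSet_trivializationAt' (b m₀)))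
  filter_upwards [h1, h2] with m hm1 hm2
  simp only [Pi.add_apply]
  rw [inCoordinates_eq hm1 hm2, inCoordinates_eq hm1 hm2, inCoordinates_eq hm1 hm2]
  ext w
  simp

theorem contMDiff_hom_smul (a : ℝ) {L : ∀ m, E₁ (b m) →L[ℝ] E₂ (b m)}
    (hL : ContMDiff IN (IB.prod 𝓘(ℝ, F₁ →L[ℝ] F₂)) n
      (fun m => TotalSpace.mk' (F₁ →L[ℝ] F₂) (E := fun x => E₁ x →L[ℝ] E₂ x) (b m) (L m))) :
    ContMDiff IN (IB.prod 𝓘(ℝ, F₁ →L[ℝ] F₂)) n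
      (fun m => TotalSpace.mk' (F₁ →L[ℝ] F₂) (E := fun x => E₁ x →L[ℝ] E₂ x) (b m)
        (a • L m)) := by
  intro m₀
  obtain ⟨hb, hL'⟩ := (contMDiffAt_hom_bundle _).1 (hL m₀)
  refine (contMDiffAt_hom_bundle _).2 ⟨hb, ?_⟩
  refine ((contDiff_const_smul a).contDiffAt.comp_contMDiffAt hL').congr_of_eventuallyEq ?_
  have h2 : ∀ᶠ m in nhds m₀, b m ∈ (trivializationAt F₂ E₂ (b m₀)).baseSet :=
    hb.continuousAt ((trivializationAt F₂ E₂ (b m₀)).open_baseSet.mem_nhds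
      (FiberBundle.mem_baseSet_trivializationAt' (b m₀)))
  have h1 : ∀ᶠ m in nhds m₀, b m ∈ (trivializationAt F₁ E₁ (b m₀)).baseSet :=
    hb.continuousAt ((trivializationAt F₁ E₁ (b m₀)).open_baseSet.mem_nhds
      (FiberBundle.mem_baseSet_trivializationAt' (b m₀)))
  filter_upwards [h1, h2] with m hm1 hm2
  rw [inCoordinates_eq hm1 hm2]
  simp only [Function.comp_apply]
  rw [inCoordinates_eq hm1 hm2]
  ext w
  simp

end HomBundles

/-! ### The adjoint representation of a Lie group -/

section Ad

variable {EK : Type*} [NormedAddCommGroup EK] [NormedSpace ℝ EK]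
  {K : Type*} [TopologicalSpace K] [ChartedSpace EK K] [Group K]

/-- The adjoint representation `Ad k` of a Lie group `K` modelled on `EK`: the derivative at `1` of
`x ↦ k x k⁻¹`. The Lie algebra `𝔨 = T₁K` is the vector space `EK`. -/
noncomputable def adRep (k : K) : EK →L[ℝ] EK :=
  mfderiv 𝓘(ℝ, EK) 𝓘(ℝ, EK) (fun x : K => k * x * k⁻¹) 1

theorem adRep_one : adRep (EK := EK) (1 : K) = ContinuousLinearMap.id ℝ EK := by
  have h : (fun x : K => 1 * x * 1⁻¹) = id := by ext x; simp
  unfold adRep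
  rw [h]
  exact mfderiv_id

variable [LieGroup 𝓘(ℝ, EK) ∞ K]

theorem contMDiff_conj (k : K) : ContMDiff 𝓘(ℝ, EK) 𝓘(ℝ, EK) ∞ (fun x : K => k * x * k⁻¹) :=
  (contMDiff_const.mul contMDiff_id).mul contMDiff_const

theorem adRep_mul (k l : K) : adRep (EK := EK) (k * l) = (adRep k).comp (adRep l) := by
  have h : (fun x : K => (k * l) * x * (k * l)⁻¹) =
      (fun x : K => k * x * k⁻¹) ∘ (fun x : K => l * x * l⁻¹) := by
    ext x; simp [mul_assoc]
  have h1 : l * 1 * l⁻¹ = (1 : K) := by simp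
  have key := mfderiv_comp (I := 𝓘(ℝ, EK)) (I' := 𝓘(ℝ, EK)) (I'' := 𝓘(ℝ, EK)) (1 : K)
    (g := fun x : K => k * x * k⁻¹) (f := fun x : K => l * x * l⁻¹)
    ((contMDiff_conj (EK := EK) k).mdifferentiable (by simp) _)
    ((contMDiff_conj (EK := EK) l).mdifferentiable (by simp) _)
  unfold adRep
  rw [h]
  refine key.trans ?_
  have : ∀ y : K, y = 1 → ((mfderiv 𝓘(ℝ, EK) 𝓘(ℝ, EK) (fun x : K => k * x * k⁻¹) y : EK →L[ℝ] EK)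
      = mfderiv 𝓘(ℝ, EK) 𝓘(ℝ, EK) (fun x : K => k * x * k⁻¹) 1) := by
    rintro y rfl; rfl
  exact congrArg (fun T : EK →L[ℝ] EK => T.comp
    (mfderiv 𝓘(ℝ, EK) 𝓘(ℝ, EK) (fun x : K => l * x * l⁻¹) 1 : EK →L[ℝ] EK)) (this _ h1)

theorem contMDiff_adRep : ContMDiff 𝓘(ℝ, EK) 𝓘(ℝ, EK →L[ℝ] EK) ∞ (adRep (EK := EK) (K := K)) := by
  intro k₀
  have : IsManifold 𝓘(ℝ, EK) ∞ K := LieGroup.toContMDiffMul.toIsManifold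
  have hf : ContMDiff (𝓘(ℝ, EK).prod 𝓘(ℝ, EK)) 𝓘(ℝ, EK) ∞
      (Function.uncurry (fun k x : K => k * x * k⁻¹)) :=
    (contMDiff_fst.mul contMDiff_snd).mul contMDiff_fst.inv
  have h := ContMDiffAt.mfderiv (m := ∞) (n := ∞) (x₀ := k₀) (fun k x : K => k * x * k⁻¹) (fun _ => (1 : K))
    (hf (k₀, 1)) contMDiffAt_const (by simp)
  refine h.congr_of_eventuallyEq (Filter.Eventually.of_forall fun k => ?_)
  refine Eq.trans ?_ (inTangentCoordinates_eq (I := 𝓘(ℝ, EK)) (I' := 𝓘(ℝ, EK)) (x₀ := k₀) (x := k)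
    (fun _ : K => (1 : K)) (fun k : K => k * 1 * k⁻¹) (fun k => adRep k)
    (mem_chart_source _ _) (by simp)).symm
  ext v
  have e1 : ∀ y z : K, y = 1 → z = 1 → ∀ w : EK, (tangentBundleCore 𝓘(ℝ, EK) K).coordChange (achart EK y) (achart EK z) y w = w := by
    rintro y z rfl rfl w
    exact (tangentBundleCore 𝓘(ℝ, EK) K).coordChange_self _ _ (by simp) _
  have e2 := e1 1 1 rfl rfl v
  have e3 := e1 (k * 1 * k⁻¹) (k₀ * 1 * k₀⁻¹) (by simp) (by simp) (adRep k v)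
  refine (e3.symm.trans ?_)
  change _ = (tangentBundleCore 𝓘(ℝ, EK) K).coordChange _ _ _ (adRep k ((tangentBundleCore 𝓘(ℝ, EK) K).coordChange _ _ _ v))
  rw [e2]
end Ad

/-! ### Surfaces, orientation, integration -/

/-- The model plane `ℝ²`. -/
abbrev Plane : Type := EuclideanSpace ℝ (Fin 2)

section Surface

variable (S : Type*) [TopologicalSpace S] [ChartedSpace Plane S]

/-- The atlas of `S` is oriented: all transition maps between its charts have positive Jacobian.
The orientation of `S` is the one for which all charts of the atlas are positive. -/
def IsOrientedAtlas : Prop :=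
  ∀ e ∈ atlas Plane S, ∀ e' ∈ atlas Plane S, ∀ y ∈ (e.symm.trans e').source,
    0 < (fderiv ℝ (e.symm.trans e') y).det

variable {S}

/-- The standard area form of `ℝ²`. -/
def planeArea (u v : Plane) : ℝ := u 0 * v 1 - u 1 * v 0

variable [IsManifold (𝓡 2) ∞ S] [T2Space S] [SigmaCompactSpace S]

/-- The integral over `S` (oriented by its atlas) of the 2-form `η`, given by its values
`η x u v` on tangent vectors `u v` at `x`: the sum over a smooth partition of unity subordinate to
charts of the integrals over the chart images in `ℝ²` of the coefficient of `dy₁ ∧ dy₂`. -/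
noncomputable def surfaceIntegral
    (η : ∀ x : S, TangentSpace (𝓡 2) x → TangentSpace (𝓡 2) x → ℝ) : ℝ :=
  ∑ᶠ i : S, ∫ y in (chartAt Plane i).target,
    (SmoothPartitionOfUnity.exists_isSubordinate_chartAt_source (𝓡 2) S).choose i
        ((chartAt Plane i).symm y) *
      η ((chartAt Plane i).symm y)
        (mfderiv 𝓘(ℝ, Plane) (𝓡 2) (chartAt Plane i).symm y (EuclideanSpace.single 0 1 : Plane))
        (mfderiv 𝓘(ℝ, Plane) (𝓡 2) (chartAt Plane i).symm y (EuclideanSpace.single 1 1 : Plane))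

end Surface

section Fields

variable (S : Type*) [TopologicalSpace S] [ChartedSpace Plane S] [IsManifold (𝓡 2) ∞ S]

/-- Smooth sections of `End(TS)`. -/
abbrev EndField : Type _ :=
  Cₛ^∞⟮𝓡 2; Plane →L[ℝ] Plane,
    fun x : S => TangentSpace (𝓡 2) x →L[ℝ] TangentSpace (𝓡 2) x⟯

noncomputable instance : AddCommGroup (EndField S) := inferInstance
noncomputable instance : Module ℝ (EndField S) := inferInstance
noncomputable instance : MulAction ℝ (EndField S) := Module.toDistribMulAction.toMulAction

/-- The space `𝒥` of complex structures on the surface `S` compatible with the orientation: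
smooth `J` with `J² = -1` and such that `(v, J v)` is a positive basis for every `v ≠ 0`.
(Tangent vectors at `x` are read in the chart at `x`, which is positive.) -/
structure ComplexStructure where
  toEnd : EndField S
  sq : ∀ x, (toEnd x).comp (toEnd x) = -ContinuousLinearMap.id ℝ (TangentSpace (𝓡 2) x)
  pos : ∀ (x : S) (v : TangentSpace (𝓡 2) x), v ≠ 0 → 0 < planeArea v (toEnd x v)

variable {S}

/-- Composition of smooth endomorphism fields. -/
noncomputable def EndField.comp (C D : EndField S) : EndField S where
  toFun x := (C x).comp (D x)
  contMDiff_toFun := contMDiff_hom_comp (b := fun x : S => x) C.contMDiff D.contMDiff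

/-- The tangent space `T_J 𝒥`: endomorphism fields anticommuting with `J`. -/
def tangentJ (J : ComplexStructure S) : Submodule ℝ (EndField S) where
  carrier := {C | ∀ x, (C x).comp (J.toEnd x) = -(J.toEnd x).comp (C x)}
  zero_mem' x := by ext v; simp
  add_mem' {C D} hC hD x := by
    have h1 := hC x
    have h2 := hD x
    simp only [ContMDiffSection.coe_add, Pi.add_apply, ContinuousLinearMap.add_comp,
      ContinuousLinearMap.comp_add, h1, h2]
    abel
  smul_mem' a C hC x := by
    have h1 := hC x
    simp only [ContMDiffSection.coe_smul, Pi.smul_apply, ContinuousLinearMap.smul_comp,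
      ContinuousLinearMap.comp_smul, h1, smul_neg]

/-- A family of endomorphism fields depending smoothly on a parameter. -/
def IsSmoothEndFamily {P : Type*} [NormedAddCommGroup P] [NormedSpace ℝ P]
    (C : P → EndField S) : Prop :=
  ContMDiff (𝓘(ℝ, P).prod (𝓡 2)) ((𝓡 2).prod 𝓘(ℝ, Plane →L[ℝ] Plane)) ∞
    (fun q : P × S => Bundle.TotalSpace.mk' (Plane →L[ℝ] Plane)
      (E := fun x : S => TangentSpace (𝓡 2) x →L[ℝ] TangentSpace (𝓡 2) x) q.2 (C q.1 q.2))

end Fields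

/-! ### Principal bundles, connections, adjoint-valued one-forms -/

section Principal

variable (S : Type*) [TopologicalSpace S] [ChartedSpace Plane S]
  (EK : Type*) [NormedAddCommGroup EK] [NormedSpace ℝ EK]
  (K : Type*) [TopologicalSpace K] [ChartedSpace EK K] [Group K]
  (ι : Type*)

/-- A smooth principal `K`-bundle over `S`, given by an open cover with smooth transition functions
`g i j = transition i j` satisfying the cocycle condition (local sections are related by
`s j = s i · g i j`). As for Mathlib's `FiberBundleCore`, a preferred trivialization `indexAt x`
around each point `x` is part of the data. -/
structure PrincipalBundleCore where
  baseSet : ι → Set S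
  isOpen_baseSet : ∀ i, IsOpen (baseSet i)
  indexAt : S → ι
  mem_baseSet_at : ∀ x, x ∈ baseSet (indexAt x)
  transition : ι → ι → S → K
  contMDiffOn_transition : ∀ i j,
    ContMDiffOn (𝓡 2) 𝓘(ℝ, EK) ∞ (transition i j) (baseSet i ∩ baseSet j)
  transition_self : ∀ i, ∀ x ∈ baseSet i, transition i i x = 1
  transition_comp : ∀ i j k, ∀ x ∈ baseSet i ∩ baseSet j ∩ baseSet k,
    transition i j x * transition j k x = transition i k x

variable {S EK K ι} [LieGroup 𝓘(ℝ, EK) ∞ K]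

/-- The adjoint bundle `E_K(𝔨)` of the principal bundle `P`, as a vector bundle core: its change of
trivialization from `i` to `j` is `Ad (g i j)⁻¹ = Ad (g j i)`. -/
noncomputable def PrincipalBundleCore.adjoint (P : PrincipalBundleCore S EK K ι) :
    VectorBundleCore ℝ S EK ι where
  baseSet := P.baseSet
  isOpen_baseSet := P.isOpen_baseSet
  indexAt := P.indexAt
  mem_baseSet_at := P.mem_baseSet_at
  coordChange i j x := adRep (P.transition j i x)
  coordChange_self i x hx v := by
    rw [P.transition_self i x hx, adRep_one]; rfl
  continuousOn_coordChange i j :=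
    (contMDiff_adRep (EK := EK) (K := K)).continuous.comp_continuousOn
      ((P.contMDiffOn_transition j i).continuousOn.mono (by rw [Set.inter_comm]))
  coordChange_comp i j k x hx v := by
    rw [← P.transition_comp k j i x ⟨⟨hx.2, hx.1.2⟩, hx.1.1⟩, adRep_mul]; rfl

instance (P : PrincipalBundleCore S EK K ι) : P.adjoint.IsContMDiff (𝓡 2) ∞ where
  contMDiffOn_coordChange i j :=
    (contMDiff_adRep (EK := EK) (K := K)).comp_contMDiffOn
      ((P.contMDiffOn_transition j i).mono (by rw [Set.inter_comm]; exact subset_rfl))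

instance (P : PrincipalBundleCore S EK K ι) (x : S) :
    IsTopologicalAddGroup (P.adjoint.Fiber x) :=
  inferInstanceAs (IsTopologicalAddGroup EK)

instance (P : PrincipalBundleCore S EK K ι) (x : S) : ContinuousSMul ℝ (P.adjoint.Fiber x) :=
  inferInstanceAs (ContinuousSMul ℝ EK)

variable [IsManifold (𝓡 2) ∞ S]

/-- The space `Ω¹(S, E_K(𝔨))` of smooth one-forms with values in the adjoint bundle. -/
abbrev OneForm (P : PrincipalBundleCore S EK K ι) : Type _ :=
  Cₛ^∞⟮𝓡 2; Plane →L[ℝ] EK, fun x : S => TangentSpace (𝓡 2) x →L[ℝ] P.adjoint.Fiber x⟯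

noncomputable instance (P : PrincipalBundleCore S EK K ι) : AddCommGroup (OneForm P) :=
  inferInstance
noncomputable instance (P : PrincipalBundleCore S EK K ι) : Module ℝ (OneForm P) := inferInstance

/-- A family of adjoint-valued one-forms depending smoothly on a parameter. -/
def IsSmoothFormFamily {P : PrincipalBundleCore S EK K ι}
    {Q : Type*} [NormedAddCommGroup Q] [NormedSpace ℝ Q] (a : Q → OneForm P) : Prop :=
  ContMDiff (𝓘(ℝ, Q).prod (𝓡 2)) ((𝓡 2).prod 𝓘(ℝ, Plane →L[ℝ] EK)) ∞
    (fun q : Q × S => Bundle.TotalSpace.mk' (Plane →L[ℝ] EK)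
      (E := fun x : S => TangentSpace (𝓡 2) x →L[ℝ] P.adjoint.Fiber x) q.2 (a q.1 q.2))

/-- `a.comp C` is the adjoint-valued one-form `a(C) = a ∘ C`. -/
noncomputable def OneForm.comp {P : PrincipalBundleCore S EK K ι} (a : OneForm P) (C : EndField S) :
    OneForm P where
  toFun x := (a x).comp (C x)
  contMDiff_toFun := contMDiff_hom_comp (b := fun x : S => x) a.contMDiff C.contMDiff

/-- The pull-back `g⁻¹ dg` of the left Maurer-Cartan form of `K` by `g`. -/
noncomputable def mcPullback (g : S → K) (x : S) : TangentSpace (𝓡 2) x →L[ℝ] EK :=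
  mfderiv (𝓡 2) 𝓘(ℝ, EK) (fun y => (g x)⁻¹ * g y) x

/-- A connection on the principal bundle `P`, given by its gauge potentials in the local
trivializations, related by `A j = Ad (g i j)⁻¹ (A i) + (g i j)⁻¹ d(g i j)`. (The irrelevant values
of a potential outside its domain are normalised to be zero.) -/
structure Connection (P : PrincipalBundleCore S EK K ι) where
  pot : ι → ∀ x : S, TangentSpace (𝓡 2) x →L[ℝ] EK
  contMDiffOn_pot : ∀ i, ContMDiffOn (𝓡 2) ((𝓡 2).prod 𝓘(ℝ, Plane →L[ℝ] EK)) ∞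
    (fun x : S => Bundle.TotalSpace.mk' (Plane →L[ℝ] EK)
      (E := fun x : S => TangentSpace (𝓡 2) x →L[ℝ] Bundle.Trivial S EK x) x (pot i x))
    (P.baseSet i)
  gauge : ∀ i j, ∀ x ∈ P.baseSet i ∩ P.baseSet j,
    pot j x = (adRep (P.transition j i x)).comp (pot i x) + mcPullback (P.transition i j) x
  pot_eq_zero : ∀ i, ∀ x ∉ P.baseSet i, pot i x = 0

/-- A family of connections depending smoothly on a parameter. -/
def IsSmoothConnectionFamily {P : PrincipalBundleCore S EK K ι}
    {Q : Type*} [NormedAddCommGroup Q] [NormedSpace ℝ Q] (A : Q → Connection P) : Prop :=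
  ∀ i, ContMDiffOn (𝓘(ℝ, Q).prod (𝓡 2)) ((𝓡 2).prod 𝓘(ℝ, Plane →L[ℝ] EK)) ∞
    (fun q : Q × S => Bundle.TotalSpace.mk' (Plane →L[ℝ] EK)
      (E := fun x : S => TangentSpace (𝓡 2) x →L[ℝ] Bundle.Trivial S EK x) q.2
      ((A q.1).pot i q.2))
    (Set.univ ×ˢ P.baseSet i)

/-- An inner product on the Lie algebra of `K` invariant under the adjoint representation. -/
structure InvariantMetric (EK : Type*) [NormedAddCommGroup EK] [NormedSpace ℝ EK]
    (K : Type*) [TopologicalSpace K] [ChartedSpace EK K] [Group K] where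
  form : EK →ₗ[ℝ] EK →ₗ[ℝ] ℝ
  symm : ∀ ξ ζ, form ξ ζ = form ζ ξ
  pos : ∀ ξ, ξ ≠ 0 → 0 < form ξ ξ
  invariant : ∀ (k : K) (ξ ζ : EK), form (adRep k ξ) (adRep k ζ) = form ξ ζ

variable [T2Space S] [SigmaCompactSpace S]

/-- `∫_S B(a ∧ b)` for adjoint-valued one-forms `a`, `b`, where
`B(a ∧ b)(u, v) = B(a(u), b(v)) - B(a(v), b(u))`. By invariance of `B` the integrand does not
depend on the trivialization in which the values in the adjoint bundle are read. -/
noncomputable def pairing (B : InvariantMetric EK K) {P : PrincipalBundleCore S EK K ι}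
    (a b : OneForm P) : ℝ :=
  surfaceIntegral (S := S) fun x u v => B.form (a x u) (b x v) - B.form (a x v) (b x u)

end Principal

/-! ### The configuration space and its complex structure -/

section Configuration

variable {S : Type*} [TopologicalSpace S] [ChartedSpace Plane S] [IsManifold (𝓡 2) ∞ S]
  {EK : Type*} [NormedAddCommGroup EK] [NormedSpace ℝ EK]
  {K : Type*} [TopologicalSpace K] [ChartedSpace EK K] [Group K] [LieGroup 𝓘(ℝ, EK) ∞ K]
  {ι : Type*}

/-- The space `𝒳 = 𝒥 × 𝒜 × Ω¹(S, E_K(𝔨))` of triples `(J, A, ψ)`, fibred over `𝒥` by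
`(J, A, ψ) ↦ J`. -/
structure Config (P : PrincipalBundleCore S EK K ι) where
  J : ComplexStructure S
  A : Connection P
  ψ : OneForm P

variable {P : PrincipalBundleCore S EK K ι}

/-- The tangent space of `𝒳` at `p`: triples `(J', a, ψ')`. -/
abbrev Tangent (p : Config P) : Type _ := tangentJ p.J × OneForm P × OneForm P

noncomputable instance (p : Config P) : AddCommGroup (Tangent p) := inferInstance
noncomputable instance (p : Config P) : Module ℝ (Tangent p) := inferInstance

/-- The vertical space of `𝒳 → 𝒥` at `p`: the triples `(0, a, ψ')`. -/
noncomputable def vertical (p : Config P) : Submodule ℝ (Tangent p) :=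
  LinearMap.ker (LinearMap.fst ℝ (tangentJ p.J) (OneForm P × OneForm P))

/-- The complex structure `J' ↦ J J'` on `T_J 𝒥`. -/
noncomputable def mulJ (J : ComplexStructure S) : tangentJ J →ₗ[ℝ] tangentJ J where
  toFun C := ⟨J.toEnd.comp C, fun x => by
    have h := C.2 x
    change ((J.toEnd x).comp ((C : EndField S) x)).comp (J.toEnd x) =
      -(J.toEnd x).comp ((J.toEnd x).comp ((C : EndField S) x))
    rw [ContinuousLinearMap.comp_assoc, h, ContinuousLinearMap.comp_neg]⟩
  map_add' C D := by
    ext x v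
    exact map_add (J.toEnd x) _ _
  map_smul' r C := by
    ext x v
    exact map_smul (J.toEnd x) r _

/-- The complex structure `𝕀 (J', a, ψ') = (J J', J a, - J ψ' + ψ(J'))` of `𝒳`, where
`J a = - a ∘ J` for a one-form `a`. -/
noncomputable def complexI (p : Config P) : Tangent p →ₗ[ℝ] Tangent p where
  toFun v := (mulJ p.J v.1, -(v.2.1.comp p.J.toEnd), v.2.2.comp p.J.toEnd + p.ψ.comp v.1)
  map_add' v w := by
    refine Prod.ext (map_add _ _ _) (Prod.ext ?_ ?_)
    · ext x u
      exact neg_add _ _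
    · ext x u
      change (v.2.2 x + w.2.2 x) (p.J.toEnd x u) + p.ψ x ((v.1 : EndField S) x u +
        (w.1 : EndField S) x u) = _
      rw [map_add, add_apply]
      exact add_add_add_comm _ _ _ _
  map_smul' r v := by
    refine Prod.ext (map_smul _ _ _) (Prod.ext ?_ ?_)
    · ext x u
      exact (smul_neg r _).symm
    · ext x u
      change r • (v.2.2 x) (p.J.toEnd x u) + p.ψ x (r • (v.1 : EndField S) x u) = _
      rw [map_smul]
      exact (smul_add r _ _).symm

/-! Smoothness in `𝒳` is smoothness of parametrised families: a family of triples is smooth if all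
fields depend smoothly on the parameter and the point of `S` jointly. -/

/-- A smoothly parametrised family of points of `𝒳`. -/
structure IsSmoothFamily {Q : Type*} [NormedAddCommGroup Q] [NormedSpace ℝ Q]
    (c : Q → Config P) : Prop where
  smooth_J : IsSmoothEndFamily fun t => (c t).J.toEnd
  smooth_A : IsSmoothConnectionFamily fun t => (c t).A
  smooth_ψ : IsSmoothFormFamily fun t => (c t).ψ

/-- A smooth family of tangent vectors along a family of points of `𝒳`. -/
structure IsSmoothVectorFamily {Q : Type*} [NormedAddCommGroup Q] [NormedSpace ℝ Q]
    (c : Q → Config P) (v : ∀ t, Tangent (c t)) : Prop where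
  smooth_J : IsSmoothEndFamily fun t => ((v t).1 : EndField S)
  smooth_A : IsSmoothFormFamily fun t => (v t).2.1
  smooth_ψ : IsSmoothFormFamily fun t => (v t).2.2

/-- `v` is the derivative at `t` of the family `c` in the direction `e`. (The derivative of a
connection is read in the trivialization in which the fibre of the adjoint bundle is read.) -/
structure HasVelocity {Q : Type*} [NormedAddCommGroup Q] [NormedSpace ℝ Q]
    (c : Q → Config P) (t e : Q) (v : Tangent (c t)) : Prop where
  deriv_J : ∀ x, HasDerivAt (fun s : ℝ => (c (t + s • e)).J.toEnd x) ((v.1 : EndField S) x) 0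
  deriv_A : ∀ x, HasDerivAt (fun s : ℝ => ((c (t + s • e)).A.pot (P.indexAt x) x :
    TangentSpace (𝓡 2) x →L[ℝ] P.adjoint.Fiber x)) (v.2.1 x) 0
  deriv_ψ : ∀ x, HasDerivAt (fun s : ℝ => (c (t + s • e)).ψ x) (v.2.2 x) 0

/-! ### Differential forms on the configuration space -/

/-- `σ` is a smooth real 2-form on `𝒳`. -/
structure IsTwoForm (σ : ∀ p : Config P, Tangent p → Tangent p → ℝ) : Prop where
  add_left : ∀ p u v w, σ p (u + v) w = σ p u w + σ p v w
  smul_left : ∀ p (r : ℝ) v w, σ p (r • v) w = r * σ p v w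
  antisymm : ∀ p v w, σ p v w = -σ p w v
  smooth : ∀ (n : ℕ) (c : (Fin n → ℝ) → Config P) (v w : ∀ t, Tangent (c t)),
    IsSmoothFamily c → IsSmoothVectorFamily c v → IsSmoothVectorFamily c w →
    ContDiff ℝ ∞ fun t => σ (c t) (v t) (w t)

/-- `dσ = 0`: for every smooth 3-parameter family `c` with partial derivatives `v 0, v 1, v 2`, the
exterior derivative of the pull-back of `σ` by `c` vanishes,
`∂₀ (σ(v₁, v₂)) + ∂₁ (σ(v₂, v₀)) + ∂₂ (σ(v₀, v₁)) = 0`. -/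
def IsClosedForm (σ : ∀ p : Config P, Tangent p → Tangent p → ℝ) : Prop :=
  ∀ (c : (Fin 3 → ℝ) → Config P) (v : Fin 3 → ∀ t, Tangent (c t)), IsSmoothFamily c →
    (∀ i t, HasVelocity c t (Pi.single i 1) (v i t)) →
    (∀ i j, Differentiable ℝ fun t => σ (c t) (v i t) (v j t)) ∧
    ∀ t, lineDeriv ℝ (fun t => σ (c t) (v 1 t) (v 2 t)) t (Pi.single 0 1) +
      lineDeriv ℝ (fun t => σ (c t) (v 2 t) (v 0 t)) t (Pi.single 1 1) +
      lineDeriv ℝ (fun t => σ (c t) (v 0 t) (v 1 t)) t (Pi.single 2 1) = 0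

/-- `σ` is of type `(1,1)` with respect to `𝕀`. -/
def IsType11 (σ : ∀ p : Config P, Tangent p → Tangent p → ℝ) : Prop :=
  ∀ p v w, σ p (complexI p v) (complexI p w) = σ p v w

/-! ### Ehresmann connections on `𝒳 → 𝒥` -/

/-- An Ehresmann connection on `𝒳 → 𝒥`: a smooth distribution of horizontal subspaces,
complementary to the vertical ones. -/
structure EhresmannConnection (P : PrincipalBundleCore S EK K ι) where
  horizontal : ∀ p : Config P, Submodule ℝ (Tangent p)
  isCompl : ∀ p, IsCompl (vertical p) (horizontal p)
  smooth : ∀ (n : ℕ) (c : (Fin n → ℝ) → Config P) (v : ∀ t, Tangent (c t)),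
    IsSmoothFamily c → IsSmoothVectorFamily c v → IsSmoothVectorFamily c fun t =>
      (Submodule.projectionOnto (vertical (c t)) (horizontal (c t)) (isCompl (c t)) (v t) :
        Tangent (c t))

/-- The vertical projection `T𝒳 → V𝒳` along the horizontal spaces. -/
noncomputable def EhresmannConnection.proj (Γ : EhresmannConnection P) (p : Config P) :
    Tangent p →ₗ[ℝ] vertical p :=
  Submodule.projectionOnto (vertical p) (Γ.horizontal p) (Γ.isCompl p)

/-- `c` is a horizontal lift to `𝒳` of the path `γ` in `𝒥`. -/
structure IsHorizontalLift (Γ : EhresmannConnection P) (γ : ℝ → ComplexStructure S)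
    (c : ℝ → Config P) : Prop where
  smooth : IsSmoothFamily c
  lift : ∀ t, (c t).J = γ t
  horizontal : ∀ t, ∃ v ∈ Γ.horizontal (c t), HasVelocity c t 1 v

/-- `q` is the parallel transport of `p` along the path `γ` from time `s` to time `t`. -/
def IsParallelTransport (Γ : EhresmannConnection P) (γ : ℝ → ComplexStructure S) (s t : ℝ)
    (p q : Config P) : Prop :=
  ∃ c, IsHorizontalLift Γ γ c ∧ c s = p ∧ c t = q

/-- The lift `J' ↦ (J', 0, -½ ψ(J J'))`. -/
noncomputable def liftI (p : Config P) : tangentJ p.J →ₗ[ℝ] Tangent p where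
  toFun C := (C, 0, -(1 / 2 : ℝ) • p.ψ.comp (mulJ p.J C : EndField S))
  map_add' C D := by
    refine Prod.ext rfl (Prod.ext (add_zero _).symm ?_)
    ext x u
    change -(1 / 2 : ℝ) • p.ψ x (((mulJ p.J (C + D) : tangentJ p.J) : EndField S) x u) = _
    rw [map_add]
    change -(1 / 2 : ℝ) • p.ψ x (((mulJ p.J C : tangentJ p.J) : EndField S) x u +
      ((mulJ p.J D : tangentJ p.J) : EndField S) x u) = _
    rw [map_add, smul_add]
    rfl
  map_smul' r C := by
    refine Prod.ext rfl (Prod.ext (smul_zero _).symm ?_)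
    ext x u
    change -(1 / 2 : ℝ) • p.ψ x (((mulJ p.J (r • C) : tangentJ p.J) : EndField S) x u) = _
    rw [map_smul]
    change -(1 / 2 : ℝ) • p.ψ x (r • ((mulJ p.J C : tangentJ p.J) : EndField S) x u) = _
    rw [map_smul, smul_comm]
    rfl

theorem isCompl_liftI (p : Config P) : IsCompl (vertical p) (LinearMap.range (liftI p)) := by
  have h : ∀ v : Tangent p, v ∈ vertical p ↔ v.1 = 0 := fun v => Iff.rfl
  rw [isCompl_iff, Submodule.disjoint_def, codisjoint_iff, eq_top_iff]
  refine ⟨?_, ?_⟩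
  · rintro _ hv ⟨C, rfl⟩
    have hC : C = 0 := (h _).1 hv
    rw [hC, map_zero]
  · intro v _
    refine Submodule.mem_sup.2 ⟨v - liftI p v.1, (h _).2 (sub_self v.1), liftI p v.1, ⟨_, rfl⟩, ?_⟩
    exact sub_add_cancel _ _

theorem projectionOnto_liftI (p : Config P) (v : Tangent p) :
    ((Submodule.projectionOnto (vertical p) (LinearMap.range (liftI p)) (isCompl_liftI p) v :
      vertical p) : Tangent p) = v - liftI p v.1 := by
  have hv : v - liftI p v.1 ∈ vertical p := sub_self v.1
  have h1 := Submodule.projectionOnto_apply_left (isCompl_liftI p) ⟨_, hv⟩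
  have h2 := Submodule.projectionOnto_apply_right (isCompl_liftI p) ⟨liftI p v.1, ⟨_, rfl⟩⟩
  have h3 : v = (v - liftI p v.1) + liftI p v.1 := (sub_add_cancel _ _).symm
  conv_lhs => rw [h3]
  rw [map_add, h2, add_zero, h1]

/-- The Ehresmann connection `Γ^𝕀` with horizontal spaces `{(J', 0, -½ ψ(J J'))}`. -/
noncomputable def connectionI (P : PrincipalBundleCore S EK K ι) : EhresmannConnection P where
  horizontal p := LinearMap.range (liftI p)
  isCompl := isCompl_liftI
  smooth n c v hc hv := by
    have e : (fun t => (Submodule.projectionOnto (vertical (c t)) (LinearMap.range (liftI (c t)))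
        (isCompl_liftI (c t)) (v t) : Tangent (c t))) = fun t => v t - liftI (c t) (v t).1 :=
      funext fun t => projectionOnto_liftI (c t) (v t)
    rw [e]
    refine ⟨?_, ?_, ?_⟩
    · refine (contMDiff_hom_add hv.smooth_J (contMDiff_hom_smul (-1) hv.smooth_J)).congr fun q => ?_
      refine congrArg (Bundle.TotalSpace.mk q.2) ?_
      rw [neg_one_smul, ← sub_eq_add_neg]
      rfl
    · refine hv.smooth_A.congr fun q => ?_
      refine congrArg (Bundle.TotalSpace.mk q.2) ?_
      exact sub_zero ((v q.1).2.1 q.2)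
    · have h := contMDiff_hom_comp hc.smooth_ψ (contMDiff_hom_comp hc.smooth_J hv.smooth_J)
      refine (contMDiff_hom_add hv.smooth_ψ (contMDiff_hom_smul (1 / 2) h)).congr fun q => ?_
      refine congrArg (Bundle.TotalSpace.mk q.2) ?_
      have h1 : ∀ T U : TangentSpace (𝓡 2) q.2 →L[ℝ] P.adjoint.Fiber q.2,
          T - -(1 / 2 : ℝ) • U = T + (1 / 2 : ℝ) • U := fun T U => by
        rw [neg_smul, sub_neg_eq_add]
      exact h1 _ _

variable [T2Space S] [SigmaCompactSpace S]

/-! ### The fibrewise Kähler form and the coupling form -/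

/-- The fibrewise symplectic form
`ω̂_I ((0, a₁, ψ₁), (0, a₂, ψ₂)) = ∫ B(a₁ ∧ a₂) - ∫ B(ψ₁ ∧ ψ₂)`. -/
noncomputable def fibreForm (B : InvariantMetric EK K) (p : Config P) (v w : vertical p) : ℝ :=
  pairing B (v : Tangent p).2.1 (w : Tangent p).2.1 -
    pairing B (v : Tangent p).2.2 (w : Tangent p).2.2

/-- `Γ` is a Kähler connection for the fibration `(𝒳, 𝕀, ω̂_I)`: its horizontal distribution is
complex, parallel transport between the fibres is defined along every smooth path in `𝒥`, and it is
smooth and preserves the Kähler forms of the fibres. Preservation of the fibre forms under parallel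
transport is expressed on arbitrary smooth families `p` of points in a fibre. -/
structure IsKaehlerConnection (B : InvariantMetric EK K) (Γ : EhresmannConnection P) : Prop where
  complex : ∀ p, ∀ v ∈ Γ.horizontal p, complexI p v ∈ Γ.horizontal p
  existsUnique_lift : ∀ γ : ℝ → ComplexStructure S, IsSmoothEndFamily (fun t => (γ t).toEnd) →
    ∀ s p, p.J = γ s → ∃! c, IsHorizontalLift Γ γ c ∧ c s = p
  preserves : ∀ γ : ℝ → ComplexStructure S, IsSmoothEndFamily (fun t => (γ t).toEnd) →
    ∀ (s t : ℝ) (n : ℕ) (p q : (Fin n → ℝ) → Config P), IsSmoothFamily p →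
    (∀ r, IsParallelTransport Γ γ s t (p r) (q r)) →
    IsSmoothFamily q ∧ ∀ (r e₁ e₂ : Fin n → ℝ) (v₁ v₂ : vertical (p r)),
      HasVelocity p r e₁ v₁ → HasVelocity p r e₂ v₂ →
      ∃ w₁ w₂ : vertical (q r), HasVelocity q r e₁ w₁ ∧ HasVelocity q r e₂ w₂ ∧
        fibreForm B (q r) w₁ w₂ = fibreForm B (p r) v₁ v₂

/-- `σ` is a coupling form for `Γ`: a closed 2-form of type `(1,1)` which restricts to `ω̂_I` on the
fibres, and whose orthogonal complement to the vertical spaces is the horizontal distribution. -/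
structure IsCouplingForm (B : InvariantMetric EK K) (Γ : EhresmannConnection P)
    (σ : ∀ p : Config P, Tangent p → Tangent p → ℝ) : Prop where
  isTwoForm : IsTwoForm σ
  closed : IsClosedForm σ
  type11 : IsType11 σ
  restrict : ∀ p (v w : vertical p), σ p v w = fibreForm B p v w
  horizontal_iff : ∀ p v, v ∈ Γ.horizontal p ↔ ∀ w ∈ vertical p, σ p v w = 0

/-- The 2-form `μ (v₁, v₂) = ¼ ∫ B(ψ(J'₁) ∧ ψ(J'₂))`. -/
noncomputable def mu (B : InvariantMetric EK K) (p : Config P) (v w : Tangent p) : ℝ :=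
  1 / 4 * pairing B (p.ψ.comp v.1) (p.ψ.comp w.1)

/-- `σ^𝕀 = ω̂_I (Γ^𝕀, Γ^𝕀) - μ`. -/
noncomputable def sigmaI (B : InvariantMetric EK K) (p : Config P) (v w : Tangent p) : ℝ :=
  fibreForm B p ((connectionI P).proj p v) ((connectionI P).proj p w) - mu B p v w

end Configuration

end HiggsFibration

/-!
The horizontal lift of a path `J` in `𝒥` keeps the connection `A` fixed and moves `ψ` by the linear
equation `ψ' = -½ ψ ∘ (J J')`, which contains no derivatives along the surface. At each point it is an
ordinary differential equation in a plane. Its fundamental solution `U` starting at `J₀ = J(s)` is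
explicit (`rotor`): up to a rotation commuting with `J₀` it is `1 - J₀ J`, normalised by the positive
number `2 - tr (J₀ J)`, and the angle of the rotation is a primitive in time of an explicit function
(`hasDerivAt_rotor`). So `U` is smooth on the surface, parallel transport is
`(J(s), A, ψ) ↦ (J(t), A, ψ ∘ U)`, and uniqueness holds because `ψ U⁻¹` is constant along any lift. As
`J J'` has trace zero, `U` has determinant one, and `B((a ∘ U) ∧ (b ∘ U)) = det U · B(a ∧ b)`
(`wedge_comp_comp`) shows that the fibre forms are preserved: `isKaehlerConnection_connectionI`.

The algebra of `σ` rests on the same identity for `U = J`, which gives the type `(1,1)`, and on the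
vertical projection `(J', a, ψ') ↦ (0, a, ψ' + ½ ψ(J J'))`, which gives both formulas. The horizontal
spaces are the orthogonal complements of the vertical ones because `∫ B((a ∘ J) ∧ a)` is the integral
of a positive multiple of `|a|²` with respect to the orientation
(`eq_zero_of_pairing_comp_J_eq_zero`); this uses that the atlas is oriented.

Closedness is proved under the integral sign. At a point of the surface the integrand `η` of `σ` is,
along a smooth family of configurations, the exterior derivative of
`½ B(A ∧ A') - ½ B(ψ ∧ ψ') - ¼ B(ψ ∧ ψ(J J'))` (`primitive`, `exterior_derivative_primitive`): the
traceless endomorphisms `J'` and `J J'` act skew-symmetrically on one-forms (`wedge_comp_add`), and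
mixed second derivatives cancel. Hence the cyclic sum of the derivatives of `η` vanishes pointwise
(`cyclic_sum_sigmaDensity`), and so does its integral.

The analytic input is that the integral over the surface of a smooth family of two-forms is smooth in
the parameter and may be differentiated under the integral sign (`contDiff_surfaceIntegral`,
`lineDeriv_surfaceIntegral`), and that velocities of smooth families are smooth families of tangent
vectors.
-/

namespace HiggsFibration

/-! ### Integrals depending on a parameter -/

section ParametricIntegral

open MeasureTheory Set

theorem integrable_of_compact {E : Type*} [NormedAddCommGroup E] [MeasurableSpace E] [BorelSpace E]
    {μ : Measure E} [IsFiniteMeasureOnCompacts μ] {f : E → ℝ} {k : Set E}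
    (hk : IsCompact k) (hf0 : ∀ y ∉ k, f y = 0) (hf : Continuous f) : Integrable f μ :=
  hf.integrable_of_hasCompactSupport (HasCompactSupport.intro hk hf0)

variable {Q : Type*} [NormedAddCommGroup Q] [NormedSpace ℝ Q]
  {E : Type*} [NormedAddCommGroup E] [NormedSpace ℝ E]
  [MeasurableSpace E] [BorelSpace E]

/-- The integral of `w • F q` over the whole space is `C^∞` in the parameter `q` when `w` is locally
integrable and `F` is smooth with uniformly compact support: it is the value at `0` of the
convolution of `w` with the reflection of `F q`. -/
theorem contDiffOn_integral_mul_of_compact {μ : Measure E} [μ.IsAddHaarMeasure] {w : E → ℝ}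
    (hw : LocallyIntegrable w μ) {F : Q → E → ℝ} {s : Set Q} (hs : IsOpen s) {k : Set E}
    (hk : IsCompact k) (hF0 : ∀ q ∈ s, ∀ y ∉ k, F q y = 0)
    (hF : ContDiffOn ℝ ∞ (Function.uncurry F) (s ×ˢ univ)) :
    ContDiffOn ℝ ∞ (fun q => ∫ y, w y * F q y ∂μ) s := by
  have h := contDiffOn_convolution_right_with_param_comp (n := ⊤) (μ := μ)
    (ContinuousLinearMap.mul ℝ ℝ) (s := s) (v := fun _ : Q => (0 : E)) (f := w)
    (g := fun q y => F q (-y)) (k := -k) contDiffOn_const hs hk.neg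
    (fun q y hq hy => hF0 q hq _ (by simpa using hy)) hw
    (hF.comp (contDiff_fst.prodMk contDiff_snd.neg).contDiffOn (fun p hp => ⟨hp.1, mem_univ _⟩))
  refine h.congr fun q _ => ?_
  simp [convolution]

theorem contDiff_integral_of_compact [FiniteDimensional ℝ E] {μ : Measure E} [μ.IsAddHaarMeasure]
    {F : Q → E → ℝ} {k : Set E} (hk : IsCompact k) (hF0 : ∀ q, ∀ y ∉ k, F q y = 0)
    (hF : ContDiff ℝ ∞ (Function.uncurry F)) : ContDiff ℝ ∞ (fun q => ∫ y, F q y ∂μ) := by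
  have h := contDiffOn_integral_mul_of_compact (μ := μ) (w := fun _ => 1) (locallyIntegrable_const 1)
    isOpen_univ hk (fun q _ => hF0 q) hF.contDiffOn
  simpa [contDiffOn_univ] using h

/-- Differentiation under the integral sign for smooth integrands with uniformly compact
support. -/
theorem hasLineDerivAt_integral_of_compact {μ : Measure E} [μ.IsAddHaarMeasure]
    {F : Q → E → ℝ} {k : Set E} (hk : IsCompact k) (hF0 : ∀ q, ∀ y ∉ k, F q y = 0)
    (hF : ContDiff ℝ ∞ (Function.uncurry F)) (q e : Q) :
    Integrable (fun y => lineDeriv ℝ (fun q => F q y) q e) μ ∧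
    HasLineDerivAt ℝ (fun q => ∫ y, F q y ∂μ) (∫ y, lineDeriv ℝ (fun q => F q y) q e ∂μ) q e := by
  set H : ℝ → E → ℝ := fun r y => F (q + r • e) y
  set H' : ℝ → E → ℝ := fun r y => fderiv ℝ (Function.uncurry F) (q + r • e, y) (e, 0)
  have hFd : Differentiable ℝ (Function.uncurry F) := hF.differentiable (by simp)
  have hd : ∀ r y, HasDerivAt (fun r => H r y) (H' r y) r := fun r y => by
    have h1 : HasDerivAt (fun r : ℝ => (q + r • e, y)) (e, (0 : E)) r := by
      refine HasDerivAt.prodMk ?_ (hasDerivAt_const _ _)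
      simpa using ((hasDerivAt_id r).smul_const e).const_add q
    exact (hFd (q + r • e, y)).hasFDerivAt.comp_hasDerivAt r h1
  have hH'c : Continuous (Function.uncurry H') := by
    have : Continuous fun p : ℝ × E => (q + p.1 • e, p.2) := by fun_prop
    exact ((hF.continuous_fderiv (by simp)).comp this).clm_apply continuous_const
  have hH0 : ∀ r, ∀ y ∉ k, H r y = 0 := fun r y hy => hF0 _ y hy
  have hH'0 : ∀ r, ∀ y ∉ k, H' r y = 0 := fun r y hy => by
    have h0 : (fun r => H r y) = fun _ => (0 : ℝ) := funext fun r => hH0 r y hy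
    have := hd r y
    rw [h0] at this
    exact this.unique (hasDerivAt_const _ _)
  have hHc : ∀ r, Continuous (H r) := fun r => hF.continuous.comp (by fun_prop : Continuous fun y => (q + r • e, y))
  obtain ⟨C, hC⟩ := (isCompact_Icc (a := (-1 : ℝ)) (b := 1)).prod hk |>.exists_bound_of_continuousOn
    hH'c.continuousOn
  have hline : ∀ y, lineDeriv ℝ (fun q => F q y) q e = H' 0 y := fun y => (hd 0 y).deriv
  have key := hasDerivAt_integral_of_dominated_loc_of_deriv_le (μ := μ) (x₀ := (0 : ℝ))
    (s := Icc (-1) 1) (F := H) (F' := H') (bound := k.indicator fun _ => C)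
    (Icc_mem_nhds (by norm_num) (by norm_num))
    (Filter.Eventually.of_forall fun r => (hHc r).aestronglyMeasurable)
    (integrable_of_compact hk (hH0 0) (hHc 0))
    (hH'c.comp (by fun_prop : Continuous fun y : E => ((0 : ℝ), y))).aestronglyMeasurable
    (Filter.Eventually.of_forall fun y r hr => by
      by_cases hy : y ∈ k
      · simpa [hy] using hC (r, y) ⟨hr, hy⟩
      · simp [hy, hH'0 r y hy])
    ((integrable_indicator_iff hk.measurableSet).2 (integrableOn_const hk.measure_lt_top.ne))
    (Filter.Eventually.of_forall fun y r _ => hd r y)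
  simp only [hline]
  exact key

/-- A primitive in the variable `τ` of a function of `(τ, z)` is smooth in both variables. -/
theorem contDiffOn_intervalIntegral {f : ℝ × Q → ℝ} {U : Set Q} (hU : IsOpen U)
    (hf : ContDiffOn ℝ ∞ f (univ ×ˢ U)) (s : ℝ) :
    ContDiffOn ℝ ∞ (fun p : ℝ × Q => ∫ τ in s..p.1, f (τ, p.2)) (univ ×ˢ U) := by
  -- rescaling to the fixed interval `[0, 1]`, on which a cut-off `χ` equals one
  let χ : ContDiffBump (0 : ℝ) := ⟨1, 2, one_pos, one_lt_two⟩
  have hχ : ∀ r ∈ Ioc (0 : ℝ) 1, χ r = 1 := fun r hr => χ.one_of_mem_closedBall (by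
    simpa [abs_le] using And.intro (by linarith [hr.1]) hr.2)
  have h := contDiffOn_integral_mul_of_compact (Q := ℝ × Q) (μ := (volume : Measure ℝ))
    (w := (Ioc (0 : ℝ) 1).indicator fun _ => 1)
    (((integrable_indicator_iff measurableSet_Ioc).2
      (integrableOn_const (by simp))).locallyIntegrable)
    (F := fun p r => χ r * (f (s + r * (p.1 - s), p.2) * (p.1 - s)))
    (s := univ ×ˢ U) (isOpen_univ.prod hU) (k := Metric.closedBall 0 2) (isCompact_closedBall _ _)
    (fun p _ r hr => by
      rw [χ.zero_of_le_dist (by simpa using (not_le.1 fun h' => hr (by simpa using h')).le), zero_mul])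
    (by
      have h1 : ContDiffOn ℝ ∞ (fun x : (ℝ × Q) × ℝ => f (s + x.2 * (x.1.1 - s), x.1.2))
          ((univ ×ˢ U) ×ˢ univ) := by
        refine hf.comp (ContDiff.contDiffOn (by fun_prop)) fun x hx => ⟨mem_univ _, hx.1.2⟩
      have h2 : ContDiff ℝ ∞ (fun x : (ℝ × Q) × ℝ => χ x.2) := χ.contDiff.comp contDiff_snd
      have h3 : ContDiff ℝ ∞ (fun x : (ℝ × Q) × ℝ => x.1.1 - s) := by fun_prop
      exact h2.contDiffOn.mul (h1.mul h3.contDiffOn))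
  refine h.congr fun p _ => ?_
  have e1 : (fun r => (Ioc (0 : ℝ) 1).indicator (fun _ => (1 : ℝ)) r *
      (χ r * (f (s + r * (p.1 - s), p.2) * (p.1 - s)))) =
      (Ioc (0 : ℝ) 1).indicator fun r => f (s + r * (p.1 - s), p.2) * (p.1 - s) := by
    funext r
    by_cases hr : r ∈ Ioc (0 : ℝ) 1
    · simp [hr, hχ r hr]
    · simp [hr]
  rw [e1, integral_indicator measurableSet_Ioc, ← intervalIntegral.integral_of_le zero_le_one,
    intervalIntegral.integral_mul_const]
  have h2 := intervalIntegral.mul_integral_comp_add_mul (f := fun τ => f (τ, p.2)) (p.1 - s) s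
    (a := 0) (b := 1)
  simp only [mul_zero, add_zero, mul_one, add_sub_cancel] at h2
  rw [← h2, mul_comm]
  simp only [mul_comm]

end ParametricIntegral

/-! ### Linear algebra in the plane -/

section PlaneAlgebra

/-- The standard basis vectors of `ℝ²`. -/
noncomputable def planeBasis (i : Fin 2) : Plane := EuclideanSpace.single i 1

@[simp] theorem planeBasis_apply (i j : Fin 2) : planeBasis i j = if j = i then 1 else 0 := by
  simp [planeBasis]

theorem plane_decomp (w : Plane) : w = w 0 • planeBasis 0 + w 1 • planeBasis 1 := by
  ext i; fin_cases i <;> simp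

theorem map_plane {V : Type*} [AddCommGroup V] [Module ℝ V] (a : Plane →ₗ[ℝ] V) (w : Plane) :
    a w = w 0 • a (planeBasis 0) + w 1 • a (planeBasis 1) := by
  conv_lhs => rw [plane_decomp w, map_add, map_smul, map_smul]

/-- The trace of an endomorphism of the plane. -/
noncomputable def planeTrace : (Plane →L[ℝ] Plane) →L[ℝ] ℝ :=
  LinearMap.toContinuousLinearMap
    ((LinearMap.trace ℝ Plane).comp (ContinuousLinearMap.coeLM ℝ))

theorem planeTrace_eq_trace (T : Plane →L[ℝ] Plane) :
    planeTrace T = LinearMap.trace ℝ Plane (T : Plane →ₗ[ℝ] Plane) := rfl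

theorem planeTrace_eq (T : Plane →L[ℝ] Plane) :
    planeTrace T = T (planeBasis 0) 0 + T (planeBasis 1) 1 := by
  rw [planeTrace_eq_trace, LinearMap.trace_eq_matrix_trace ℝ (EuclideanSpace.basisFun (Fin 2) ℝ).toBasis]
  simp [Matrix.trace, LinearMap.toMatrix_apply, planeBasis]

theorem planeTrace_mul_comm (S T : Plane →L[ℝ] Plane) :
    planeTrace (S * T) = planeTrace (T * S) :=
  LinearMap.trace_mul_comm ℝ (S : Plane →ₗ[ℝ] Plane) T

theorem plane_det_eq (T : Plane →L[ℝ] Plane) :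
    T.det = planeArea (T (planeBasis 0)) (T (planeBasis 1)) := by
  have : T.det = LinearMap.det (T : Plane →ₗ[ℝ] Plane) := rfl
  rw [this, ← LinearMap.det_toMatrix (EuclideanSpace.basisFun (Fin 2) ℝ).toBasis, Matrix.det_fin_two]
  simp [LinearMap.toMatrix_apply, planeBasis, planeArea]
  ring

theorem plane_ext {S T : Plane →L[ℝ] Plane} (h00 : S (planeBasis 0) 0 = T (planeBasis 0) 0)
    (h01 : S (planeBasis 0) 1 = T (planeBasis 0) 1) (h10 : S (planeBasis 1) 0 = T (planeBasis 1) 0)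
    (h11 : S (planeBasis 1) 1 = T (planeBasis 1) 1) : S = T := by
  have h0 : S (planeBasis 0) = T (planeBasis 0) := by ext i; fin_cases i <;> assumption
  have h1 : S (planeBasis 1) = T (planeBasis 1) := by ext i; fin_cases i <;> assumption
  ext1 w
  have hS := map_plane (S : Plane →ₗ[ℝ] Plane) w
  have hT := map_plane (T : Plane →ₗ[ℝ] Plane) w
  simp only [ContinuousLinearMap.coe_coe] at hS hT
  rw [hS, hT, h0, h1]

theorem plane_mul_apply (S T : Plane →L[ℝ] Plane) (j i : Fin 2) :
    (S * T) (planeBasis j) i = T (planeBasis j) 0 * S (planeBasis 0) i +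
      T (planeBasis j) 1 * S (planeBasis 1) i := by
  have hS := map_plane (S : Plane →ₗ[ℝ] Plane) (T (planeBasis j))
  simp only [ContinuousLinearMap.coe_coe] at hS
  rw [mul_apply_eq_comp, hS]
  simp

theorem planeTrace_one : planeTrace 1 = 2 := by
  rw [planeTrace_eq]; norm_num

variable {J J₀ X : Plane →L[ℝ] Plane}

theorem planeTrace_eq_zero_of_sq (hJ : J * J = -1) : planeTrace J = 0 := by
  have h := fun j i => congrArg (fun T : Plane →L[ℝ] Plane => T (planeBasis j) i) hJ
  have h00 := h 0 0; have h01 := h 0 1; have h10 := h 1 0; have h11 := h 1 1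
  simp only [plane_mul_apply] at h00 h01 h10 h11
  simp at h00 h01 h10 h11
  rw [planeTrace_eq]
  by_contra hne
  have h1 : J (planeBasis 0) 1 = 0 := by
    apply mul_right_cancel₀ hne; linear_combination h01
  rw [h1] at h00
  nlinarith [sq_nonneg (J (planeBasis 0) 0)]

theorem plane_det_eq_one_of_sq (hJ : J * J = -1) : J.det = 1 := by
  have h := congrArg (fun T : Plane →L[ℝ] Plane => T (planeBasis 0) 0) hJ
  have ht := planeTrace_eq_zero_of_sq hJ
  simp only [plane_mul_apply] at h
  simp at h
  rw [planeTrace_eq] at ht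
  rw [plane_det_eq, planeArea]
  linear_combination -h + J (planeBasis 0) 0 * ht

theorem mul_mul_eq_of_anticomm {A : Type*} [Ring A] {J X : A} (hJ : J * J = -1)
    (hX : X * J = -(J * X)) : J * X * J = X := by
  rw [mul_assoc, hX, mul_neg, ← mul_assoc, hJ, neg_one_mul, neg_neg]

theorem planeTrace_eq_zero_of_anticomm (hJ : J * J = -1) (hX : X * J = -(J * X)) :
    planeTrace X = 0 := by
  have h1 : J * X * J = X := mul_mul_eq_of_anticomm hJ hX
  have h2 : planeTrace (J * X * J) = -planeTrace X := by
    rw [planeTrace_mul_comm, ← mul_assoc, hJ, neg_one_mul X, map_neg]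
  rw [h1] at h2
  linarith

theorem planeTrace_mul_eq_zero_of_anticomm (hX : X * J = -(J * X)) : planeTrace (J * X) = 0 := by
  have h := planeTrace_mul_comm X J
  rw [hX, map_neg] at h
  linarith

/-- The polarised Cayley–Hamilton identity for traceless endomorphisms. -/
theorem anticommutator_of_trace_zero (hJ : planeTrace J = 0) (hX : planeTrace X = 0) :
    J * X + X * J = planeTrace (J * X) • 1 := by
  rw [planeTrace_eq] at hJ hX
  apply plane_ext <;> simp only [add_apply, smul_apply, PiLp.add_apply, PiLp.smul_apply,
    plane_mul_apply, planeTrace_eq, one_apply_eq_self, planeBasis_apply, smul_eq_mul] <;> simp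
  · linear_combination J (planeBasis 0) 0 * hX - X (planeBasis 1) 1 * hJ
  · linear_combination X (planeBasis 0) 1 * hJ + J (planeBasis 0) 1 * hX
  · linear_combination X (planeBasis 1) 0 * hJ + J (planeBasis 1) 0 * hX
  · linear_combination J (planeBasis 1) 1 * hX - X (planeBasis 0) 0 * hJ

/-- Two positive complex structures of the plane span a geodesic of the hyperbolic plane: `-½ tr (J₀ J)`
is the hyperbolic cosine of their distance. Only its positivity is needed. -/
theorem planeTrace_mul_neg (hJ₀ : J₀ * J₀ = -1) (hJ : J * J = -1)
    (p₀ : ∀ v, v ≠ 0 → 0 < planeArea v (J₀ v)) (p : ∀ v, v ≠ 0 → 0 < planeArea v (J v)) :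
    planeTrace (J₀ * J) < 0 := by
  have t0 := planeTrace_eq_zero_of_sq hJ₀
  have t := planeTrace_eq_zero_of_sq hJ
  have d0 := plane_det_eq_one_of_sq hJ₀
  have d := plane_det_eq_one_of_sq hJ
  have hne : planeBasis 0 ≠ 0 := fun h => by
    have := congrArg (fun w : Plane => w 0) h; simp at this
  have c0 := p₀ _ hne
  have c := p _ hne
  simp [planeArea] at c0 c
  rw [planeTrace_eq] at t0 t
  rw [plane_det_eq, planeArea] at d0 d
  rw [planeTrace_eq]
  simp only [plane_mul_apply]
  set a := J (planeBasis 0) 0; set b := J (planeBasis 1) 0; set e := J (planeBasis 0) 1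
  set a₀ := J₀ (planeBasis 0) 0; set b₀ := J₀ (planeBasis 1) 0; set e₀ := J₀ (planeBasis 0) 1
  have hx : J (planeBasis 1) 1 = -a := by linarith
  have hx0 : J₀ (planeBasis 1) 1 = -a₀ := by linarith
  rw [hx] at d ⊢; rw [hx0] at d0 ⊢
  have : e * e₀ * (a * a₀ + e * b₀ + (b * e₀ + -a * -a₀)) = -((e * a₀ - e₀ * a) ^ 2 + e ^ 2 + e₀ ^ 2) := by
    linear_combination (-e ^ 2) * d0 - e₀ ^ 2 * d
  by_contra hcon
  push Not at hcon
  have := mul_nonneg (mul_pos c c0).le hcon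
  nlinarith [sq_nonneg (e * a₀ - e₀ * a), sq_nonneg e₀, pow_pos c 2]

end PlaneAlgebra

/-! ### The wedge product of vector-valued covectors of the plane -/

section Wedge

variable {V : Type*} [AddCommGroup V] [Module ℝ V] (β : V →ₗ[ℝ] V →ₗ[ℝ] ℝ)

/-- The value `β (a ∧ b) (u, v) = β (a u) (b v) - β (a v) (b u)`. -/
def wedge (a b : Plane →ₗ[ℝ] V) (u v : Plane) : ℝ := β (a u) (b v) - β (a v) (b u)

variable {β}

theorem wedge_eq_area (a b : Plane →ₗ[ℝ] V) (u v : Plane) :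
    wedge β a b u v = planeArea u v * wedge β a b (planeBasis 0) (planeBasis 1) := by
  simp only [wedge, planeArea]
  rw [map_plane a u, map_plane a v, map_plane b u, map_plane b v]
  simp only [map_add, map_smul, LinearMap.add_apply, LinearMap.smul_apply, smul_eq_mul]
  ring

theorem wedge_antisymm (hβ : ∀ x y, β x y = β y x) (a b : Plane →ₗ[ℝ] V) (u v : Plane) :
    wedge β a b u v = -wedge β b a u v := by
  simp only [wedge]; rw [hβ (a u), hβ (a v)]; ring

theorem wedge_comp_comp (a b : Plane →ₗ[ℝ] V) (C : Plane →L[ℝ] Plane) (u v : Plane) :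
    wedge β (a ∘ₗ (C : Plane →ₗ[ℝ] Plane)) (b ∘ₗ (C : Plane →ₗ[ℝ] Plane)) u v =
      C.det * wedge β a b u v := by
  rw [wedge_eq_area, wedge_eq_area a b u v]
  have : wedge β (a ∘ₗ (C : Plane →ₗ[ℝ] Plane)) (b ∘ₗ (C : Plane →ₗ[ℝ] Plane)) (planeBasis 0)
    (planeBasis 1) = wedge β a b (C (planeBasis 0)) (C (planeBasis 1)) := rfl
  rw [this, wedge_eq_area a b (C _), plane_det_eq]
  ring

/-- The infinitesimal form of `wedge_comp_comp`. It makes composition with a traceless endomorphism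
skew for the wedge product. -/
theorem wedge_comp_add (a b : Plane →ₗ[ℝ] V) (C : Plane →L[ℝ] Plane) (u v : Plane) :
    wedge β (a ∘ₗ (C : Plane →ₗ[ℝ] Plane)) b u v + wedge β a (b ∘ₗ (C : Plane →ₗ[ℝ] Plane)) u v =
      planeTrace C * wedge β a b u v := by
  rw [wedge_eq_area, wedge_eq_area a (b ∘ₗ _) u v, wedge_eq_area a b u v, planeTrace_eq]
  simp only [wedge, LinearMap.comp_apply, ContinuousLinearMap.coe_coe]
  rw [map_plane a (C (planeBasis 0)), map_plane a (C (planeBasis 1)), map_plane b (C (planeBasis 0)),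
    map_plane b (C (planeBasis 1))]
  simp only [map_add, map_smul, LinearMap.add_apply, LinearMap.smul_apply, smul_eq_mul]
  ring

end Wedge

/-! ### The parallel transport of the tautological bundle over the hyperbolic plane -/

section Rotor

variable {A : Type*} [Ring A] [Algebra ℝ A]

/-- The infinitesimal rotation of the frame `1 - J₀ J` under a variation `X` of `J`, written in an
arbitrary algebra with the anticommutation relations of `2 × 2` matrices. -/
theorem rotor_identity {J₀ J X : A} {τ τ' κ : ℝ} (h₀ : J₀ * J₀ = -1) (h : J * J = -1)
    (hX : X * J = -(J * X)) (hτ : J₀ * J + J * J₀ = τ • 1) (hτ' : J₀ * X + X * J₀ = τ' • 1)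
    (hκ : J₀ * (J * X) + J * X * J₀ = κ • 1) :
    (2 - τ) • (-(J₀ * X) + (1 / 2 : ℝ) • ((1 - J₀ * J) * (J * X))) =
      -((1 / 2 : ℝ) • ((τ' • 1 + κ • J₀) * (1 - J₀ * J))) := by
  have e1 : J * J₀ = τ • 1 - J₀ * J := eq_sub_of_add_eq' hτ
  have e2 : X * J₀ = τ' • 1 - J₀ * X := eq_sub_of_add_eq' hτ'
  have a1 : ∀ Z, J₀ * (J₀ * Z) = -Z := fun Z => by rw [← mul_assoc, h₀]; simp
  have a2 : ∀ Z, J * (J * Z) = -Z := fun Z => by rw [← mul_assoc, h]; simp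
  have a3 : ∀ Z, J * (J₀ * Z) = τ • Z - J₀ * (J * Z) := fun Z => by
    rw [← mul_assoc, e1, sub_mul]; simp [mul_assoc]
  have k1 : κ • (1 : A) = (2 : ℝ) • (J₀ * (J * X)) + τ' • J - τ • X := by
    rw [← hκ, mul_assoc, e2, mul_sub, a3]
    simp only [mul_smul_comm, mul_one]
    module
  have k2 : κ • J₀ = τ' • (J₀ * J) - (2 : ℝ) • (J * X) - τ • (J₀ * X) := by
    have : κ • J₀ = J₀ * (κ • 1) := by simp
    rw [this, k1]
    simp only [mul_add, mul_sub, mul_smul_comm, a1]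
    module
  have k3 : κ • J = (2 : ℝ) • (J₀ * X) - τ' • 1 + τ • (J * X) := by
    have : κ • J = (κ • 1) * J := by simp
    rw [this, k1]
    simp only [add_mul, sub_mul, smul_mul_assoc, mul_assoc, hX, mul_neg, a2, h]
    module
  have k4 : κ • J₀ * (1 - J₀ * J) = κ • J₀ + κ • J := by
    rw [mul_sub, smul_mul_assoc, smul_mul_assoc, a1]; simp
  rw [add_mul, k4, k2, k3]
  simp only [mul_sub, sub_mul, smul_mul_assoc, one_mul, mul_one, mul_assoc, a2, mul_neg]
  module

end Rotor

section NormedRotor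

variable {A : Type*} [NormedRing A] [NormedAlgebra ℝ A] (tr : A →L[ℝ] ℝ) {J₀ J X : A}

/-- The rotation `cos θ + sin θ J₀` followed by the normalised frame `1 - J₀ J`, which conjugates `J`
to `J₀`. -/
noncomputable def rotor (J₀ J : A) (θ : ℝ) : A :=
  (√(2 - tr (J₀ * J)))⁻¹ • ((Real.cos θ • 1 + Real.sin θ • J₀) * (1 - J₀ * J))

variable {tr}

theorem rotor_self (hJ₀ : J₀ * J₀ = -1) (h1 : tr 1 = 2) : rotor tr J₀ J₀ 0 = 1 := by
  have h : (2 - tr (J₀ * J₀)) = 2 ^ 2 := by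
    rw [hJ₀, map_neg, h1]; norm_num
  rw [rotor, h, Real.sqrt_sq (by norm_num), hJ₀]
  simp only [Real.cos_zero, Real.sin_zero, zero_smul, one_smul, add_zero, one_mul]
  rw [sub_neg_eq_add, ← two_smul ℝ (1 : A), smul_smul]
  norm_num

/-- If the angle `θ` turns at the rate `tr (J₀ J J') / (2 (2 - tr (J₀ J)))`, the rotor `U` along the
path `J` solves `U' = -½ U J J'`. -/
theorem hasDerivAt_rotor_of_anticommutators {J : ℝ → A} {θ : ℝ → ℝ} {t : ℝ}
    (hJ₀ : J₀ * J₀ = -1) (hJ : J t * J t = -1) (hX : X * J t = -(J t * X))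
    (hτ : J₀ * J t + J t * J₀ = tr (J₀ * J t) • 1) (hτ' : J₀ * X + X * J₀ = tr (J₀ * X) • 1)
    (hκ : J₀ * (J t * X) + J t * X * J₀ = tr (J₀ * (J t * X)) • 1)
    (hneg : tr (J₀ * J t) < 0) (hd : HasDerivAt J X t)
    (hθ : HasDerivAt θ (tr (J₀ * (J t * X)) / (2 * (2 - tr (J₀ * J t)))) t) :
    HasDerivAt (fun r => rotor tr J₀ (J r) (θ r))
      (-(1 / 2 : ℝ) • (rotor tr J₀ (J t) (θ t) * (J t * X))) t := by
  have key := rotor_identity hJ₀ hJ hX hτ hτ' hκ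
  have d1 : HasDerivAt (fun r => J₀ * J r) (J₀ * X) t := hd.const_mul J₀
  have d2 : HasDerivAt (fun r => 2 - tr (J₀ * J r)) (-tr (J₀ * X)) t :=
    (tr.hasFDerivAt.comp_hasDerivAt t d1).const_sub 2
  have hrot : rotor tr J₀ (J t) (θ t) = (√(2 - tr (J₀ * J t)))⁻¹ •
    ((Real.cos (θ t) • 1 + Real.sin (θ t) • J₀) * (1 - J₀ * J t)) := rfl
  clear hτ hτ' hκ
  set τ := tr (J₀ * J t) with hτ
  set κ := tr (J₀ * (J t * X))
  set τ' := tr (J₀ * X)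
  have hm : (0 : ℝ) < 2 - τ := by linarith
  have d3 := (d2.sqrt hm.ne').inv (Real.sqrt_pos.2 hm).ne'
  have d4 := (hθ.cos.smul_const (1 : A)).add (hθ.sin.smul_const J₀)
  have d5 := d3.smul (d4.mul (d1.const_sub 1))
  refine d5.congr_deriv ?_
  simp only [Pi.add_apply, Pi.mul_apply, Pi.inv_apply, ← hτ]
  set s := √(2 - τ) with hs
  have hs2 : 2 - τ = s ^ 2 := (Real.sq_sqrt hm.le).symm
  have hs0 : s ≠ 0 := (Real.sqrt_pos.2 hm).ne'
  rw [hs2] at key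
  rw [hs2, hrot]
  set R : A := Real.cos (θ t) • 1 + Real.sin (θ t) • J₀ with hR
  have hR' : (-Real.sin (θ t) * (κ / (2 * s ^ 2))) • (1 : A) +
      (Real.cos (θ t) * (κ / (2 * s ^ 2))) • J₀ = (κ / (2 * s ^ 2)) • (R * J₀) := by
    rw [hR, add_mul, smul_mul_assoc, smul_mul_assoc, hJ₀, one_mul]
    module
  rw [hR']
  have key2 : -(J₀ * X) = (s ^ 2)⁻¹ • -((1 / 2 : ℝ) • ((τ' • 1 + κ • J₀) * (1 - J₀ * J t))) -
      (1 / 2 : ℝ) • ((1 - J₀ * J t) * (J t * X)) := by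
    rw [← key, smul_smul, inv_mul_cancel₀ (pow_ne_zero 2 hs0), one_smul]
    abel
  rw [key2]
  generalize 1 - J₀ * J t = h
  simp only [mul_sub, mul_neg, mul_smul_comm, mul_add, add_mul, smul_mul_assoc, one_mul, mul_assoc]
  match_scalars <;> field_simp <;> ring

/-- If `U` is the fundamental solution of the linear equation `U' = -½ U M`, every solution of
`φ' = -½ φ M` is `φ s` acting on `U`, because `φ U⁻¹` is constant. -/
theorem eq_of_hasDerivAt_mul {E : Type*} [NormedAddCommGroup E] [NormedSpace ℝ E]
    [CompleteSpace A] (act : E →L[ℝ] A →L[ℝ] E) (hact : ∀ φ a b, act (act φ a) b = act φ (a * b))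
    (hone : ∀ φ, act φ 1 = φ) {M U : ℝ → A} {φ : ℝ → E} {s : ℝ}
    (hU : ∀ t, HasDerivAt U (-(1 / 2 : ℝ) • (U t * M t)) t) (hunit : ∀ t, IsUnit (U t))
    (hUs : U s = 1) (hφ : ∀ t, HasDerivAt φ (-(1 / 2 : ℝ) • act (φ t) (M t)) t) (t : ℝ) :
    φ t = act (φ s) (U t) := by
  have hV : ∀ t, HasDerivAt (fun t => Ring.inverse (U t)) ((1 / 2 : ℝ) • (M t * Ring.inverse (U t))) t :=
    fun t => by
      obtain ⟨u, hu⟩ := hunit t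
      have h1 := hasFDerivAt_ringInverse (𝕜 := ℝ) u
      rw [hu] at h1
      refine (h1.comp_hasDerivAt t (hU t)).congr_deriv ?_
      simp only [← hu, Ring.inverse_unit, neg_apply,
        ContinuousLinearMap.mulLeftRight_apply, mul_smul_comm, smul_mul_assoc]
      rw [← mul_assoc, Units.inv_mul, one_mul, neg_smul, neg_neg]
  have hc : ∀ t, HasDerivAt (fun t => act (φ t) (Ring.inverse (U t))) 0 t := fun t => by
    have h := act.hasFDerivAt_of_bilinear (hφ t).hasFDerivAt (hV t).hasFDerivAt
    refine h.hasDerivAt.congr_deriv ?_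
    simp [hact]
  have hconst := is_const_of_deriv_eq_zero (fun t => (hc t).differentiableAt) (fun t => (hc t).deriv) t s
  simp only [hUs, Ring.inverse_one, hone] at hconst
  rw [← hconst, hact, Ring.inverse_mul_cancel _ (hunit t), hone]

end NormedRotor

section RotorPlane

variable {J J₀ X : Plane →L[ℝ] Plane}

theorem plane_det_smul (c : ℝ) (T : Plane →L[ℝ] Plane) : (c • T).det = c ^ 2 * T.det := by
  simp only [plane_det_eq, planeArea, smul_apply, PiLp.smul_apply, smul_eq_mul]; ring

theorem plane_det_mul (S T : Plane →L[ℝ] Plane) : (S * T).det = S.det * T.det :=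
  LinearMap.det_comp (S : Plane →ₗ[ℝ] Plane) T

theorem plane_det_one_sub (T : Plane →L[ℝ] Plane) : (1 - T).det = 1 - planeTrace T + T.det := by
  simp only [plane_det_eq, planeArea, planeTrace_eq, sub_apply, PiLp.sub_apply, one_apply_eq_self,
    planeBasis_apply]
  norm_num
  ring

theorem plane_det_smul_one_add_smul (a b : ℝ) (T : Plane →L[ℝ] Plane) :
    (a • 1 + b • T).det = a ^ 2 + a * b * planeTrace T + b ^ 2 * T.det := by
  simp only [plane_det_eq, planeArea, planeTrace_eq]
  simp
  ring

theorem rotor_det (hJ₀ : J₀ * J₀ = -1) (hJ : J * J = -1) (hneg : planeTrace (J₀ * J) < 0) (θ : ℝ) :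
    (rotor planeTrace J₀ J θ).det = 1 := by
  have t0 := planeTrace_eq_zero_of_sq hJ₀
  have d0 := plane_det_eq_one_of_sq hJ₀
  have d1 : (J₀ * J).det = 1 := by
    rw [plane_det_mul, d0, plane_det_eq_one_of_sq hJ, one_mul]
  rw [rotor, plane_det_smul, plane_det_mul, plane_det_smul_one_add_smul, plane_det_one_sub, d1, d0,
    t0, inv_pow, Real.sq_sqrt (by linarith), mul_zero, add_zero, mul_one, Real.cos_sq_add_sin_sq,
    one_mul, sub_add_eq_add_sub, one_add_one_eq_two]
  exact inv_mul_cancel₀ (by linarith)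

theorem isUnit_of_plane_det_eq_one {T : Plane →L[ℝ] Plane} (h : T.det = 1) : IsUnit T := by
  have key : ∀ S : Plane →L[ℝ] Plane, S * (planeTrace S • 1 - S) = S.det • 1 ∧
      (planeTrace S • 1 - S) * S = S.det • 1 := fun S => by
    constructor <;> apply plane_ext <;> simp only [sub_apply, PiLp.sub_apply,
      plane_mul_apply, plane_det_eq, planeArea, planeTrace_eq, smul_apply, PiLp.smul_apply,
      one_apply_eq_self, planeBasis_apply, smul_eq_mul] <;> simp <;> ring
  have h1 := key T
  rw [h, one_smul] at h1
  exact ⟨⟨T, _, h1.1, h1.2⟩, rfl⟩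

theorem hasDerivAt_rotor {J : ℝ → Plane →L[ℝ] Plane} {θ : ℝ → ℝ} {t : ℝ}
    (hJ₀ : J₀ * J₀ = -1) (hJ : J t * J t = -1) (hX : X * J t = -(J t * X))
    (hneg : planeTrace (J₀ * J t) < 0) (hd : HasDerivAt J X t)
    (hθ : HasDerivAt θ (planeTrace (J₀ * (J t * X)) / (2 * (2 - planeTrace (J₀ * J t)))) t) :
    HasDerivAt (fun r => rotor planeTrace J₀ (J r) (θ r))
      (-(1 / 2 : ℝ) • (rotor planeTrace J₀ (J t) (θ t) * (J t * X))) t := by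
  have t0 := planeTrace_eq_zero_of_sq hJ₀
  exact hasDerivAt_rotor_of_anticommutators hJ₀ hJ hX
    (anticommutator_of_trace_zero t0 (planeTrace_eq_zero_of_sq hJ))
    (anticommutator_of_trace_zero t0 (planeTrace_eq_zero_of_anticomm hJ hX))
    (anticommutator_of_trace_zero t0 (planeTrace_mul_eq_zero_of_anticomm hX)) hneg hd hθ

end RotorPlane

/-! ### Smooth families of functions and of sections over the surface -/

section Families

open Set Bundle

/-- Derivatives of curves in topological vector spaces commute with continuous linear maps. -/
theorem hasDerivAt_clm_comp {V W : Type*} [AddCommGroup V] [Module ℝ V] [TopologicalSpace V]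
    [ContinuousSMul ℝ V] [AddCommGroup W] [Module ℝ W] [TopologicalSpace W] [ContinuousSMul ℝ W]
    (T : V →L[ℝ] W) {f : ℝ → V} {f' : V} {r : ℝ} (h : HasDerivAt f f' r) :
    HasDerivAt (fun r => T (f r)) (T f') r := by
  refine HasFDerivAtFilter.of_isLittleOTVS ?_
  refine ((T.isBigOTVS_fun_comp).trans_isLittleOTVS h.isLittleOTVS).congr_left fun p => ?_
  simp

variable {S : Type*} [TopologicalSpace S] [ChartedSpace Plane S]
  {Q : Type*} [NormedAddCommGroup Q] [NormedSpace ℝ Q]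
  {F : Type*} [NormedAddCommGroup F] [NormedSpace ℝ F]

theorem contMDiffOn_prodMap_chart_symm [IsManifold (𝓡 2) ∞ S] (i : S) :
    ContMDiffOn 𝓘(ℝ, Q × Plane) (𝓘(ℝ, Q).prod (𝓡 2)) ∞
      (fun p : Q × Plane => (p.1, (chartAt Plane i).symm p.2))
      (univ ×ˢ (chartAt Plane i).target) := by
  rw [modelWithCornersSelf_prod, ← chartedSpaceSelf_prod]
  exact contMDiff_fst.contMDiffOn.prodMk
    ((contMDiffOn_chart_symm (I := 𝓡 2) (n := ∞) (x := i)).comp contMDiff_snd.contMDiffOn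
      fun p hp => hp.2)

theorem contMDiffOn_prodMap_chart [IsManifold (𝓡 2) ∞ S] (i : S) :
    ContMDiffOn (𝓘(ℝ, Q).prod (𝓡 2)) 𝓘(ℝ, Q × Plane) ∞
      (fun p : Q × S => (p.1, chartAt Plane i p.2)) (univ ×ˢ (chartAt Plane i).source) := by
  rw [modelWithCornersSelf_prod, ← chartedSpaceSelf_prod]
  exact contMDiff_fst.contMDiffOn.prodMk
    ((contMDiffOn_chart (I := 𝓡 2) (n := ∞) (x := i)).comp contMDiff_snd.contMDiffOn
      fun p hp => hp.2)

theorem contDiffOn_comp_chart_symm [IsManifold (𝓡 2) ∞ S] {f : Q × S → F} {U : Set S}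
    (hf : ContMDiffOn (𝓘(ℝ, Q).prod (𝓡 2)) 𝓘(ℝ, F) ∞ f (univ ×ˢ U)) (i : S) :
    ContDiffOn ℝ ∞ (fun p : Q × Plane => f (p.1, (chartAt Plane i).symm p.2))
      (univ ×ˢ ((chartAt Plane i).target ∩ (chartAt Plane i).symm ⁻¹' U)) := by
  rw [← contMDiffOn_iff_contDiffOn]
  exact hf.comp ((contMDiffOn_prodMap_chart_symm i).mono
    (prod_mono_right inter_subset_left)) fun p hp => ⟨mem_univ _, hp.2.2⟩

theorem contMDiffOn_of_comp_chart_symm [IsManifold (𝓡 2) ∞ S] {f : Q × S → F} {U : Set S} (hU : IsOpen U)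
    (hf : ∀ i, ContDiffOn ℝ ∞ (fun p : Q × Plane => f (p.1, (chartAt Plane i).symm p.2))
      (univ ×ˢ ((chartAt Plane i).target ∩ (chartAt Plane i).symm ⁻¹' U))) :
    ContMDiffOn (𝓘(ℝ, Q).prod (𝓡 2)) 𝓘(ℝ, F) ∞ f (univ ×ˢ U) := by
  rintro ⟨q, x⟩ hx
  have hs : IsOpen ((univ : Set Q) ×ˢ ((chartAt Plane x).source ∩ U)) :=
    isOpen_univ.prod ((chartAt Plane x).open_source.inter hU)
  have h := (contMDiffOn_iff_contDiffOn.2 (hf x)).comp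
    ((contMDiffOn_prodMap_chart x).mono (prod_mono_right (inter_subset_left (t := U))))
    fun p hp => ⟨mem_univ _, (chartAt Plane x).map_source hp.2.1, by
      rw [mem_preimage, (chartAt Plane x).left_inv hp.2.1]; exact hp.2.2⟩
  refine ContMDiffAt.contMDiffWithinAt ?_
  refine (h.contMDiffAt (hs.mem_nhds ⟨mem_univ _, mem_chart_source _ x, hx.2⟩)).congr_of_eventuallyEq ?_
  filter_upwards [hs.mem_nhds (show (q, x) ∈ _ from ⟨mem_univ _, mem_chart_source _ x, hx.2⟩)] with p hp
  simp [(chartAt Plane x).left_inv hp.2.1]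

/-- The derivative in the parameter of a smooth family of functions is a smooth family. -/
theorem contMDiffOn_deriv_param [IsManifold (𝓡 2) ∞ S] {f f' : Q × S → F} {U : Set S} (hU : IsOpen U) (e : Q)
    (hf : ContMDiffOn (𝓘(ℝ, Q).prod (𝓡 2)) 𝓘(ℝ, F) ∞ f (univ ×ˢ U))
    (hd : ∀ q, ∀ x ∈ U, HasDerivAt (fun r : ℝ => f (q + r • e, x)) (f' (q, x)) 0) :
    ContMDiffOn (𝓘(ℝ, Q).prod (𝓡 2)) 𝓘(ℝ, F) ∞ f' (univ ×ˢ U) := by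
  refine contMDiffOn_of_comp_chart_symm hU fun i => ?_
  have h := contDiffOn_comp_chart_symm hf i
  have ho : IsOpen ((univ : Set Q) ×ˢ ((chartAt Plane i).target ∩ (chartAt Plane i).symm ⁻¹' U)) :=
    isOpen_univ.prod ((chartAt Plane i).isOpen_inter_preimage_symm hU)
  have h1 := (h.fderiv_of_isOpen ho (m := ∞) (by simp)).clm_apply
    (contDiffOn_const (c := (e, (0 : Plane))))
  refine h1.congr fun p hp => ?_
  have h2 := (h.contDiffAt (ho.mem_nhds hp)).differentiableAt (by simp)
  have h3 : HasDerivAt (fun r : ℝ => (p.1 + r • e, p.2)) (e, (0 : Plane)) 0 := by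
    refine HasDerivAt.prodMk ?_ (hasDerivAt_const _ _)
    simpa using ((hasDerivAt_id (0 : ℝ)).smul_const e).const_add p.1
  have h4 := HasFDerivAt.comp_hasDerivAt_of_eq (0 : ℝ) h2.hasFDerivAt h3 (by simp)
  exact (hd p.1 _ hp.2.2).unique h4

/-- The primitive in the time variable of a smooth family of functions is a smooth family. -/
theorem contMDiff_intervalIntegral [IsManifold (𝓡 2) ∞ S] {f : ℝ × S → ℝ}
    (hf : ContMDiff (𝓘(ℝ, ℝ).prod (𝓡 2)) 𝓘(ℝ, ℝ) ∞ f) (s : ℝ) :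
    ContMDiff (𝓘(ℝ, ℝ).prod (𝓡 2)) 𝓘(ℝ, ℝ) ∞ (fun p : ℝ × S => ∫ τ in s..p.1, f (τ, p.2)) := by
  have h : ContMDiffOn (𝓘(ℝ, ℝ).prod (𝓡 2)) 𝓘(ℝ, ℝ) ∞
      (fun p : ℝ × S => ∫ τ in s..p.1, f (τ, p.2)) (univ ×ˢ univ) := by
    refine contMDiffOn_of_comp_chart_symm isOpen_univ fun i => ?_
    exact contDiffOn_intervalIntegral (f := fun p => f (p.1, (chartAt Plane i).symm p.2))
      ((chartAt Plane i).isOpen_inter_preimage_symm isOpen_univ)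
      (contDiffOn_comp_chart_symm hf.contMDiffOn i) s
  rwa [univ_prod_univ, contMDiffOn_univ] at h

variable {E : S → Type*} [TopologicalSpace (TotalSpace F E)] [∀ x, TopologicalSpace (E x)]
  [FiberBundle F E]

/-- A family of sections is smooth if it is smooth in the trivialization around each point. -/
theorem contMDiff_section_iff {s : Q → ∀ x, E x} :
    ContMDiff (𝓘(ℝ, Q).prod (𝓡 2)) ((𝓡 2).prod 𝓘(ℝ, F)) ∞
      (fun p : Q × S => TotalSpace.mk' F p.2 (s p.1 p.2)) ↔
    ∀ q x, ContMDiffAt (𝓘(ℝ, Q).prod (𝓡 2)) 𝓘(ℝ, F) ∞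
      (fun p : Q × S => (trivializationAt F E x ⟨p.2, s p.1 p.2⟩).2) (q, x) := by
  constructor
  · exact fun h q x => (contMDiffAt_totalSpace.1 (h (q, x))).2
  · exact fun h p => contMDiffAt_totalSpace.2 ⟨contMDiff_snd.contMDiffAt, h p.1 p.2⟩

variable [∀ x, AddCommGroup (E x)] [∀ x, Module ℝ (E x)] [VectorBundle ℝ F E]

theorem contMDiffOn_trivialization_of_section [ContMDiffVectorBundle ∞ F E (𝓡 2)] {s : Q → ∀ x, E x}
    (hs : ContMDiff (𝓘(ℝ, Q).prod (𝓡 2)) ((𝓡 2).prod 𝓘(ℝ, F)) ∞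
      (fun p : Q × S => TotalSpace.mk' F p.2 (s p.1 p.2))) (x : S) :
    ContMDiffOn (𝓘(ℝ, Q).prod (𝓡 2)) 𝓘(ℝ, F) ∞
      (fun p : Q × S => (trivializationAt F E x ⟨p.2, s p.1 p.2⟩).2)
      (univ ×ˢ (trivializationAt F E x).baseSet) := by
  have h := (Trivialization.contMDiffOn (IB := 𝓡 2) (n := ∞) (trivializationAt F E x)).comp
    (s := univ ×ˢ (trivializationAt F E x).baseSet) hs.contMDiffOn fun p hp => by
      rw [mem_preimage, Trivialization.mem_source]; exact hp.2
  exact contMDiff_snd.comp_contMDiffOn h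

/-- The derivative in the parameter of a smooth family of sections is a smooth family. -/
theorem contMDiff_section_deriv_param [IsManifold (𝓡 2) ∞ S] [∀ x, ContinuousSMul ℝ (E x)] [ContMDiffVectorBundle ∞ F E (𝓡 2)]
    {s s' : Q → ∀ x, E x} (e : Q)
    (hs : ContMDiff (𝓘(ℝ, Q).prod (𝓡 2)) ((𝓡 2).prod 𝓘(ℝ, F)) ∞
      (fun p : Q × S => TotalSpace.mk' F p.2 (s p.1 p.2)))
    (hd : ∀ q x, HasDerivAt (fun r : ℝ => s (q + r • e) x) (s' q x) 0) :
    ContMDiff (𝓘(ℝ, Q).prod (𝓡 2)) ((𝓡 2).prod 𝓘(ℝ, F)) ∞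
      (fun p : Q × S => TotalSpace.mk' F p.2 (s' p.1 p.2)) := by
  refine contMDiff_section_iff.2 fun q x => ?_
  have h := contMDiffOn_deriv_param (trivializationAt F E x).open_baseSet e
    (contMDiffOn_trivialization_of_section hs x)
    (f' := fun p : Q × S => (trivializationAt F E x ⟨p.2, s' p.1 p.2⟩).2) fun q y hy => ?_
  · exact h.contMDiffAt ((isOpen_univ.prod (trivializationAt F E x).open_baseSet).mem_nhds
      ⟨mem_univ _, FiberBundle.mem_baseSet_trivializationAt' x⟩)
  · have h1 := hasDerivAt_clm_comp ((trivializationAt F E x).continuousLinearMapAt ℝ y) (hd q y)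
    simpa [Trivialization.coe_linearMapAt_of_mem _ hy] using h1

/-- At a fixed point of the surface, a smooth family of sections is a smooth function of the
parameter. -/
theorem contDiff_section_apply [ContMDiffVectorBundle ∞ F E (𝓡 2)] {s : Q → ∀ x, E x}
    (hs : ContMDiff (𝓘(ℝ, Q).prod (𝓡 2)) ((𝓡 2).prod 𝓘(ℝ, F)) ∞
      (fun p : Q × S => TotalSpace.mk' F p.2 (s p.1 p.2))) (x : S) :
    ContDiff ℝ ∞ fun q => (trivializationAt F E x).continuousLinearMapAt ℝ x (s q x) := by
  rw [← contMDiff_iff_contDiff]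
  have h1 : ContMDiff 𝓘(ℝ, Q) (𝓘(ℝ, Q).prod (𝓡 2)) ∞ fun q : Q => (q, x) :=
    contMDiff_id.prodMk contMDiff_const
  have hx := FiberBundle.mem_baseSet_trivializationAt' (F := F) (E := E) x
  refine ((contMDiffOn_trivialization_of_section hs x).comp_contMDiff h1 fun q => ⟨mem_univ _, hx⟩).congr
    fun q => ?_
  simp [Trivialization.coe_linearMapAt_of_mem _ hx]

end Families

/-! ### Traces and scalar multiples of smooth families of bundle maps -/

section HomFamilies

open Bundle ContinuousLinearMap

variable {S N F₁ F₂ EB EN HB HN : Type*}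
  {E₁ : S → Type*} {E₂ : S → Type*}
  [∀ x, AddCommGroup (E₁ x)] [∀ x, Module ℝ (E₁ x)] [NormedAddCommGroup F₁] [NormedSpace ℝ F₁]
  [TopologicalSpace (TotalSpace F₁ E₁)] [∀ x, TopologicalSpace (E₁ x)]
  [∀ x, AddCommGroup (E₂ x)] [∀ x, Module ℝ (E₂ x)] [NormedAddCommGroup F₂] [NormedSpace ℝ F₂]
  [TopologicalSpace (TotalSpace F₂ E₂)] [∀ x, TopologicalSpace (E₂ x)]
  [NormedAddCommGroup EB] [NormedSpace ℝ EB] [TopologicalSpace HB] {IB : ModelWithCorners ℝ EB HB}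
  [TopologicalSpace S] [ChartedSpace HB S]
  [NormedAddCommGroup EN] [NormedSpace ℝ EN] [TopologicalSpace HN] {IN : ModelWithCorners ℝ EN HN}
  [TopologicalSpace N] [ChartedSpace HN N]
  [FiberBundle F₁ E₁] [VectorBundle ℝ F₁ E₁] [FiberBundle F₂ E₂] [VectorBundle ℝ F₂ E₂]
  [∀ x, IsTopologicalAddGroup (E₂ x)] [∀ x, ContinuousSMul ℝ (E₂ x)]
  {n : WithTop ℕ∞} {b : N → S}

theorem contMDiff_hom_fun_smul {f : N → ℝ} (hf : ContMDiff IN 𝓘(ℝ, ℝ) n f)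
    {L : ∀ m, E₁ (b m) →L[ℝ] E₂ (b m)}
    (hL : ContMDiff IN (IB.prod 𝓘(ℝ, F₁ →L[ℝ] F₂)) n
      (fun m => TotalSpace.mk' (F₁ →L[ℝ] F₂) (E := fun x => E₁ x →L[ℝ] E₂ x) (b m) (L m))) :
    ContMDiff IN (IB.prod 𝓘(ℝ, F₁ →L[ℝ] F₂)) n
      (fun m => TotalSpace.mk' (F₁ →L[ℝ] F₂) (E := fun x => E₁ x →L[ℝ] E₂ x) (b m)
        (f m • L m)) := by
  intro m₀
  obtain ⟨hb, hL'⟩ := (contMDiffAt_hom_bundle _).1 (hL m₀)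
  refine (contMDiffAt_hom_bundle _).2 ⟨hb, ?_⟩
  refine ((hf m₀).smul hL').congr_of_eventuallyEq ?_
  have h2 : ∀ᶠ m in nhds m₀, b m ∈ (trivializationAt F₂ E₂ (b m₀)).baseSet :=
    hb.continuousAt ((trivializationAt F₂ E₂ (b m₀)).open_baseSet.mem_nhds
      (FiberBundle.mem_baseSet_trivializationAt' (b m₀)))
  have h1 : ∀ᶠ m in nhds m₀, b m ∈ (trivializationAt F₁ E₁ (b m₀)).baseSet :=
    hb.continuousAt ((trivializationAt F₁ E₁ (b m₀)).open_baseSet.mem_nhds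
      (FiberBundle.mem_baseSet_trivializationAt' (b m₀)))
  filter_upwards [h1, h2] with m hm1 hm2
  rw [inCoordinates_eq hm1 hm2]
  simp only [Pi.smul_apply']
  rw [inCoordinates_eq hm1 hm2]
  ext w
  simp

theorem contMDiff_hom_id {b : N → S} (hb : ContMDiff IN IB n b) :
    ContMDiff IN (IB.prod 𝓘(ℝ, F₂ →L[ℝ] F₂)) n
      (fun m => TotalSpace.mk' (F₂ →L[ℝ] F₂) (E := fun x => E₂ x →L[ℝ] E₂ x) (b m)
        (ContinuousLinearMap.id ℝ (E₂ (b m)))) := by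
  intro m₀
  refine (contMDiffAt_hom_bundle _).2 ⟨hb m₀, ?_⟩
  refine (contMDiffAt_const (c := ContinuousLinearMap.id ℝ F₂)).congr_of_eventuallyEq ?_
  have h2 : ∀ᶠ m in nhds m₀, b m ∈ (trivializationAt F₂ E₂ (b m₀)).baseSet :=
    (hb m₀).continuousAt ((trivializationAt F₂ E₂ (b m₀)).open_baseSet.mem_nhds
      (FiberBundle.mem_baseSet_trivializationAt' (b m₀)))
  filter_upwards [h2] with m hm2
  rw [inCoordinates_eq hm2 hm2]
  ext w
  simp

/-- The trace of a smooth family of endomorphisms of a vector bundle with fibre `ℝ²` is smooth. -/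
theorem contMDiff_hom_trace [TopologicalSpace (TotalSpace Plane E₂)] [FiberBundle Plane E₂]
    [VectorBundle ℝ Plane E₂] {L : ∀ m, E₂ (b m) →L[ℝ] E₂ (b m)}
    (hL : ContMDiff IN (IB.prod 𝓘(ℝ, Plane →L[ℝ] Plane)) n
      (fun m => TotalSpace.mk' (Plane →L[ℝ] Plane) (E := fun x => E₂ x →L[ℝ] E₂ x) (b m) (L m))) :
    ContMDiff IN 𝓘(ℝ, ℝ) n (fun m => LinearMap.trace ℝ (E₂ (b m)) (L m : E₂ (b m) →ₗ[ℝ] E₂ (b m))) := by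
  intro m₀
  obtain ⟨hb, hL'⟩ := (contMDiffAt_hom_bundle _).1 (hL m₀)
  refine (planeTrace.contDiff.contDiffAt.comp_contMDiffAt hL').congr_of_eventuallyEq ?_
  have h2 : ∀ᶠ m in nhds m₀, b m ∈ (trivializationAt Plane E₂ (b m₀)).baseSet :=
    hb.continuousAt ((trivializationAt Plane E₂ (b m₀)).open_baseSet.mem_nhds
      (FiberBundle.mem_baseSet_trivializationAt' (b m₀)))
  filter_upwards [h2] with m hm2
  rw [Function.comp_apply, inCoordinates_eq hm2 hm2, planeTrace_eq_trace]
  exact (LinearMap.trace_conj' (L m : E₂ (b m) →ₗ[ℝ] E₂ (b m))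
    ((trivializationAt Plane E₂ (b m₀)).continuousLinearEquivAt ℝ (b m) hm2).toLinearEquiv).symm

end HomFamilies

/-! ### Integration of smooth families of two-forms -/

section SurfaceIntegration

open Set Bundle MeasureTheory

variable {S : Type*} [TopologicalSpace S] [ChartedSpace Plane S] [IsManifold (𝓡 2) ∞ S]

/-- The coordinate vector field `∂/∂yⱼ` of the chart at `i`, at the point with coordinates `y`. -/
noncomputable def chartFrame (i : S) (j : Fin 2) (y : Plane) :
    TangentSpace (𝓡 2) ((chartAt Plane i).symm y) :=
  mfderiv 𝓘(ℝ, Plane) (𝓡 2) (chartAt Plane i).symm y (EuclideanSpace.single j 1 : Plane)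

theorem chartFrame_eq_symmL (i : S) (j : Fin 2) {y : Plane} (hy : y ∈ (chartAt Plane i).target) :
    chartFrame i j y = (trivializationAt Plane (TangentSpace (𝓡 2)) i).symmL ℝ
      ((chartAt Plane i).symm y) (EuclideanSpace.single j 1) := by
  have h := TangentBundle.symmL_trivializationAt (I := 𝓡 2) (x₀ := i)
    ((chartAt Plane i).map_target hy)
  have e : extChartAt (𝓡 2) i ((chartAt Plane i).symm y) = y := (chartAt Plane i).right_inv hy
  rw [h, e, chartFrame]
  simp only [modelWithCornersSelf_coe, range_id, mfderivWithin_univ]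
  rfl

theorem contMDiffOn_chartFrame (i : S) (j : Fin 2) :
    ContMDiffOn 𝓘(ℝ, Plane) ((𝓡 2).prod 𝓘(ℝ, Plane)) ∞
      (fun y => TotalSpace.mk' Plane (E := fun x : S => TangentSpace (𝓡 2) x)
        ((chartAt Plane i).symm y) (chartFrame i j y)) (chartAt Plane i).target := by
  have hb : ∀ y ∈ (chartAt Plane i).target, (chartAt Plane i).symm y ∈
      (trivializationAt Plane (TangentSpace (𝓡 2)) i).baseSet := fun y hy =>
    (chartAt Plane i).map_target hy
  refine (Trivialization.contMDiffOn_iff (e := trivializationAt Plane (TangentSpace (𝓡 2)) i)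
    fun y hy => (Trivialization.mem_source _).2 (hb y hy)).2
    ⟨contMDiffOn_chart_symm, ?_⟩
  refine (contMDiffOn_const (c := (EuclideanSpace.single j 1 : Plane))).congr fun y hy => ?_
  simp only [chartFrame_eq_symmL i j hy]
  rw [Trivialization.symmL_apply, Trivialization.apply_mk_symm _ (hb y hy)]
  exact hb y hy

theorem planeArea_chartFrame_pos (hS : IsOrientedAtlas S) (i : S) {y : Plane}
    (hy : y ∈ (chartAt Plane i).target) :
    0 < planeArea (chartFrame i 0 y) (chartFrame i 1 y) := by
  have hd : MDifferentiableAt 𝓘(ℝ, Plane) (𝓡 2) (chartAt Plane i).symm y :=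
    ((contMDiffOn_chart_symm (I := 𝓡 2) (n := ∞)).contMDiffAt
      ((chartAt Plane i).open_target.mem_nhds hy)).mdifferentiableAt (by simp)
  have h := hS _ (chart_mem_atlas Plane i) _ (chart_mem_atlas Plane ((chartAt Plane i).symm y)) y
    (by simp [hy])
  have e : ∀ w : Plane, mfderiv 𝓘(ℝ, Plane) (𝓡 2) (chartAt Plane i).symm y w =
      fderiv ℝ ((chartAt Plane i).symm.trans (chartAt Plane ((chartAt Plane i).symm y))) y w := by
    intro w
    have h1 := hd.mfderiv
    refine (DFunLike.congr_fun h1 w).trans ?_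
    simp only [writtenInExtChartAt, modelWithCornersSelf_coe, range_id, fderivWithin_univ]
    rfl
  rw [plane_det_eq] at h
  unfold chartFrame
  rw [e, e]
  exact h

variable {Q : Type*} [NormedAddCommGroup Q] [NormedSpace ℝ Q]

/-- A family of two-forms on `S` depending smoothly on a parameter: in each chart, the coefficient of
`dy₀ ∧ dy₁` is a smooth function of the parameter and the coordinates. -/
def IsSmoothTwoFormFamily (η : Q → ∀ x : S, TangentSpace (𝓡 2) x → TangentSpace (𝓡 2) x → ℝ) :
    Prop :=
  ∀ i : S, ContDiffOn ℝ ∞ (fun p : Q × Plane => η p.1 ((chartAt Plane i).symm p.2)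
    (chartFrame i 0 p.2) (chartFrame i 1 p.2)) (univ ×ˢ (chartAt Plane i).target)

variable [T2Space S]

section SigmaCompact

variable [SigmaCompactSpace S]

variable (S) in
/-- The partition of unity subordinate to the charts which defines `surfaceIntegral`. -/
noncomputable def chartPartition : SmoothPartitionOfUnity S (𝓡 2) S univ :=
  (SmoothPartitionOfUnity.exists_isSubordinate_chartAt_source (𝓡 2) S).choose

theorem chartPartition_subordinate (i : S) :
    tsupport (chartPartition S i) ⊆ (chartAt Plane i).source :=
  (SmoothPartitionOfUnity.exists_isSubordinate_chartAt_source (𝓡 2) S).choose_spec i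

/-- The contribution of the chart at `i` to the integrand of `surfaceIntegral`, extended by zero. -/
noncomputable def localIntegrand
    (η : ∀ x : S, TangentSpace (𝓡 2) x → TangentSpace (𝓡 2) x → ℝ) (i : S) : Plane → ℝ :=
  (chartAt Plane i).target.indicator fun y => chartPartition S i ((chartAt Plane i).symm y) *
    η ((chartAt Plane i).symm y) (chartFrame i 0 y) (chartFrame i 1 y)

theorem surfaceIntegral_eq_finsum
    (η : ∀ x : S, TangentSpace (𝓡 2) x → TangentSpace (𝓡 2) x → ℝ) :
    surfaceIntegral η = ∑ᶠ i : S, ∫ y, localIntegrand η i y :=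
  finsum_congr fun i => (integral_indicator (chartAt Plane i).open_target.measurableSet).symm

/-- The chart contributions of a two-form are integrable. -/
def SurfaceIntegrable (η : ∀ x : S, TangentSpace (𝓡 2) x → TangentSpace (𝓡 2) x → ℝ) : Prop :=
  ∀ i : S, Integrable (localIntegrand η i)

theorem localIntegrand_add (η ζ : ∀ x : S, TangentSpace (𝓡 2) x → TangentSpace (𝓡 2) x → ℝ) (i : S) :
    localIntegrand (fun x u v => η x u v + ζ x u v) i = localIntegrand η i + localIntegrand ζ i := by
  rw [localIntegrand, localIntegrand, localIntegrand, ← indicator_add']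
  congr 1; funext y; exact mul_add _ _ _

theorem localIntegrand_smul (r : ℝ) (η : ∀ x : S, TangentSpace (𝓡 2) x → TangentSpace (𝓡 2) x → ℝ)
    (i : S) : localIntegrand (fun x u v => r * η x u v) i = fun y => r * localIntegrand η i y := by
  funext y
  by_cases hy : y ∈ (chartAt Plane i).target
  · simp only [localIntegrand, indicator_of_mem hy]; ring
  · simp [localIntegrand, indicator_of_notMem hy]

theorem surfaceIntegral_smul (r : ℝ)
    (η : ∀ x : S, TangentSpace (𝓡 2) x → TangentSpace (𝓡 2) x → ℝ) :
    surfaceIntegral (fun x u v => r * η x u v) = r * surfaceIntegral η := by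
  simp only [surfaceIntegral_eq_finsum, localIntegrand_smul, integral_const_mul]
  exact (smul_finsum r _).symm

theorem SurfaceIntegrable.add {η ζ : ∀ x : S, TangentSpace (𝓡 2) x → TangentSpace (𝓡 2) x → ℝ}
    (hη : SurfaceIntegrable η) (hζ : SurfaceIntegrable ζ) :
    SurfaceIntegrable fun x u v => η x u v + ζ x u v := fun i => by
  rw [localIntegrand_add]; exact (hη i).add (hζ i)

end SigmaCompact

variable [CompactSpace S]

theorem finite_support_chartPartition :
    {i : S | (Function.support (chartPartition S i)).Nonempty}.Finite :=
  (chartPartition S).locallyFinite.finite_nonempty_of_compact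

/-- By compactness, only finitely many charts contribute to the integral. -/
theorem surfaceIntegral_eq_sum
    (η : ∀ x : S, TangentSpace (𝓡 2) x → TangentSpace (𝓡 2) x → ℝ) :
    surfaceIntegral η =
      ∑ i ∈ (finite_support_chartPartition (S := S)).toFinset, ∫ y, localIntegrand η i y := by
  rw [surfaceIntegral_eq_finsum]
  refine finsum_eq_sum_of_support_subset _ fun i hi => ?_
  by_contra hne
  refine hi ?_
  have h0 : ∀ x, chartPartition S i x = 0 := by
    simpa [Set.not_nonempty_iff_eq_empty, Function.support_eq_empty_iff, funext_iff] using hne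
  have : localIntegrand η i = 0 := by
    simp only [localIntegrand, h0, zero_mul, indicator_zero]; rfl
  simp [this]

theorem surfaceIntegral_add {η ζ : ∀ x : S, TangentSpace (𝓡 2) x → TangentSpace (𝓡 2) x → ℝ}
    (hη : SurfaceIntegrable η) (hζ : SurfaceIntegrable ζ) :
    surfaceIntegral (fun x u v => η x u v + ζ x u v) = surfaceIntegral η + surfaceIntegral ζ := by
  rw [surfaceIntegral_eq_sum, surfaceIntegral_eq_sum, surfaceIntegral_eq_sum, ← Finset.sum_add_distrib]
  refine Finset.sum_congr rfl fun i _ => ?_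
  rw [localIntegrand_add]
  exact integral_add (hη i) (hζ i)

/-- The image in the plane of the support of a function of the partition of unity. -/
def chartSupport (i : S) : Set Plane := chartAt Plane i '' tsupport (chartPartition S i)

theorem isCompact_chartSupport (i : S) : IsCompact (chartSupport i) :=
  (isClosed_tsupport _).isCompact.image_of_continuousOn
    ((chartAt Plane i).continuousOn.mono (chartPartition_subordinate i))

theorem chartPartition_eq_zero {i : S} {y : Plane} (hy : y ∈ (chartAt Plane i).target)
    (hk : y ∉ chartSupport i) : chartPartition S i ((chartAt Plane i).symm y) = 0 := by
  by_contra h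
  exact hk ⟨_, subset_tsupport _ h, (chartAt Plane i).right_inv hy⟩

theorem localIntegrand_eq_zero (η : ∀ x : S, TangentSpace (𝓡 2) x → TangentSpace (𝓡 2) x → ℝ)
    {i : S} {y : Plane} (hk : y ∉ chartSupport i) : localIntegrand η i y = 0 := by
  by_cases hy : y ∈ (chartAt Plane i).target
  · rw [localIntegrand, indicator_of_mem hy, chartPartition_eq_zero hy hk, zero_mul]
  · rw [localIntegrand, indicator_of_notMem hy]

theorem contDiff_localIntegrand
    {η : Q → ∀ x : S, TangentSpace (𝓡 2) x → TangentSpace (𝓡 2) x → ℝ}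
    (hη : IsSmoothTwoFormFamily η) (i : S) :
    ContDiff ℝ ∞ (Function.uncurry fun q y => localIntegrand (η q) i y) := by
  rw [contDiff_iff_contDiffAt]
  rintro ⟨q, y⟩
  by_cases hy : y ∈ (chartAt Plane i).target
  · have ho : IsOpen ((univ : Set Q) ×ˢ (chartAt Plane i).target) :=
      isOpen_univ.prod (chartAt Plane i).open_target
    have hρ : ContDiffOn ℝ ∞ (fun y => chartPartition S i ((chartAt Plane i).symm y))
        (chartAt Plane i).target := by
      rw [← contMDiffOn_iff_contDiffOn]
      exact (chartPartition S i).contMDiff.comp_contMDiffOn contMDiffOn_chart_symm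
    have h1 : ContDiffOn ℝ ∞ (fun p : Q × Plane => chartPartition S i ((chartAt Plane i).symm p.2))
        (univ ×ˢ (chartAt Plane i).target) := hρ.comp contDiffOn_snd fun p hp => hp.2
    refine ((h1.mul (hη i)).contDiffAt (ho.mem_nhds ⟨mem_univ _, hy⟩)).congr_of_eventuallyEq ?_
    filter_upwards [ho.mem_nhds (show (q, y) ∈ _ from ⟨mem_univ _, hy⟩)] with p hp
    exact (indicator_of_mem hp.2 _ : localIntegrand (η p.1) i p.2 = _)
  · have hk : y ∉ chartSupport i := by
      rintro ⟨x, hx, rfl⟩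
      exact hy ((chartAt Plane i).map_source (chartPartition_subordinate i hx))
    refine (contDiffAt_const (c := (0 : ℝ))).congr_of_eventuallyEq ?_
    have ho : IsOpen ((univ : Set Q) ×ˢ (chartSupport i)ᶜ) :=
      isOpen_univ.prod (isCompact_chartSupport i).isClosed.isOpen_compl
    filter_upwards [ho.mem_nhds (show (q, y) ∈ _ from ⟨mem_univ _, hk⟩)] with p hp
    exact localIntegrand_eq_zero _ hp.2

theorem IsSmoothTwoFormFamily.continuous_localIntegrand
    {η : Q → ∀ x : S, TangentSpace (𝓡 2) x → TangentSpace (𝓡 2) x → ℝ}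
    (hη : IsSmoothTwoFormFamily η) (q : Q) (i : S) : Continuous (localIntegrand (η q) i) :=
  (contDiff_localIntegrand hη i).continuous.comp (by fun_prop : Continuous fun y => (q, y))

theorem IsSmoothTwoFormFamily.surfaceIntegrable
    {η : Q → ∀ x : S, TangentSpace (𝓡 2) x → TangentSpace (𝓡 2) x → ℝ}
    (hη : IsSmoothTwoFormFamily η) (q : Q) : SurfaceIntegrable (η q) := fun i =>
  integrable_of_compact (isCompact_chartSupport i) (fun _ => localIntegrand_eq_zero _)
    (hη.continuous_localIntegrand q i)

theorem contDiff_surfaceIntegral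
    {η : Q → ∀ x : S, TangentSpace (𝓡 2) x → TangentSpace (𝓡 2) x → ℝ}
    (hη : IsSmoothTwoFormFamily η) : ContDiff ℝ ∞ fun q => surfaceIntegral (η q) := by
  simp only [surfaceIntegral_eq_sum]
  exact ContDiff.sum fun i _ => contDiff_integral_of_compact (isCompact_chartSupport i)
    (fun _ _ => localIntegrand_eq_zero _) (contDiff_localIntegrand hη i)

theorem localIntegrand_lineDeriv
    (η : Q → ∀ x : S, TangentSpace (𝓡 2) x → TangentSpace (𝓡 2) x → ℝ) (q e : Q) (i : S) :
    localIntegrand (fun x u v => lineDeriv ℝ (fun q => η q x u v) q e) i =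
      fun y => lineDeriv ℝ (fun q => localIntegrand (η q) i y) q e := by
  funext y
  by_cases hy : y ∈ (chartAt Plane i).target
  · simp only [localIntegrand, indicator_of_mem hy, lineDeriv, deriv_const_mul_field]
  · simp [localIntegrand, indicator_of_notMem hy, lineDeriv]

/-- Differentiation of the integral of a smooth family of two-forms with respect to a parameter. -/
theorem lineDeriv_surfaceIntegral
    {η : Q → ∀ x : S, TangentSpace (𝓡 2) x → TangentSpace (𝓡 2) x → ℝ}
    (hη : IsSmoothTwoFormFamily η) (q e : Q) :
    SurfaceIntegrable (fun x u v => lineDeriv ℝ (fun q => η q x u v) q e) ∧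
    lineDeriv ℝ (fun q => surfaceIntegral (η q)) q e =
      surfaceIntegral fun x u v => lineDeriv ℝ (fun q => η q x u v) q e := by
  have h := fun i => hasLineDerivAt_integral_of_compact (μ := volume) (isCompact_chartSupport i)
    (fun _ _ => localIntegrand_eq_zero _) (contDiff_localIntegrand hη i) q e
  refine ⟨fun i => ?_, ?_⟩
  · rw [localIntegrand_lineDeriv]; exact (h i).1
  · simp only [surfaceIntegral_eq_sum, localIntegrand_lineDeriv]
    have h2 : HasDerivAt (fun r : ℝ => ∑ i ∈ (finite_support_chartPartition (S := S)).toFinset,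
        ∫ y, localIntegrand (η (q + r • e)) i y) _ 0 := HasDerivAt.fun_sum fun i _ => (h i).2
    exact h2.deriv

/-- A two-form which is nonnegative on positive bases and has integral zero vanishes at each point
on some positive basis. -/
theorem exists_eq_zero_of_surfaceIntegral_eq_zero (hS : IsOrientedAtlas S)
    {η : Q → ∀ x : S, TangentSpace (𝓡 2) x → TangentSpace (𝓡 2) x → ℝ}
    (hη : IsSmoothTwoFormFamily η) (q : Q)
    (hpos : ∀ (x : S) (u v : TangentSpace (𝓡 2) x), 0 < planeArea u v → 0 ≤ η q x u v)
    (h0 : surfaceIntegral (η q) = 0) (x : S) :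
    ∃ u v : TangentSpace (𝓡 2) x, 0 < planeArea u v ∧ η q x u v = 0 := by
  have hnn : ∀ i, 0 ≤ localIntegrand (η q) i := fun i =>
    indicator_nonneg fun y hy => mul_nonneg ((chartPartition S).nonneg i _)
      (hpos _ _ _ (planeArea_chartFrame_pos hS i hy))
  rw [surfaceIntegral_eq_sum, Finset.sum_eq_zero_iff_of_nonneg fun i _ => integral_nonneg (hnn i)]
    at h0
  obtain ⟨i, hi⟩ := (chartPartition S).exists_pos_of_mem (mem_univ x)
  have hx : x ∈ (chartAt Plane i).source :=
    chartPartition_subordinate i (subset_tsupport _ hi.ne')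
  have hz := h0 i ((Finite.mem_toFinset _).2 ⟨x, hi.ne'⟩)
  rw [integral_eq_zero_iff_of_nonneg (hnn i) (hη.surfaceIntegrable q i),
    (hη.continuous_localIntegrand q i).ae_eq_iff_eq _ continuous_zero] at hz
  have hy := (chartAt Plane i).map_source hx
  have hzy := congrFun hz (chartAt Plane i x)
  rw [localIntegrand, indicator_of_mem hy] at hzy
  have key : ∃ u v : TangentSpace (𝓡 2) ((chartAt Plane i).symm (chartAt Plane i x)),
      0 < planeArea u v ∧ η q ((chartAt Plane i).symm (chartAt Plane i x)) u v = 0 := by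
    refine ⟨_, _, planeArea_chartFrame_pos hS i hy, (mul_eq_zero.1 hzy).resolve_left ?_⟩
    rw [(chartAt Plane i).left_inv hx]
    exact hi.ne'
  rwa [(chartAt Plane i).left_inv hx] at key

end SurfaceIntegration

/-! ### The pairing of adjoint-valued one-forms -/

section Pairing

open Set Bundle

variable {EK : Type*} [NormedAddCommGroup EK] [NormedSpace ℝ EK]
  {K : Type*} [TopologicalSpace K] [ChartedSpace EK K] [Group K]

/-- The inner product as a continuous bilinear form. -/
noncomputable def InvariantMetric.formCLM [FiniteDimensional ℝ EK] (B : InvariantMetric EK K) :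
    EK →L[ℝ] EK →L[ℝ] ℝ :=
  LinearMap.toContinuousLinearMap
    ((LinearMap.toContinuousLinearMap (E := EK) (F' := ℝ) (𝕜 := ℝ) : _ →ₗ[ℝ] _).comp B.form)

theorem InvariantMetric.contDiff_form [FiniteDimensional ℝ EK] (B : InvariantMetric EK K) :
    ContDiff ℝ ∞ fun p : EK × EK => B.form p.1 p.2 :=
  (B.formCLM.contDiff.comp contDiff_fst).clm_apply contDiff_snd

variable {S : Type*} [TopologicalSpace S] [ChartedSpace Plane S] [LieGroup 𝓘(ℝ, EK) ∞ K]
  {ι : Type*} {P : PrincipalBundleCore S EK K ι}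

/-- The invariant metric on the fibres of the adjoint bundle is smooth: by invariance it may be
evaluated in any trivialization. -/
theorem contMDiffOn_form_adjoint [FiniteDimensional ℝ EK] (B : InvariantMetric EK K)
    {EN HN N : Type*} [NormedAddCommGroup EN] [NormedSpace ℝ EN] [TopologicalSpace HN]
    {IN : ModelWithCorners ℝ EN HN} [TopologicalSpace N] [ChartedSpace HN N] {b : N → S} {U : Set N}
    {s₁ s₂ : ∀ m, P.adjoint.Fiber (b m)}
    (h₁ : ContMDiffOn IN ((𝓡 2).prod 𝓘(ℝ, EK)) ∞
      (fun m => TotalSpace.mk' EK (E := P.adjoint.Fiber) (b m) (s₁ m)) U)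
    (h₂ : ContMDiffOn IN ((𝓡 2).prod 𝓘(ℝ, EK)) ∞
      (fun m => TotalSpace.mk' EK (E := P.adjoint.Fiber) (b m) (s₂ m)) U) :
    ContMDiffOn IN 𝓘(ℝ, ℝ) ∞ (fun m => B.form (s₁ m) (s₂ m)) U := by
  intro m₀ hm₀
  have t₁ := (contMDiffWithinAt_totalSpace.1 (h₁ m₀ hm₀)).2
  have t₂ := (contMDiffWithinAt_totalSpace.1 (h₂ m₀ hm₀)).2
  have h := B.contDiff_form.contDiffAt.contMDiffAt.comp_contMDiffWithinAt m₀ (t₁.prodMk_space t₂)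
  refine h.congr (fun m _ => ?_) ?_
  · exact (B.invariant _ _ _).symm
  · exact (B.invariant _ _ _).symm

variable [IsManifold (𝓡 2) ∞ S]

/-- The value at `x` of an adjoint-valued one-form, read in the preferred trivializations of the
tangent bundle and of the adjoint bundle at `x`. -/
noncomputable def OneForm.val (a : OneForm P) (x : S) : Plane →L[ℝ] EK := a x

/-- The value at `x` of an endomorphism field, read in the preferred trivialization of the tangent
bundle at `x`. -/
noncomputable def EndField.val (C : EndField S) (x : S) : Plane →L[ℝ] Plane := C x

theorem OneForm.ext_val {a b : OneForm P} (h : ∀ x, a.val x = b.val x) : a = b :=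
  ContMDiffSection.ext h

theorem OneForm.val_comp (a : OneForm P) (C : EndField S) (x : S) :
    (a.comp C).val x = (a.val x).comp (C.val x) := rfl

theorem ComplexStructure.val_mul_val (J : ComplexStructure S) (x : S) :
    J.toEnd.val x * J.toEnd.val x = -1 := J.sq x

theorem tangentJ_val {J : ComplexStructure S} (C : tangentJ J) (x : S) :
    (C : EndField S).val x * J.toEnd.val x = -(J.toEnd.val x * (C : EndField S).val x) := C.2 x

/-- The two-form `B(a ∧ b)`. -/
noncomputable def formWedge (B : InvariantMetric EK K) (a b : OneForm P) (x : S)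
    (u v : TangentSpace (𝓡 2) x) : ℝ :=
  wedge B.form (a.val x) (b.val x) u v

variable {Q : Type*} [NormedAddCommGroup Q] [NormedSpace ℝ Q]

theorem isSmoothTwoFormFamily_formWedge [FiniteDimensional ℝ EK] (B : InvariantMetric EK K)
    {a b : Q → OneForm P} (ha : IsSmoothFormFamily a) (hb : IsSmoothFormFamily b) :
    IsSmoothTwoFormFamily fun q => formWedge B (a q) (b q) := by
  intro i
  have hφ := contMDiffOn_prodMap_chart_symm (Q := Q) i
  have hf : ∀ j, ContMDiffOn 𝓘(ℝ, Q × Plane) ((𝓡 2).prod 𝓘(ℝ, Plane)) ∞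
      (fun p : Q × Plane => TotalSpace.mk' Plane (E := fun x : S => TangentSpace (𝓡 2) x)
        ((chartAt Plane i).symm p.2) (chartFrame i j p.2)) (univ ×ˢ (chartAt Plane i).target) :=
    fun j => (contMDiffOn_chartFrame i j).comp contDiff_snd.contMDiff.contMDiffOn fun p hp => hp.2
  have h : ∀ (c : Q → OneForm P), IsSmoothFormFamily c → ∀ j,
      ContMDiffOn 𝓘(ℝ, Q × Plane) ((𝓡 2).prod 𝓘(ℝ, EK)) ∞
        (fun p : Q × Plane => TotalSpace.mk' EK (E := P.adjoint.Fiber) ((chartAt Plane i).symm p.2)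
          (c p.1 ((chartAt Plane i).symm p.2) (chartFrame i j p.2)))
        (univ ×ˢ (chartAt Plane i).target) := fun c hc j =>
    ContMDiffOn.clm_bundle_apply (E₁ := fun x : S => TangentSpace (𝓡 2) x) (E₂ := P.adjoint.Fiber)
      (b := fun p : Q × Plane => (chartAt Plane i).symm p.2)
      (ϕ := fun p => c p.1 ((chartAt Plane i).symm p.2)) (hc.comp_contMDiffOn hφ) (hf j)
  have h1 := contMDiffOn_form_adjoint B (h a ha 0) (h b hb 1)
  have h2 := contMDiffOn_form_adjoint B (h a ha 1) (h b hb 0)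
  exact (contMDiffOn_iff_contDiffOn.1 h1).sub (contMDiffOn_iff_contDiffOn.1 h2)

theorem formWedge_antisymm (B : InvariantMetric EK K) (a b : OneForm P) (x : S)
    (u v : TangentSpace (𝓡 2) x) : formWedge B a b x u v = -formWedge B b a x u v :=
  wedge_antisymm B.symm _ _ _ _

theorem formWedge_eq_area (B : InvariantMetric EK K) (a b : OneForm P) (x : S)
    (u v : TangentSpace (𝓡 2) x) : formWedge B a b x u v =
      planeArea u v * formWedge B a b x (planeBasis 0) (planeBasis 1) :=
  wedge_eq_area _ _ _ _

theorem isSmoothFormFamily_const (a : OneForm P) : IsSmoothFormFamily fun _ : Q => a :=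
  a.contMDiff.comp contMDiff_snd

theorem isSmoothEndFamily_const (C : EndField S) : IsSmoothEndFamily fun _ : Q => C :=
  C.contMDiff.comp contMDiff_snd

theorem IsSmoothFormFamily.comp {a : Q → OneForm P} {C : Q → EndField S}
    (ha : IsSmoothFormFamily a) (hC : IsSmoothEndFamily C) :
    IsSmoothFormFamily fun q => (a q).comp (C q) :=
  contMDiff_hom_comp (b := fun p : Q × S => p.2) ha hC

theorem IsSmoothEndFamily.comp {C D : Q → EndField S}
    (hC : IsSmoothEndFamily C) (hD : IsSmoothEndFamily D) :
    IsSmoothEndFamily fun q => (C q).comp (D q) :=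
  contMDiff_hom_comp (b := fun p : Q × S => p.2) hC hD

theorem IsSmoothFormFamily.add {a b : Q → OneForm P}
    (ha : IsSmoothFormFamily a) (hb : IsSmoothFormFamily b) :
    IsSmoothFormFamily fun q => a q + b q :=
  contMDiff_hom_add (b := fun p : Q × S => p.2) ha hb

theorem IsSmoothFormFamily.const_smul {a : Q → OneForm P} (r : ℝ)
    (ha : IsSmoothFormFamily a) : IsSmoothFormFamily fun q => r • a q :=
  contMDiff_hom_smul (b := fun p : Q × S => p.2) r ha

variable [T2Space S] [CompactSpace S] (B : InvariantMetric EK K)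

theorem pairing_eq (a b : OneForm P) : pairing B a b = surfaceIntegral (formWedge B a b) := rfl

theorem pairing_smul_left (r : ℝ) (a c : OneForm P) :
    pairing B (r • a) c = r * pairing B a c := by
  rw [pairing_eq, pairing_eq, ← surfaceIntegral_smul]
  congr 1; funext x u v
  change B.form (r • a.val x u) _ - B.form (r • a.val x v) _ = _
  simp only [map_smul, LinearMap.smul_apply, formWedge, wedge, smul_eq_mul]
  exact (mul_sub _ _ _).symm

theorem pairing_antisymm (a b : OneForm P) : pairing B a b = -pairing B b a := by
  rw [pairing_eq, pairing_eq, neg_eq_neg_one_mul, ← surfaceIntegral_smul]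
  congr 1; funext x u v
  rw [formWedge_antisymm, neg_one_mul]

/-- The pairing is invariant under composition with a field of determinant one. -/
theorem pairing_comp_comp (a b : OneForm P) {C : EndField S}
    (hC : ∀ x, (C.val x).det = 1) :
    pairing B (a.comp C) (b.comp C) = pairing B a b := by
  rw [pairing_eq, pairing_eq]
  congr 1; funext x u v
  have h := wedge_comp_comp (β := B.form) (a.val x) (b.val x) (C.val x) u v
  rw [hC x, one_mul] at h
  exact h

theorem pairing_comp_J_comp_J (J : ComplexStructure S) (a b : OneForm P) :
    pairing B (a.comp J.toEnd) (b.comp J.toEnd) = pairing B a b :=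
  pairing_comp_comp B a b fun x => plane_det_eq_one_of_sq (J.val_mul_val x)

variable [FiniteDimensional ℝ EK]

theorem surfaceIntegrable_formWedge (a b : OneForm P) : SurfaceIntegrable (formWedge B a b) :=
  (isSmoothTwoFormFamily_formWedge (Q := ℝ) B (isSmoothFormFamily_const a)
    (isSmoothFormFamily_const b)).surfaceIntegrable 0

theorem contDiff_pairing {a b : Q → OneForm P} (ha : IsSmoothFormFamily a)
    (hb : IsSmoothFormFamily b) : ContDiff ℝ ∞ fun q => pairing B (a q) (b q) :=
  contDiff_surfaceIntegral (isSmoothTwoFormFamily_formWedge B ha hb)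

theorem pairing_add_left (a b c : OneForm P) :
    pairing B (a + b) c = pairing B a c + pairing B b c := by
  rw [pairing_eq, pairing_eq, pairing_eq, ← surfaceIntegral_add (surfaceIntegrable_formWedge B a c)
    (surfaceIntegrable_formWedge B b c)]
  congr 1; funext x u v
  change B.form (a.val x u + b.val x u) _ - B.form (a.val x v + b.val x v) _ = _
  simp only [map_add, LinearMap.add_apply, formWedge, wedge]
  exact add_sub_add_comm _ _ _ _

/-- The pairing as a bilinear form. -/
noncomputable def pairingForm : OneForm P →ₗ[ℝ] OneForm P →ₗ[ℝ] ℝ :=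
  LinearMap.mk₂ ℝ (fun a b => pairing B a b) (pairing_add_left B) (pairing_smul_left B)
    (fun a b c => by
      rw [pairing_antisymm, pairing_add_left, pairing_antisymm B b a, pairing_antisymm B c a, neg_add, neg_neg, neg_neg])
    (fun r a b => by
      rw [pairing_antisymm, pairing_smul_left, pairing_antisymm B b a, smul_eq_mul]; ring)

theorem pairingForm_apply (a b : OneForm P) : pairingForm B a b = pairing B a b := rfl

/-- The form `a ↦ ∫ B((a ∘ J) ∧ a)` is positive definite. -/
theorem eq_zero_of_pairing_comp_J_eq_zero (hS : IsOrientedAtlas S) (J : ComplexStructure S)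
    {a : OneForm P} (h : pairing B (a.comp J.toEnd) a = 0) : a = 0 := by
  -- the value on `(u, J u)` is `B(a u, a u) + B(a J u, a J u)`
  have hJ : ∀ (x : S) (u : Plane), planeArea u (J.toEnd.val x u) *
      formWedge B (a.comp J.toEnd) a x (planeBasis 0) (planeBasis 1) =
      B.form (a.val x u) (a.val x u) +
        B.form (a.val x (J.toEnd.val x u)) (a.val x (J.toEnd.val x u)) := fun x u => by
    have h1 : J.toEnd.val x (J.toEnd.val x u) = -u := DFunLike.congr_fun (J.val_mul_val x) u
    refine (formWedge_eq_area B (a.comp J.toEnd) a x u (J.toEnd.val x u)).symm.trans ?_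
    change B.form (a.val x (J.toEnd.val x u)) (a.val x (J.toEnd.val x u)) -
      B.form (a.val x (J.toEnd.val x (J.toEnd.val x u))) (a.val x u) = _
    rw [h1, map_neg, map_neg, LinearMap.neg_apply]
    ring
  have hB : ∀ ξ, 0 ≤ B.form ξ ξ := fun ξ => by
    by_cases hξ : ξ = 0
    · simp [hξ]
    · exact (B.pos ξ hξ).le
  have hne : ∀ {u v : Plane}, 0 < planeArea u v → u ≠ 0 := fun {u v} huv hu => by
    simp [planeArea, hu] at huv
  have hsm := isSmoothTwoFormFamily_formWedge (Q := ℝ) B (isSmoothFormFamily_const (a.comp J.toEnd))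
    (isSmoothFormFamily_const a)
  have hz := exists_eq_zero_of_surfaceIntegral_eq_zero hS hsm 0 (fun x u v huv => by
    have h1 := hJ x u
    have h2 := J.pos x u (hne huv)
    rw [formWedge_eq_area]
    refine mul_nonneg huv.le (le_of_mul_le_mul_left ?_ h2)
    rw [mul_zero]
    exact (add_nonneg (hB _) (hB _)).trans_eq h1.symm) h
  refine OneForm.ext_val fun x => ?_
  obtain ⟨u, v, huv, h0⟩ := hz x
  rw [formWedge_eq_area] at h0
  have hc := (mul_eq_zero.1 h0).resolve_left huv.ne'
  ext1 w
  have h1 := hJ x w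
  rw [hc, mul_zero] at h1
  by_contra hw
  have := B.pos _ hw
  linarith [hB (a.val x (J.toEnd.val x w))]

end Pairing

/-! ### The coupling form: algebraic properties -/

section Coupling

variable {S : Type*} [TopologicalSpace S] [ChartedSpace Plane S] [IsManifold (𝓡 2) ∞ S]
  {EK : Type*} [NormedAddCommGroup EK] [NormedSpace ℝ EK]
  {K : Type*} [TopologicalSpace K] [ChartedSpace EK K] [Group K] [LieGroup 𝓘(ℝ, EK) ∞ K]
  {ι : Type*} {P : PrincipalBundleCore S EK K ι}

theorem OneForm.add_comp (a b : OneForm P) (C : EndField S) :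
    (a + b).comp C = a.comp C + b.comp C := rfl

theorem OneForm.smul_comp (r : ℝ) (a : OneForm P) (C : EndField S) :
    (r • a).comp C = r • a.comp C := rfl

theorem OneForm.comp_zero (a : OneForm P) : a.comp (0 : EndField S) = 0 :=
  OneForm.ext_val fun x => (a.val x).comp_zero

theorem comp_J_comp_tangent {J : ComplexStructure S} (a : OneForm P) (C : tangentJ J) :
    a.comp (J.toEnd.comp C) = -(a.comp C).comp J.toEnd := by
  refine OneForm.ext_val fun x => ?_
  ext1 u
  have h : (C : EndField S).val x (J.toEnd.val x u) = -(J.toEnd.val x ((C : EndField S).val x u)) :=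
    DFunLike.congr_fun (tangentJ_val C x) u
  change a.val x (J.toEnd.val x ((C : EndField S).val x u)) =
    -(a.val x ((C : EndField S).val x (J.toEnd.val x u)))
  rw [h, map_neg, neg_neg]

theorem OneForm.comp_J_J (a : OneForm P) (J : ComplexStructure S) (C : EndField S) :
    a.comp (J.toEnd.comp (J.toEnd.comp C)) = -a.comp C := by
  refine OneForm.ext_val fun x => ?_
  ext1 u
  have h : J.toEnd.val x (J.toEnd.val x ((C.val x) u)) = -(C.val x u) :=
    DFunLike.congr_fun (J.val_mul_val x) _
  change a.val x (J.toEnd.val x (J.toEnd.val x (C.val x u))) = -(a.val x (C.val x u))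
  rw [h, map_neg]

theorem OneForm.comp_J_comp_J (a : OneForm P) (J : ComplexStructure S) :
    (a.comp J.toEnd).comp J.toEnd = -a := by
  refine OneForm.ext_val fun x => ?_
  ext1 u
  have h : J.toEnd.val x (J.toEnd.val x u) = -u := DFunLike.congr_fun (J.val_mul_val x) _
  change a.val x (J.toEnd.val x (J.toEnd.val x u)) = -(a.val x u)
  rw [h, map_neg]

/-- The component along `Ω¹(S, E_K(𝔨))` of the vertical projection of a tangent vector. -/
noncomputable def verticalPart (p : Config P) (v : Tangent p) : OneForm P :=
  v.2.2 + (1 / 2 : ℝ) • p.ψ.comp (p.J.toEnd.comp v.1)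

theorem connectionI_proj (p : Config P) (v : Tangent p) :
    ((connectionI P).proj p v : Tangent p) = (0, v.2.1, verticalPart p v) := by
  refine (projectionOnto_liftI p v).trans ?_
  refine Prod.ext (sub_self v.1) (Prod.ext (sub_zero v.2.1) ?_)
  change v.2.2 - -(1 / 2 : ℝ) • p.ψ.comp (p.J.toEnd.comp v.1) = _
  rw [neg_smul, sub_neg_eq_add, verticalPart]

theorem mem_horizontal_iff (p : Config P) (v : Tangent p) :
    v ∈ (connectionI P).horizontal p ↔ v.2.1 = 0 ∧ verticalPart p v = 0 := by
  have h1 : v ∈ (connectionI P).horizontal p ↔ (connectionI P).proj p v = 0 :=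
    (Submodule.projectionOnto_apply_eq_zero_iff ((connectionI P).isCompl p)).symm
  rw [h1, ← Submodule.coe_eq_zero, connectionI_proj]
  exact ⟨fun h => ⟨congrArg (fun v : Tangent p => v.2.1) h, congrArg (fun v : Tangent p => v.2.2) h⟩,
    fun h => Prod.ext rfl (Prod.ext h.1 h.2)⟩

theorem verticalPart_of_mem_vertical {p : Config P} {v : Tangent p} (hv : v ∈ vertical p) :
    verticalPart p v = v.2.2 := by
  have h : v.1 = 0 := hv
  rw [verticalPart, h]
  have h2 : p.ψ.comp (p.J.toEnd.comp ((0 : tangentJ p.J) : EndField S)) = 0 := by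
    rw [comp_J_comp_tangent]
    exact OneForm.ext_val fun x => by
      ext1 u
      change -(p.ψ.val x 0) = 0
      rw [map_zero, neg_zero]
  rw [h2, smul_zero, add_zero]

theorem comp_of_mem_vertical {p : Config P} {v : Tangent p} (hv : v ∈ vertical p) :
    p.ψ.comp v.1 = 0 := by
  have h : v.1 = 0 := hv
  rw [h]
  exact OneForm.comp_zero _

theorem verticalPart_complexI (p : Config P) (v : Tangent p) :
    verticalPart p (complexI p v) = (verticalPart p v).comp p.J.toEnd := by
  change v.2.2.comp p.J.toEnd + p.ψ.comp v.1 +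
    (1 / 2 : ℝ) • p.ψ.comp (p.J.toEnd.comp (p.J.toEnd.comp v.1)) = _
  rw [OneForm.comp_J_J, verticalPart, OneForm.add_comp, OneForm.smul_comp, comp_J_comp_tangent]
  have h : (-(p.ψ.comp v.1).comp p.J.toEnd).comp p.J.toEnd = p.ψ.comp v.1 := by
    have := (p.ψ.comp v.1).comp_J_comp_J p.J
    rw [← neg_eq_iff_eq_neg] at this
    exact this
  rw [h]
  module

theorem complexI_mem_horizontal {p : Config P} {v : Tangent p}
    (hv : v ∈ (connectionI P).horizontal p) : complexI p v ∈ (connectionI P).horizontal p := by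
  rw [mem_horizontal_iff] at hv ⊢
  rw [verticalPart_complexI, hv.2]
  have h0 : (0 : OneForm P).comp p.J.toEnd = 0 := rfl
  refine ⟨?_, h0⟩
  change -(v.2.1.comp p.J.toEnd) = 0
  rw [hv.1, h0, neg_zero]

theorem IsSmoothVectorFamily.verticalPart {Q : Type*} [NormedAddCommGroup Q] [NormedSpace ℝ Q]
    {c : Q → Config P} {v : ∀ t, Tangent (c t)} (hc : IsSmoothFamily c)
    (hv : IsSmoothVectorFamily c v) : IsSmoothFormFamily fun t => verticalPart (c t) (v t) :=
  hv.smooth_ψ.add ((hc.smooth_ψ.comp (hc.smooth_J.comp hv.smooth_J)).const_smul _)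

variable [T2Space S] [CompactSpace S] (B : InvariantMetric EK K)

theorem sigmaI_eq (p : Config P) (v w : Tangent p) :
    sigmaI B p v w = pairing B v.2.1 w.2.1 - pairing B (verticalPart p v) (verticalPart p w) -
      1 / 4 * pairing B (p.ψ.comp v.1) (p.ψ.comp w.1) := by
  rw [sigmaI, fibreForm, connectionI_proj, connectionI_proj]
  rfl

theorem pairing_neg_comp_J (J : ComplexStructure S) (a b : OneForm P) :
    pairing B (-(a.comp J.toEnd)) (-(b.comp J.toEnd)) = pairing B a b := by
  have h : ∀ a : OneForm P, -(a.comp J.toEnd) = (-1 : ℝ) • a.comp J.toEnd := fun a => by module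
  rw [h, h, pairing_smul_left, pairing_antisymm, pairing_smul_left, pairing_antisymm B,
    pairing_comp_J_comp_J]
  ring

theorem isType11_sigmaI : IsType11 (sigmaI (P := P) B) := by
  intro p v w
  rw [sigmaI_eq, sigmaI_eq, verticalPart_complexI, verticalPart_complexI, pairing_comp_J_comp_J]
  congr 1
  · congr 1
    exact pairing_neg_comp_J B p.J _ _
  · congr 1
    change pairing B (p.ψ.comp (p.J.toEnd.comp v.1)) (p.ψ.comp (p.J.toEnd.comp w.1)) = _
    rw [comp_J_comp_tangent, comp_J_comp_tangent, pairing_neg_comp_J]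

variable [FiniteDimensional ℝ EK]

theorem sigmaI_eq' (p : Config P) (v w : Tangent p) :
    sigmaI B p v w = pairing B v.2.1 w.2.1 - pairing B v.2.2 w.2.2 -
      1 / 2 * pairing B (p.ψ.comp (p.J.toEnd.comp v.1)) w.2.2 -
      1 / 2 * pairing B v.2.2 (p.ψ.comp (p.J.toEnd.comp w.1)) -
      1 / 2 * pairing B (p.ψ.comp v.1) (p.ψ.comp w.1) := by
  have h : pairing B (p.ψ.comp (p.J.toEnd.comp v.1)) (p.ψ.comp (p.J.toEnd.comp w.1)) =
      pairing B (p.ψ.comp v.1) (p.ψ.comp w.1) := by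
    rw [comp_J_comp_tangent, comp_J_comp_tangent, pairing_neg_comp_J]
  rw [sigmaI_eq, verticalPart, verticalPart]
  simp only [← pairingForm_apply] at h ⊢
  simp only [map_add, map_smul, LinearMap.add_apply, LinearMap.smul_apply, smul_eq_mul]
  linear_combination (-1 / 4) * h

theorem pairing_zero_left (a : OneForm P) : pairing B 0 a = 0 := by
  rw [← pairingForm_apply, map_zero, LinearMap.zero_apply]

theorem pairing_zero_right (a : OneForm P) : pairing B a 0 = 0 := by
  rw [← pairingForm_apply, map_zero]

theorem sigmaI_of_mem_vertical {p : Config P} (v : Tangent p) {w : Tangent p}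
    (hw : w ∈ vertical p) :
    sigmaI B p v w = pairing B v.2.1 w.2.1 - pairing B (verticalPart p v) w.2.2 := by
  rw [sigmaI_eq, comp_of_mem_vertical hw, pairing_zero_right, verticalPart_of_mem_vertical hw,
    mul_zero, sub_zero]

theorem isTwoForm_sigmaI : IsTwoForm (sigmaI (P := P) B) where
  add_left p u v w := by
    have h : verticalPart p (u + v) = verticalPart p u + verticalPart p v := by
      refine OneForm.ext_val fun x => ?_
      ext1 z
      change (u.2.2.val x z + v.2.2.val x z) + (1 / 2 : ℝ) • p.ψ.val x (p.J.toEnd.val x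
        ((u.1 : EndField S).val x z + (v.1 : EndField S).val x z)) =
        (u.2.2.val x z + (1 / 2 : ℝ) • p.ψ.val x (p.J.toEnd.val x ((u.1 : EndField S).val x z))) +
        (v.2.2.val x z + (1 / 2 : ℝ) • p.ψ.val x (p.J.toEnd.val x ((v.1 : EndField S).val x z)))
      rw [map_add, map_add]
      module
    have h2 : p.ψ.comp ((u + v).1 : tangentJ p.J) = p.ψ.comp u.1 + p.ψ.comp v.1 := by
      refine OneForm.ext_val fun x => ?_
      ext1 z
      exact map_add (p.ψ.val x) ((u.1 : EndField S).val x z) ((v.1 : EndField S).val x z)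
    rw [sigmaI_eq, sigmaI_eq, sigmaI_eq, h, h2]
    change pairing B (u.2.1 + v.2.1) _ - _ - _ = _
    rw [pairing_add_left, pairing_add_left, pairing_add_left]
    ring
  smul_left p r v w := by
    have h : verticalPart p (r • v) = r • verticalPart p v := by
      refine OneForm.ext_val fun x => ?_
      ext1 z
      change r • v.2.2.val x z + (1 / 2 : ℝ) • p.ψ.val x (p.J.toEnd.val x
        (r • (v.1 : EndField S).val x z)) =
        r • (v.2.2.val x z + (1 / 2 : ℝ) • p.ψ.val x (p.J.toEnd.val x ((v.1 : EndField S).val x z)))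
      rw [map_smul, map_smul]
      module
    have h2 : p.ψ.comp ((r • v).1 : tangentJ p.J) = r • p.ψ.comp v.1 := by
      refine OneForm.ext_val fun x => ?_
      ext1 z
      exact map_smul (p.ψ.val x) r ((v.1 : EndField S).val x z)
    rw [sigmaI_eq, sigmaI_eq, h, h2]
    change pairing B (r • v.2.1) _ - _ - _ = _
    rw [pairing_smul_left, pairing_smul_left, pairing_smul_left]
    ring
  antisymm p v w := by
    rw [sigmaI_eq, sigmaI_eq, pairing_antisymm, pairing_antisymm B (verticalPart p v),
      pairing_antisymm B (p.ψ.comp v.1)]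
    ring
  smooth n c v w hc hv hw := by
    simp only [sigmaI_eq]
    exact ((contDiff_pairing B hv.smooth_A hw.smooth_A).sub
      (contDiff_pairing B (hv.verticalPart hc) (hw.verticalPart hc))).sub
      (contDiff_const.mul (contDiff_pairing B (hc.smooth_ψ.comp hv.smooth_J)
        (hc.smooth_ψ.comp hw.smooth_J)))

theorem sigmaI_restrict (p : Config P) (v w : vertical p) :
    sigmaI B p v w = fibreForm B p v w := by
  rw [sigmaI_of_mem_vertical B _ w.2, verticalPart_of_mem_vertical v.2, fibreForm]

/-- The vertical bundle determines the horizontal one: testing `σ` against `a ∘ J` for the vertical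
components `a` of a vector gives their norms. -/
theorem mem_horizontal_iff_sigmaI (hS : IsOrientedAtlas S) (p : Config P) (v : Tangent p) :
    v ∈ (connectionI P).horizontal p ↔ ∀ w ∈ vertical p, sigmaI B p v w = 0 := by
  rw [mem_horizontal_iff]
  constructor
  · rintro ⟨h1, h2⟩ w hw
    rw [sigmaI_of_mem_vertical B v hw, h1, h2, pairing_zero_left, pairing_zero_left, sub_zero]
  · intro h
    constructor
    · have h1 := h (0, v.2.1.comp p.J.toEnd, 0) rfl
      rw [sigmaI_of_mem_vertical B v rfl, pairing_zero_right, sub_zero, pairing_antisymm,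
        neg_eq_zero] at h1
      exact eq_zero_of_pairing_comp_J_eq_zero B hS p.J h1
    · have h1 := h (0, 0, (verticalPart p v).comp p.J.toEnd) rfl
      rw [sigmaI_of_mem_vertical B v rfl, pairing_zero_right, zero_sub, pairing_antisymm,
        neg_neg] at h1
      exact eq_zero_of_pairing_comp_J_eq_zero B hS p.J h1

end Coupling

/-! ### Velocities of smooth families -/

section Velocity

open Set Bundle

variable {S : Type*} [TopologicalSpace S] [ChartedSpace Plane S]
  {Q : Type*} [NormedAddCommGroup Q] [NormedSpace ℝ Q]

section Generic

variable {F : Type*} [NormedAddCommGroup F] [NormedSpace ℝ F]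
  {E : S → Type*} [∀ x, AddCommGroup (E x)] [∀ x, Module ℝ (E x)]
  [TopologicalSpace (TotalSpace F E)] [∀ x, TopologicalSpace (E x)]
  [FiberBundle F E] [VectorBundle ℝ F E] [ContMDiffVectorBundle ∞ F E (𝓡 2)]

theorem exists_hasDerivAt_section [∀ x, ContinuousSMul ℝ (E x)] {s : Q → ∀ x, E x} (e : Q)
    (hs : ContMDiff (𝓘(ℝ, Q).prod (𝓡 2)) ((𝓡 2).prod 𝓘(ℝ, F)) ∞
      (fun p : Q × S => TotalSpace.mk' F p.2 (s p.1 p.2))) :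
    ∃ s' : Q → ∀ x, E x, ∀ q x, HasDerivAt (fun r : ℝ => s (q + r • e) x) (s' q x) 0 := by
  have key : ∀ q x, ∃ f' : E x, HasDerivAt (fun r : ℝ => s (q + r • e) x) f' 0 := fun q x => by
    have hx := FiberBundle.mem_baseSet_trivializationAt' (F := F) (E := E) x
    have h1 := ((contDiff_section_apply hs x).comp
      (by fun_prop : ContDiff ℝ ∞ fun r : ℝ => q + r • e)).differentiable (by simp) 0
    have h2 := hasDerivAt_clm_comp ((trivializationAt F E x).symmL ℝ x) h1.hasDerivAt
    have e : (fun r : ℝ => s (q + r • e) x) = fun r => (trivializationAt F E x).symmL ℝ x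
        ((trivializationAt F E x).continuousLinearMapAt ℝ x (s (q + r • e) x)) :=
      funext fun r => (Trivialization.symmL_continuousLinearMapAt _ hx _).symm
    rw [e]
    exact ⟨_, h2⟩
  choose s' hs' using key
  exact ⟨s', hs'⟩

end Generic

theorem contMDiff_slice (q : Q) : ContMDiff (𝓡 2) (𝓘(ℝ, Q).prod (𝓡 2)) ∞ fun x : S => (q, x) :=
  contMDiff_const.prodMk contMDiff_id

variable [IsManifold (𝓡 2) ∞ S]

theorem IsSmoothEndFamily.contDiff_val {C : Q → EndField S} (hC : IsSmoothEndFamily C) (x : S) :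
    ContDiff ℝ ∞ fun q => (C q).val x := by
  have h := contDiff_section_apply (s := fun q x => C q x) hC x
  have hx := FiberBundle.mem_baseSet_trivializationAt' (F := Plane →L[ℝ] Plane)
    (E := fun x : S => TangentSpace (𝓡 2) x →L[ℝ] TangentSpace (𝓡 2) x) x
  let T : (Plane →L[ℝ] Plane) →L[ℝ] (Plane →L[ℝ] Plane) := (trivializationAt (Plane →L[ℝ] Plane)
    (fun x : S => TangentSpace (𝓡 2) x →L[ℝ] TangentSpace (𝓡 2) x) x).symmL ℝ x
  convert! T.contDiff.comp h using 1
  funext q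
  exact (Trivialization.symmL_continuousLinearMapAt _ hx _).symm

variable {EK : Type*} [NormedAddCommGroup EK] [NormedSpace ℝ EK]
  {K : Type*} [TopologicalSpace K] [ChartedSpace EK K] [Group K] [LieGroup 𝓘(ℝ, EK) ∞ K]
  {ι : Type*} {P : PrincipalBundleCore S EK K ι}

theorem IsSmoothFormFamily.contDiff_val {a : Q → OneForm P} (ha : IsSmoothFormFamily a) (x : S) :
    ContDiff ℝ ∞ fun q => (a q).val x := by
  have h := contDiff_section_apply (s := fun q x => a q x) ha x
  have hx := FiberBundle.mem_baseSet_trivializationAt' (F := Plane →L[ℝ] EK)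
    (E := fun x : S => TangentSpace (𝓡 2) x →L[ℝ] P.adjoint.Fiber x) x
  let T : (Plane →L[ℝ] EK) →L[ℝ] (Plane →L[ℝ] EK) := (trivializationAt (Plane →L[ℝ] EK)
    (fun x : S => TangentSpace (𝓡 2) x →L[ℝ] P.adjoint.Fiber x) x).symmL ℝ x
  convert! T.contDiff.comp h using 1
  funext q
  exact (Trivialization.symmL_continuousLinearMapAt _ hx _).symm

theorem IsSmoothEndFamily.deriv_param {C C' : Q → EndField S} (e : Q) (hC : IsSmoothEndFamily C)
    (hd : ∀ q x, HasDerivAt (fun r : ℝ => (C (q + r • e)).val x) ((C' q).val x) 0) :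
    IsSmoothEndFamily C' :=
  contMDiff_section_deriv_param (s := fun q x => C q x) (s' := fun q x => C' q x) e hC hd

theorem IsSmoothFormFamily.deriv_param {a a' : Q → OneForm P} (e : Q) (ha : IsSmoothFormFamily a)
    (hd : ∀ q x, HasDerivAt (fun r : ℝ => (a (q + r • e)).val x) ((a' q).val x) 0) :
    IsSmoothFormFamily a' :=
  contMDiff_section_deriv_param (s := fun q x => a q x) (s' := fun q x => a' q x) e ha hd

/-- A smooth path of complex structures has a velocity, which is a smooth family of tangent vectors
of `𝒥`. -/
theorem exists_velocity_J {γ : ℝ → ComplexStructure S}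
    (hγ : IsSmoothEndFamily fun t => (γ t).toEnd) :
    ∃ X : ∀ t, tangentJ (γ t), IsSmoothEndFamily (fun t => (X t : EndField S)) ∧
      ∀ t x, HasDerivAt (fun r => (γ r).toEnd.val x) ((X t : EndField S).val x) t := by
  obtain ⟨s', hs'⟩ := exists_hasDerivAt_section (s := fun t x => (γ t).toEnd x) (1 : ℝ) hγ
  have hsm := contMDiff_section_deriv_param (s := fun t x => (γ t).toEnd x) (s' := s') (1 : ℝ) hγ hs'
  have hd : ∀ t x, HasDerivAt (fun r => (γ r).toEnd.val x) (s' t x : Plane →L[ℝ] Plane) t := by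
    intro t x
    have h : HasDerivAt (fun r : ℝ => (γ (t + r • (1 : ℝ))).toEnd.val x)
      (s' t x : Plane →L[ℝ] Plane) (t - t) := by rw [sub_self]; exact hs' t x
    have h2 := h.comp_sub_const t t
    simpa using h2
  refine ⟨fun t => ⟨⟨s' t, hsm.comp (contMDiff_slice t)⟩, fun x => ?_⟩, hsm, hd⟩
  have h1 := (hd t x).mul (hd t x)
  have h2 : ((fun r => (γ r).toEnd.val x) * fun r => (γ r).toEnd.val x) = fun _ => -1 :=
    funext fun r => (γ r).val_mul_val x
  rw [h2] at h1
  exact eq_neg_of_add_eq_zero_left (h1.unique (hasDerivAt_const _ _))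

end Velocity

/-! ### Parallel transport -/

section Transport

open Set Bundle

variable {S : Type*} [TopologicalSpace S] [ChartedSpace Plane S] [IsManifold (𝓡 2) ∞ S]

theorem IsSmoothEndFamily.contMDiff_trace {Q : Type*} [NormedAddCommGroup Q] [NormedSpace ℝ Q]
    {C : Q → EndField S} (hC : IsSmoothEndFamily C) :
    ContMDiff (𝓘(ℝ, Q).prod (𝓡 2)) 𝓘(ℝ, ℝ) ∞ fun p : Q × S => planeTrace ((C p.1).val p.2) :=
  contMDiff_hom_trace (E₂ := fun x : S => TangentSpace (𝓡 2) x) (b := fun p : Q × S => p.2) hC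

theorem ComplexStructure.trace_mul_neg (J₀ J : ComplexStructure S) (x : S) :
    planeTrace (J₀.toEnd.val x * J.toEnd.val x) < 0 :=
  planeTrace_mul_neg (J₀.val_mul_val x) (J.val_mul_val x) (J₀.pos x) (J.pos x)

/-- The fundamental solution `U` of the linear equation `U' = -½ U J J'` along a path of complex
structures, which starts at the identity at time `s`. -/
structure IsTransportField (γ : ℝ → ComplexStructure S) (X : ∀ t, tangentJ (γ t)) (s : ℝ)
    (U : ℝ → EndField S) : Prop where
  smooth : IsSmoothEndFamily U
  start : ∀ x, (U s).val x = 1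
  det : ∀ t x, ((U t).val x).det = 1
  deriv : ∀ t x, HasDerivAt (fun r => (U r).val x)
    (-(1 / 2 : ℝ) • ((U t).val x * ((γ t).toEnd.val x * (X t : EndField S).val x))) t

/-- The fundamental solution is a rotor whose angle is a primitive of an explicit function. In
particular it depends smoothly on the point of the surface. -/
theorem exists_isTransportField {γ : ℝ → ComplexStructure S} {X : ∀ t, tangentJ (γ t)}
    (hγ : IsSmoothEndFamily fun t => (γ t).toEnd)
    (hX : IsSmoothEndFamily fun t => (X t : EndField S))
    (hd : ∀ t x, HasDerivAt (fun r => (γ r).toEnd.val x) ((X t : EndField S).val x) t) (s : ℝ) :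
    ∃ U, IsTransportField γ X s U := by
  have hJ₀ := isSmoothEndFamily_const (Q := ℝ) (γ s).toEnd
  have hJ₀J := hJ₀.comp hγ
  have hτ := hJ₀J.contMDiff_trace
  have hκ := (hJ₀.comp (hγ.comp hX)).contMDiff_trace
  have hpos : ∀ p : ℝ × S, 0 < 2 - planeTrace ((γ s).toEnd.val p.2 * (γ p.1).toEnd.val p.2) :=
    fun p => by linarith [(γ s).trace_mul_neg (γ p.1) p.2]
  -- the rate of rotation
  set f : ℝ × S → ℝ := fun p =>
    planeTrace ((γ s).toEnd.val p.2 * ((γ p.1).toEnd.val p.2 * (X p.1 : EndField S).val p.2)) /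
      (2 * (2 - planeTrace ((γ s).toEnd.val p.2 * (γ p.1).toEnd.val p.2))) with hf_def
  have hf : ContMDiff (𝓘(ℝ, ℝ).prod (𝓡 2)) 𝓘(ℝ, ℝ) ∞ f :=
    hκ.div₀ (contMDiff_const.mul (contMDiff_const.sub hτ)) fun p => (mul_pos two_pos (hpos p)).ne'
  set θ : ℝ → S → ℝ := fun t x => ∫ τ in s..t, f (τ, x) with hθ_def
  have hθ : ContMDiff (𝓘(ℝ, ℝ).prod (𝓡 2)) 𝓘(ℝ, ℝ) ∞ fun p : ℝ × S => θ p.1 p.2 :=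
    contMDiff_intervalIntegral hf s
  have hc : ContMDiff (𝓘(ℝ, ℝ).prod (𝓡 2)) 𝓘(ℝ, ℝ) ∞ fun p : ℝ × S =>
      (√(2 - planeTrace ((γ s).toEnd.val p.2 * (γ p.1).toEnd.val p.2)))⁻¹ := fun p => by
    have h : ContDiffAt ℝ ∞ (fun y => (√y)⁻¹)
        (2 - planeTrace ((γ s).toEnd.val p.2 * (γ p.1).toEnd.val p.2)) :=
      (Real.contDiffAt_sqrt (hpos p).ne').inv (Real.sqrt_pos.2 (hpos p)).ne'
    have h2 := (contMDiff_const (c := (2 : ℝ))).sub hτ p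
    exact ContDiffAt.comp_contMDiffAt (g := fun y => (√y)⁻¹)
      (f := fun p : ℝ × S => 2 - planeTrace ((γ s).toEnd.val p.2 * (γ p.1).toEnd.val p.2)) h h2
  have hsm := contMDiff_hom_fun_smul (b := fun p : ℝ × S => p.2) hc
    (contMDiff_hom_comp (b := fun p : ℝ × S => p.2)
      (contMDiff_hom_add (b := fun p : ℝ × S => p.2)
        (contMDiff_hom_fun_smul (b := fun p : ℝ × S => p.2) (Real.contDiff_cos.comp_contMDiff hθ)
          (contMDiff_hom_id (E₂ := fun x : S => TangentSpace (𝓡 2) x) contMDiff_snd))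
        (contMDiff_hom_fun_smul (b := fun p : ℝ × S => p.2) (Real.contDiff_sin.comp_contMDiff hθ) hJ₀))
      (contMDiff_hom_add (b := fun p : ℝ × S => p.2)
        (contMDiff_hom_id (E₂ := fun x : S => TangentSpace (𝓡 2) x) contMDiff_snd)
        (contMDiff_hom_smul (b := fun p : ℝ × S => p.2) (-1) hJ₀J)))
  have hval : ∀ t x, (√(2 - planeTrace ((γ s).toEnd.val x * (γ t).toEnd.val x)))⁻¹ •
      ((Real.cos (θ t x) • (1 : Plane →L[ℝ] Plane) + Real.sin (θ t x) • (γ s).toEnd.val x) *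
        (1 + (-1 : ℝ) • ((γ s).toEnd.val x * (γ t).toEnd.val x))) =
      rotor planeTrace ((γ s).toEnd.val x) ((γ t).toEnd.val x) (θ t x) := fun t x => by
    have h1 : ∀ Y : Plane →L[ℝ] Plane, 1 + (-1 : ℝ) • Y = 1 - Y := fun Y => by
      ext; simp [sub_eq_add_neg]
    rw [rotor, h1]
  refine ⟨fun t => ⟨_, hsm.comp (contMDiff_slice t)⟩, hsm, fun x => ?_, fun t x => ?_, fun t x => ?_⟩
  · refine (hval s x).trans ?_
    rw [hθ_def]
    simp only [intervalIntegral.integral_same]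
    exact rotor_self ((γ s).val_mul_val x) planeTrace_one
  · refine (congrArg _ (hval t x)).trans ?_
    exact rotor_det ((γ s).val_mul_val x) ((γ t).val_mul_val x) ((γ s).trace_mul_neg (γ t) x) _
  · have hcont : Continuous fun τ => f (τ, x) :=
      hf.continuous.comp (by fun_prop : Continuous fun τ : ℝ => (τ, x))
    have h := hasDerivAt_rotor (J := fun r => (γ r).toEnd.val x) (θ := fun r => θ r x) (t := t)
      ((γ s).val_mul_val x) ((γ t).val_mul_val x) (tangentJ_val (X t) x)
      ((γ s).trace_mul_neg (γ t) x) (hd t x) (hcont.integral_hasStrictDerivAt s t).hasDerivAt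
    rw [← hval t x] at h
    exact h.congr_of_eventuallyEq (Filter.Eventually.of_forall fun r => hval r x)

variable {EK : Type*} [NormedAddCommGroup EK] [NormedSpace ℝ EK]
  {K : Type*} [TopologicalSpace K] [ChartedSpace EK K] [Group K]
  {ι : Type*} {P : PrincipalBundleCore S EK K ι}

/-- A connection is determined by its potentials in the preferred trivializations. -/
theorem Connection.ext_indexAt {A A' : Connection P}
    (h : ∀ x, A.pot (P.indexAt x) x = A'.pot (P.indexAt x) x) : A = A' := by
  have hpot : A.pot = A'.pot := by
    funext i x
    by_cases hx : x ∈ P.baseSet i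
    · rw [A.gauge (P.indexAt x) i x ⟨P.mem_baseSet_at x, hx⟩,
        A'.gauge (P.indexAt x) i x ⟨P.mem_baseSet_at x, hx⟩, h]
    · rw [A.pot_eq_zero i x hx, A'.pot_eq_zero i x hx]
  cases A; cases A'; congr

/-- The value at `x` of the potential of a connection in the trivialization in which the fibre of
the adjoint bundle at `x` is read. -/
def Connection.val (A : Connection P) (x : S) : Plane →L[ℝ] EK :=
  A.pot (P.indexAt x) x

theorem isSmoothConnectionFamily_const {Q : Type*} [NormedAddCommGroup Q] [NormedSpace ℝ Q]
    (A : Connection P) : IsSmoothConnectionFamily fun _ : Q => A := fun i =>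
  (A.contMDiffOn_pot i).comp contMDiff_snd.contMDiffOn fun _ hp => hp.2

variable [LieGroup 𝓘(ℝ, EK) ∞ K]

/-- The parallel transport of `p` to the fibre over `J`, with `U` the fundamental solution. -/
noncomputable def transported (J : ComplexStructure S) (U : EndField S) (p : Config P) : Config P :=
  ⟨J, p.A, p.ψ.comp U⟩

variable {γ : ℝ → ComplexStructure S} {X : ∀ t, tangentJ (γ t)} {s : ℝ} {U : ℝ → EndField S}

theorem hasDerivAt_add_smul_one {V : Type*} [NormedAddCommGroup V] [NormedSpace ℝ V] {f : ℝ → V}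
    {f' : V} {t : ℝ} : HasDerivAt (fun r : ℝ => f (t + r • (1 : ℝ))) f' 0 ↔ HasDerivAt f f' t := by
  simp only [smul_eq_mul, mul_one]
  refine ⟨fun h => ?_, fun h => ?_⟩
  · have h1 : HasDerivAt (fun r : ℝ => f (t + r)) f' (t - t) := by rwa [sub_self]
    simpa using h1.comp_sub_const t t
  · exact HasDerivAt.comp_const_add t 0 (by rwa [add_zero])

theorem isHorizontalLift_transported (hγ : IsSmoothEndFamily fun t => (γ t).toEnd)
    (hd : ∀ t x, HasDerivAt (fun r => (γ r).toEnd.val x) ((X t : EndField S).val x) t)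
    (hU : IsTransportField γ X s U) (p : Config P) :
    IsHorizontalLift (connectionI P) γ fun t => transported (γ t) (U t) p where
  smooth := ⟨hγ, isSmoothConnectionFamily_const p.A, (isSmoothFormFamily_const p.ψ).comp hU.smooth⟩
  lift _ := rfl
  horizontal t := by
    refine ⟨liftI (transported (γ t) (U t) p) (X t), ⟨_, rfl⟩, ?_, ?_, ?_⟩
    · exact fun x => hasDerivAt_add_smul_one.2 (hd t x)
    · exact fun x => hasDerivAt_const (0 : ℝ) (p.A.val x)
    · intro x
      have h1 := (ContinuousLinearMap.compL ℝ Plane Plane EK (p.ψ.val x)).hasFDerivAt.comp_hasDerivAt t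
        (hU.deriv t x)
      refine (hasDerivAt_add_smul_one (f := fun r => (p.ψ.val x).comp ((U r).val x))).2
        (h1.congr_deriv ?_)
      rw [map_smul]
      rfl

/-- A horizontal lift is determined by its starting point. -/
theorem IsHorizontalLift.eq_transported
    (hd : ∀ t x, HasDerivAt (fun r => (γ r).toEnd.val x) ((X t : EndField S).val x) t)
    (hU : IsTransportField γ X s U) {c : ℝ → Config P} (hc : IsHorizontalLift (connectionI P) γ c)
    (t : ℝ) : c t = transported (γ t) (U t) (c s) := by
  have hA : (c t).A = (c s).A := by
    refine Connection.ext_indexAt fun x => ?_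
    have h0 : ∀ t, HasDerivAt (fun r => (c r).A.val x) 0 t := by
      intro t
      obtain ⟨_, ⟨C, rfl⟩, hv⟩ := hc.horizontal t
      exact (hasDerivAt_add_smul_one
        (f := fun r => (c r).A.val x)).1 (hv.deriv_A x)
    exact is_const_of_deriv_eq_zero (fun t => (h0 t).differentiableAt) (fun t => (h0 t).deriv) t s
  have hψ : (c t).ψ = (c s).ψ.comp (U t) := by
    refine OneForm.ext_val fun x => ?_
    refine eq_of_hasDerivAt_mul (ContinuousLinearMap.compL ℝ Plane Plane EK) (fun _ _ _ => rfl)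
      (fun _ => rfl) (M := fun t => (γ t).toEnd.val x * (X t : EndField S).val x)
      (U := fun t => (U t).val x) (φ := fun t => (c t).ψ.val x) (fun t => hU.deriv t x)
      (fun t => isUnit_of_plane_det_eq_one (hU.det t x)) (hU.start x) (fun t => ?_) t
    obtain ⟨_, ⟨C, rfl⟩, hv⟩ := hc.horizontal t
    have hC : (C : EndField S).val x = (X t : EndField S).val x := by
      have h1 := (hasDerivAt_add_smul_one (f := fun r => (c r).J.toEnd.val x)).1 (hv.deriv_J x)
      simp only [hc.lift] at h1
      exact h1.unique (hd t x)
    refine ((hasDerivAt_add_smul_one (f := fun r => (c r).ψ.val x)).1 (hv.deriv_ψ x)).congr_deriv ?_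
    change -(1 / 2 : ℝ) • ((c t).ψ.val x).comp ((c t).J.toEnd.val x * (C : EndField S).val x) = _
    rw [hC, hc.lift]
    rfl
  have hJ := hc.lift t
  rw [transported, ← hJ, ← hA, ← hψ]

theorem transported_self (hU : IsTransportField γ X s U) {p : Config P} (hp : p.J = γ s) :
    transported (γ s) (U s) p = p := by
  have hψ : p.ψ.comp (U s) = p.ψ := OneForm.ext_val fun x => by
    rw [OneForm.val_comp, hU.start]; rfl
  rw [transported, hψ, ← hp]

theorem HasVelocity.transported {Q : Type*} [NormedAddCommGroup Q] [NormedSpace ℝ Q]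
    {p : Q → Config P} {r e : Q} {v : Tangent (p r)} (hv : HasVelocity p r e v)
    (J : ComplexStructure S) (U : EndField S) :
    HasVelocity (fun r => transported J U (p r)) r e (0, v.2.1, v.2.2.comp U) where
  deriv_J x := hasDerivAt_const (0 : ℝ) (J.toEnd.val x)
  deriv_A x := hv.deriv_A x
  deriv_ψ x := by
    have h : HasDerivAt (fun s : ℝ => (p (r + s • e)).ψ.val x) (v.2.2.val x) 0 := hv.deriv_ψ x
    exact ((ContinuousLinearMap.compL ℝ Plane Plane EK).flip (U.val x)).hasFDerivAt.comp_hasDerivAt _ h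

variable [T2Space S] [CompactSpace S]

theorem isKaehlerConnection_connectionI (B : InvariantMetric EK K) :
    IsKaehlerConnection B (connectionI P) where
  complex _ _ hv := complexI_mem_horizontal hv
  existsUnique_lift γ hγ s p hp := by
    obtain ⟨X, hX, hd⟩ := exists_velocity_J hγ
    obtain ⟨U, hU⟩ := exists_isTransportField hγ hX hd s
    refine ⟨fun t => transported (γ t) (U t) p,
      ⟨isHorizontalLift_transported hγ hd hU p, transported_self hU hp⟩, ?_⟩
    rintro c ⟨hc, rfl⟩
    exact funext fun t => hc.eq_transported hd hU t
  preserves γ hγ s t n p q hp hpq := by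
    obtain ⟨X, hX, hd⟩ := exists_velocity_J hγ
    obtain ⟨U, hU⟩ := exists_isTransportField hγ hX hd s
    have hq : q = fun r => transported (γ t) (U t) (p r) := funext fun r => by
      obtain ⟨c, hc, hcs, hct⟩ := hpq r
      rw [← hcs, ← hct, hc.eq_transported hd hU t]
    subst hq
    refine ⟨⟨isSmoothEndFamily_const (γ t).toEnd, hp.smooth_A,
      hp.smooth_ψ.comp (isSmoothEndFamily_const (U t))⟩, fun r e₁ e₂ v₁ v₂ hv₁ hv₂ => ?_⟩
    refine ⟨⟨_, rfl⟩, ⟨_, rfl⟩, hv₁.transported _ _, hv₂.transported _ _, ?_⟩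
    exact congrArg (pairing B (v₁ : Tangent (p r)).2.1 (v₂ : Tangent (p r)).2.1 - ·)
      (pairing_comp_comp B _ _ (hU.det t))

end Transport

/-! ### Closedness of the coupling form -/

section Calculus

variable {Q : Type*} [NormedAddCommGroup Q] [NormedSpace ℝ Q]
  {V : Type*} [NormedAddCommGroup V] [NormedSpace ℝ V]

theorem hasDerivAt_along {f : Q → V} (hf : ContDiff ℝ ∞ f) (q e : Q) :
    HasDerivAt (fun r : ℝ => f (q + r • e)) (fderiv ℝ f q e) 0 := by
  have h := (hf.differentiable (by simp) q).hasFDerivAt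
  have h2 : HasDerivAt (fun r : ℝ => q + r • e) e 0 := by
    simpa using ((hasDerivAt_id (0 : ℝ)).smul_const e).const_add q
  have h3 : HasFDerivAt f (fderiv ℝ f q) (q + (0 : ℝ) • e) := by simpa using h
  exact h3.comp_hasDerivAt (0 : ℝ) h2

theorem eq_fderiv_of_hasDerivAt {f : Q → V} (hf : ContDiff ℝ ∞ f) {e : Q} {f' : Q → V}
    (h : ∀ q, HasDerivAt (fun r : ℝ => f (q + r • e)) (f' q) 0) :
    f' = fun q => fderiv ℝ f q e :=
  funext fun q => (h q).unique (hasDerivAt_along hf q e)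

theorem contDiff_fderiv_apply {f : Q → V} (hf : ContDiff ℝ ∞ f) (e : Q) :
    ContDiff ℝ ∞ fun q => fderiv ℝ f q e :=
  (hf.fderiv_right (by simp)).clm_apply contDiff_const

theorem fderiv_fderiv_apply_comm {f : Q → V} (hf : ContDiff ℝ ∞ f) (q e₁ e₂ : Q) :
    fderiv ℝ (fun q => fderiv ℝ f q e₂) q e₁ = fderiv ℝ (fun q => fderiv ℝ f q e₁) q e₂ := by
  have h : ∀ a b : Q, fderiv ℝ (fun q => fderiv ℝ f q b) q a = fderiv ℝ (fderiv ℝ f) q a b := by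
    intro a b
    have hd : DifferentiableAt ℝ (fderiv ℝ f) q :=
      (hf.fderiv_right (m := ∞) (by simp)).differentiable (by simp) q
    rw [fderiv_clm_apply hd (differentiableAt_const b)]
    simp
  rw [h, h]
  exact (hf.contDiffAt.isSymmSndFDerivAt (by
    rw [minSmoothness_of_isRCLikeNormedField]; exact WithTop.coe_le_coe.2 (le_top (a := (2 : ℕ∞))))).eq e₁ e₂

/-- The partial derivatives of a smooth function have equal mixed derivatives. -/
theorem exists_mixed_derivative {f f₁ f₂ : Q → V} {e₁ e₂ : Q} (hf : ContDiff ℝ ∞ f)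
    (h₁ : ∀ q, HasDerivAt (fun r : ℝ => f (q + r • e₁)) (f₁ q) 0)
    (h₂ : ∀ q, HasDerivAt (fun r : ℝ => f (q + r • e₂)) (f₂ q) 0) (q : Q) :
    ∃ d, HasDerivAt (fun r : ℝ => f₂ (q + r • e₁)) d 0 ∧
      HasDerivAt (fun r : ℝ => f₁ (q + r • e₂)) d 0 := by
  rw [eq_fderiv_of_hasDerivAt hf h₁, eq_fderiv_of_hasDerivAt hf h₂]
  refine ⟨_, hasDerivAt_along (contDiff_fderiv_apply hf e₂) q e₁, ?_⟩
  rw [fderiv_fderiv_apply_comm hf q e₁ e₂]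
  exact hasDerivAt_along (contDiff_fderiv_apply hf e₁) q e₂

/-- An exact two-form is closed: `d(dl) = 0` on a three-parameter family. -/
theorem cyclic_sum_eq_zero {l : Fin 3 → Q → ℝ} (hl : ∀ i, ContDiff ℝ ∞ (l i)) {e : Fin 3 → Q}
    {η : Fin 3 → Fin 3 → Q → ℝ}
    (hη : ∀ i j q, η i j q = fderiv ℝ (l j) q (e i) - fderiv ℝ (l i) q (e j)) (q : Q) :
    lineDeriv ℝ (η 1 2) q (e 0) + lineDeriv ℝ (η 2 0) q (e 1) + lineDeriv ℝ (η 0 1) q (e 2) = 0 := by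
  have h : ∀ i j k, lineDeriv ℝ (η i j) q (e k) =
      fderiv ℝ (fun q => fderiv ℝ (l j) q (e i)) q (e k) -
        fderiv ℝ (fun q => fderiv ℝ (l i) q (e j)) q (e k) := fun i j k => by
    rw [funext (hη i j)]
    exact ((hasDerivAt_along (contDiff_fderiv_apply (hl j) (e i)) q (e k)).sub
      (hasDerivAt_along (contDiff_fderiv_apply (hl i) (e j)) q (e k))).deriv
  rw [h, h, h, fderiv_fderiv_apply_comm (hl 2) q (e 0) (e 1),
    fderiv_fderiv_apply_comm (hl 1) q (e 0) (e 2), fderiv_fderiv_apply_comm (hl 0) q (e 1) (e 2)]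
  ring

theorem hasDerivAt_bilinear {E G : Type*} [NormedAddCommGroup E] [NormedSpace ℝ E]
    [NormedAddCommGroup G] [NormedSpace ℝ G] (b : E →L[ℝ] V →L[ℝ] G) {f : ℝ → E} {g : ℝ → V}
    {f' : E} {g' : V} {t : ℝ} (hf : HasDerivAt f f' t) (hg : HasDerivAt g g' t) :
    HasDerivAt (fun t => b (f t) (g t)) (b (f t) g' + b f' (g t)) t :=
  ((b.hasFDerivAt.comp_hasDerivAt t hf).clm_apply hg).congr_deriv (add_comm _ _)

theorem contDiff_bilinear {E G : Type*} [NormedAddCommGroup E] [NormedSpace ℝ E]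
    [NormedAddCommGroup G] [NormedSpace ℝ G] (b : E →L[ℝ] V →L[ℝ] G) {f : Q → E} {g : Q → V}
    (hf : ContDiff ℝ ∞ f) (hg : ContDiff ℝ ∞ g) : ContDiff ℝ ∞ fun q => b (f q) (g q) :=
  (b.contDiff.comp hf).clm_apply hg

end Calculus

section Potential

variable {E : Type*} [NormedAddCommGroup E] [NormedSpace ℝ E]
  (b : (Plane →L[ℝ] E) →L[ℝ] (Plane →L[ℝ] E) →L[ℝ] ℝ)

/-- The pointwise primitive of the coupling form, evaluated on a tangent vector `(J', A', ψ')` at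
`(J, A, ψ)`. -/
noncomputable def primitive (A ψ : Plane →L[ℝ] E) (J : Plane →L[ℝ] Plane)
    (A' ψ' : Plane →L[ℝ] E) (J' : Plane →L[ℝ] Plane) : ℝ :=
  1 / 2 * b A A' - 1 / 2 * b ψ ψ' - 1 / 4 * b ψ (ψ.comp (J.comp J'))

theorem hasDerivAt_primitive {A A' ψ ψ' : ℝ → Plane →L[ℝ] E} {J J' : ℝ → Plane →L[ℝ] Plane}
    {A₁ A₂ ψ₁ ψ₂ : Plane →L[ℝ] E} {J₁ J₂ : Plane →L[ℝ] Plane} {t : ℝ}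
    (hA : HasDerivAt A A₁ t) (hA' : HasDerivAt A' A₂ t) (hψ : HasDerivAt ψ ψ₁ t)
    (hψ' : HasDerivAt ψ' ψ₂ t) (hJ : HasDerivAt J J₁ t) (hJ' : HasDerivAt J' J₂ t) :
    HasDerivAt (fun t => primitive b (A t) (ψ t) (J t) (A' t) (ψ' t) (J' t))
      (1 / 2 * (b (A t) A₂ + b A₁ (A' t)) - 1 / 2 * (b (ψ t) ψ₂ + b ψ₁ (ψ' t)) -
        1 / 4 * (b (ψ t) (ψ₁.comp ((J t).comp (J' t)) +
          (ψ t).comp (J₁.comp (J' t) + (J t).comp J₂)) +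
          b ψ₁ ((ψ t).comp ((J t).comp (J' t))))) t :=
  (((hasDerivAt_bilinear b hA hA').const_mul _).sub
    ((hasDerivAt_bilinear b hψ hψ').const_mul _)).sub
    ((hasDerivAt_bilinear b hψ (hψ.clm_comp (hJ.clm_comp hJ'))).const_mul _)

/-- The integrand of the coupling form on two tangent vectors at `(J, A, ψ)`. -/
noncomputable def density (ψ : Plane →L[ℝ] E) (J : Plane →L[ℝ] Plane)
    (A₁ ψ₁ : Plane →L[ℝ] E) (J₁ : Plane →L[ℝ] Plane) (A₂ ψ₂ : Plane →L[ℝ] E)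
    (J₂ : Plane →L[ℝ] Plane) : ℝ :=
  b A₁ A₂ - b ψ₁ ψ₂ - 1 / 2 * b (ψ.comp (J.comp J₁)) ψ₂ - 1 / 2 * b ψ₁ (ψ.comp (J.comp J₂)) -
    1 / 2 * b (ψ.comp J₁) (ψ.comp J₂)

/-- The exterior derivative of the primitive is the integrand of the coupling form. Composition with
an endomorphism of trace zero is skew for `b`; this is applied to `J'` and `J J'`. -/
theorem exterior_derivative_primitive (hb : ∀ a c, b a c = -b c a)
    (hb' : ∀ a c (C : Plane →L[ℝ] Plane), planeTrace C = 0 → b a (c.comp C) = -b (a.comp C) c)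
    {A A₁ A₂ A₁₂ ψ ψ₁ ψ₂ ψ₁₂ : Plane →L[ℝ] E} {J J₁ J₂ J₁₂ : Plane →L[ℝ] Plane}
    (hJ : J * J = -1) (h₁ : J₁ * J = -(J * J₁)) (h₂ : J₂ * J = -(J * J₂)) :
    (1 / 2 * (b A A₁₂ + b A₁ A₂) - 1 / 2 * (b ψ ψ₁₂ + b ψ₁ ψ₂) -
        1 / 4 * (b ψ (ψ₁.comp (J.comp J₂) + ψ.comp (J₁.comp J₂ + J.comp J₁₂)) +
          b ψ₁ (ψ.comp (J.comp J₂)))) -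
      (1 / 2 * (b A A₁₂ + b A₂ A₁) - 1 / 2 * (b ψ ψ₁₂ + b ψ₂ ψ₁) -
        1 / 4 * (b ψ (ψ₂.comp (J.comp J₁) + ψ.comp (J₂.comp J₁ + J.comp J₁₂)) +
          b ψ₂ (ψ.comp (J.comp J₁)))) =
    density b ψ J A₁ ψ₁ J₁ A₂ ψ₂ J₂ := by
  have e₁ := hb' ψ ψ₂ (J.comp J₁) (planeTrace_mul_eq_zero_of_anticomm h₁)
  have e₂ := hb' ψ ψ₁ (J.comp J₂) (planeTrace_mul_eq_zero_of_anticomm h₂)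
  have e₃ := hb' ψ (ψ.comp J₁) J₂ (planeTrace_eq_zero_of_anticomm hJ h₂)
  have e₄ := hb' ψ (ψ.comp J₂) J₁ (planeTrace_eq_zero_of_anticomm hJ h₁)
  rw [ContinuousLinearMap.comp_assoc] at e₃ e₄
  simp only [density, map_add, ContinuousLinearMap.comp_add, e₁, e₂, e₃, e₄]
  linarith [hb A₁ A₂, hb ψ₁ ψ₂, hb (ψ.comp J₁) (ψ.comp J₂), hb (ψ.comp (J.comp J₁)) ψ₂,
    hb (ψ.comp (J.comp J₂)) ψ₁]

variable {Q : Type*} [NormedAddCommGroup Q] [NormedSpace ℝ Q]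

theorem cyclic_sum_density (hb : ∀ a c, b a c = -b c a)
    (hb' : ∀ a c (C : Plane →L[ℝ] Plane), planeTrace C = 0 → b a (c.comp C) = -b (a.comp C) c)
    {A ψ : Q → Plane →L[ℝ] E} {J : Q → Plane →L[ℝ] Plane}
    (hA : ContDiff ℝ ∞ A) (hψ : ContDiff ℝ ∞ ψ) (hJ : ContDiff ℝ ∞ J)
    {A' ψ' : Fin 3 → Q → Plane →L[ℝ] E} {J' : Fin 3 → Q → Plane →L[ℝ] Plane} {e : Fin 3 → Q}
    (dA : ∀ i q, HasDerivAt (fun r : ℝ => A (q + r • e i)) (A' i q) 0)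
    (dψ : ∀ i q, HasDerivAt (fun r : ℝ => ψ (q + r • e i)) (ψ' i q) 0)
    (dJ : ∀ i q, HasDerivAt (fun r : ℝ => J (q + r • e i)) (J' i q) 0)
    (hsq : ∀ q, J q * J q = -1) (hanti : ∀ i q, J' i q * J q = -(J q * J' i q)) (t : Q) :
    let η := fun i j q => density b (ψ q) (J q) (A' i q) (ψ' i q) (J' i q) (A' j q) (ψ' j q) (J' j q)
    lineDeriv ℝ (η 1 2) t (e 0) + lineDeriv ℝ (η 2 0) t (e 1) + lineDeriv ℝ (η 0 1) t (e 2) = 0 := by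
  intro η
  have hA' : ∀ i, ContDiff ℝ ∞ (A' i) := fun i => by
    rw [eq_fderiv_of_hasDerivAt hA (dA i)]; exact contDiff_fderiv_apply hA _
  have hψ' : ∀ i, ContDiff ℝ ∞ (ψ' i) := fun i => by
    rw [eq_fderiv_of_hasDerivAt hψ (dψ i)]; exact contDiff_fderiv_apply hψ _
  have hJ' : ∀ i, ContDiff ℝ ∞ (J' i) := fun i => by
    rw [eq_fderiv_of_hasDerivAt hJ (dJ i)]; exact contDiff_fderiv_apply hJ _
  let l : Fin 3 → Q → ℝ := fun i q => primitive b (A q) (ψ q) (J q) (A' i q) (ψ' i q) (J' i q)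
  have hl : ∀ i, ContDiff ℝ ∞ (l i) := fun i =>
    ((contDiff_const.mul (contDiff_bilinear b hA (hA' i))).sub
      (contDiff_const.mul (contDiff_bilinear b hψ (hψ' i)))).sub
      (contDiff_const.mul (contDiff_bilinear b hψ (hψ.clm_comp (hJ.clm_comp (hJ' i)))))
  refine cyclic_sum_eq_zero hl (fun i j q => ?_) t
  obtain ⟨A₁₂, hA₁, hA₂⟩ := exists_mixed_derivative hA (dA i) (dA j) q
  obtain ⟨ψ₁₂, hψ₁, hψ₂⟩ := exists_mixed_derivative hψ (dψ i) (dψ j) q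
  obtain ⟨J₁₂, hJ₁, hJ₂⟩ := exists_mixed_derivative hJ (dJ i) (dJ j) q
  have h₁ := (hasDerivAt_along (hl j) q (e i)).unique
    (hasDerivAt_primitive b (dA i q) hA₁ (dψ i q) hψ₁ (dJ i q) hJ₁)
  have h₂ := (hasDerivAt_along (hl i) q (e j)).unique
    (hasDerivAt_primitive b (dA j q) hA₂ (dψ j q) hψ₂ (dJ j q) hJ₂)
  rw [h₁, h₂]
  simp only [zero_smul, add_zero]
  exact (exterior_derivative_primitive b hb hb' (hsq q) (hanti i q) (hanti j q)).symm

end Potential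

section Closed

open Set Bundle

variable {S : Type*} [TopologicalSpace S] [ChartedSpace Plane S]
  {Q : Type*} [NormedAddCommGroup Q] [NormedSpace ℝ Q]

theorem IsSmoothTwoFormFamily.add
    {η ζ : Q → ∀ x : S, TangentSpace (𝓡 2) x → TangentSpace (𝓡 2) x → ℝ}
    (hη : IsSmoothTwoFormFamily η) (hζ : IsSmoothTwoFormFamily ζ) :
    IsSmoothTwoFormFamily fun q x u v => η q x u v + ζ q x u v := fun i => (hη i).add (hζ i)

theorem IsSmoothTwoFormFamily.const_mul (r : ℝ)
    {η : Q → ∀ x : S, TangentSpace (𝓡 2) x → TangentSpace (𝓡 2) x → ℝ}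
    (hη : IsSmoothTwoFormFamily η) :
    IsSmoothTwoFormFamily fun q x u v => r * η q x u v := fun i => contDiffOn_const.mul (hη i)

variable [IsManifold (𝓡 2) ∞ S]
  {EK : Type*} [NormedAddCommGroup EK] [NormedSpace ℝ EK]
  {K : Type*} [TopologicalSpace K] [ChartedSpace EK K] [Group K]
  {ι : Type*} {P : PrincipalBundleCore S EK K ι}

/-- The potentials of a smooth family of connections are smooth when tangent vectors are read in the
chart at a fixed point. -/
theorem IsSmoothConnectionFamily.contMDiffOn_coord {A : Q → Connection P}
    (hA : IsSmoothConnectionFamily A) (i : ι) (x₀ : S) :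
    ContMDiffOn (𝓘(ℝ, Q).prod (𝓡 2)) 𝓘(ℝ, Plane →L[ℝ] EK) ∞
      (fun p : Q × S => ((A p.1).pot i p.2 : Plane →L[ℝ] EK).comp
        ((trivializationAt Plane (TangentSpace (𝓡 2)) x₀).symmL ℝ p.2 : Plane →L[ℝ] Plane))
      (univ ×ˢ (P.baseSet i ∩ (trivializationAt Plane (TangentSpace (𝓡 2)) x₀).baseSet)) := by
  have h := (Trivialization.contMDiffOn (IB := 𝓡 2) (n := ∞) (trivializationAt (Plane →L[ℝ] EK)
    (fun x : S => TangentSpace (𝓡 2) x →L[ℝ] Bundle.Trivial S EK x) x₀)).comp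
    (s := univ ×ˢ (P.baseSet i ∩ (trivializationAt Plane (TangentSpace (𝓡 2)) x₀).baseSet))
    ((hA i).mono (prod_mono_right inter_subset_left)) fun p hp => by
      rw [mem_preimage, Trivialization.mem_source, hom_trivializationAt_baseSet]
      exact ⟨hp.2.2, mem_univ _⟩
  refine (contMDiff_snd.comp_contMDiffOn h).congr fun p hp => ?_
  rw [Function.comp_apply, Function.comp_apply, hom_trivializationAt_apply]
  ext w
  simp [ContinuousLinearMap.inCoordinates]

theorem IsSmoothConnectionFamily.contDiff_val {A : Q → Connection P}
    (hA : IsSmoothConnectionFamily A) (x : S) : ContDiff ℝ ∞ fun q => (A q).val x := by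
  have h1 : ContMDiff 𝓘(ℝ, Q) (𝓘(ℝ, Q).prod (𝓡 2)) ∞ fun q : Q => (q, x) :=
    contMDiff_id.prodMk contMDiff_const
  have hx := FiberBundle.mem_baseSet_trivializationAt' (F := Plane)
    (E := fun x : S => TangentSpace (𝓡 2) x) x
  have h2 := (hA.contMDiffOn_coord (P.indexAt x) x).comp_contMDiff h1
    fun q => ⟨mem_univ _, P.mem_baseSet_at x, hx⟩
  let L : Plane →L[ℝ] Plane :=
    (trivializationAt Plane (TangentSpace (𝓡 2)) x).continuousLinearMapAt ℝ x
  have h3 := (contMDiff_iff_contDiff.1 h2).clm_comp (contDiff_const (c := L))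
  convert! h3 using 1
  funext q
  ext w
  exact congrArg ((A q).val x) (Trivialization.symmL_continuousLinearMapAt _ hx w).symm

variable [LieGroup 𝓘(ℝ, EK) ∞ K]

/-- The velocity of a smooth family of connections is a smooth family of one-forms: in a fixed local
trivialization the gauge transformation law is affine, with an inhomogeneous term which does not
depend on the parameter. -/
theorem IsSmoothConnectionFamily.deriv_param {A : Q → Connection P} {a : Q → OneForm P} (e : Q)
    (hA : IsSmoothConnectionFamily A)
    (hd : ∀ q x, HasDerivAt (fun r : ℝ => (A (q + r • e)).val x) ((a q).val x) 0) :
    IsSmoothFormFamily a := by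
  refine (contMDiff_section_iff (s := fun q x => a q x)).2 fun q x₀ => ?_
  have hU : IsOpen (P.baseSet (P.indexAt x₀) ∩
      (trivializationAt Plane (fun x : S => TangentSpace (𝓡 2) x) x₀).baseSet) :=
    (P.isOpen_baseSet _).inter
      (trivializationAt Plane (fun x : S => TangentSpace (𝓡 2) x) x₀).open_baseSet
  have h := contMDiffOn_deriv_param hU e (hA.contMDiffOn_coord (P.indexAt x₀) x₀)
    (f' := fun p : Q × S => (trivializationAt (Plane →L[ℝ] EK)
      (fun x : S => TangentSpace (𝓡 2) x →L[ℝ] P.adjoint.Fiber x) x₀ ⟨p.2, a p.1 p.2⟩).2)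
    fun q y hy => ?_
  · exact h.contMDiffAt ((isOpen_univ.prod hU).mem_nhds
      ⟨mem_univ _, P.mem_baseSet_at x₀, FiberBundle.mem_baseSet_trivializationAt' x₀⟩)
  · let L : Plane →L[ℝ] Plane := (trivializationAt Plane (TangentSpace (𝓡 2)) x₀).symmL ℝ y
    let T : EK →L[ℝ] EK := adRep (P.transition (P.indexAt x₀) (P.indexAt y) y)
    let m : Plane →L[ℝ] EK := mcPullback (P.transition (P.indexAt y) (P.indexAt x₀)) y
    have h1 := (((hasDerivAt_const (0 : ℝ) T).clm_comp (hd q y)).add_const m).clm_comp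
      (hasDerivAt_const (0 : ℝ) L)
    have e1 : ∀ r : ℝ, ((A (q + r • e)).pot (P.indexAt x₀) y : Plane →L[ℝ] EK) =
        T.comp ((A (q + r • e)).val y) + m := fun r =>
      (A (q + r • e)).gauge (P.indexAt y) (P.indexAt x₀) y ⟨P.mem_baseSet_at y, hy.1⟩
    simp only [e1]
    refine h1.congr_deriv ?_
    rw [hom_trivializationAt_apply]
    ext w
    have hy' : y ∈ (trivializationAt EK P.adjoint.Fiber x₀).baseSet := hy.1
    simp [ContinuousLinearMap.inCoordinates, Trivialization.coe_linearMapAt_of_mem _ hy']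
    rfl

theorem IsSmoothFamily.isSmoothVectorFamily {c : Q → Config P} (hc : IsSmoothFamily c) {e : Q}
    {v : ∀ t, Tangent (c t)} (hv : ∀ t, HasVelocity c t e (v t)) : IsSmoothVectorFamily c v where
  smooth_J := hc.smooth_J.deriv_param e fun t x => (hv t).deriv_J x
  smooth_A := hc.smooth_A.deriv_param e fun t x => (hv t).deriv_A x
  smooth_ψ := hc.smooth_ψ.deriv_param e fun t x => (hv t).deriv_ψ x

variable (B : InvariantMetric EK K)

/-- The integrand of the coupling form. -/
noncomputable def sigmaDensity (p : Config P) (v w : Tangent p) (x : S)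
    (y z : TangentSpace (𝓡 2) x) : ℝ :=
  formWedge B v.2.1 w.2.1 x y z + -1 * formWedge B v.2.2 w.2.2 x y z +
    -(1 / 2) * formWedge B (p.ψ.comp (p.J.toEnd.comp v.1)) w.2.2 x y z +
    -(1 / 2) * formWedge B v.2.2 (p.ψ.comp (p.J.toEnd.comp w.1)) x y z +
    -(1 / 2) * formWedge B (p.ψ.comp v.1) (p.ψ.comp w.1) x y z

variable [FiniteDimensional ℝ EK]

theorem isSmoothTwoFormFamily_sigmaDensity {c : Q → Config P} {v w : ∀ t, Tangent (c t)}
    (hc : IsSmoothFamily c) (hv : IsSmoothVectorFamily c v) (hw : IsSmoothVectorFamily c w) :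
    IsSmoothTwoFormFamily fun t => sigmaDensity B (c t) (v t) (w t) :=
  ((((isSmoothTwoFormFamily_formWedge B hv.smooth_A hw.smooth_A).add
    ((isSmoothTwoFormFamily_formWedge B hv.smooth_ψ hw.smooth_ψ).const_mul _)).add
    ((isSmoothTwoFormFamily_formWedge B (hc.smooth_ψ.comp (hc.smooth_J.comp hv.smooth_J))
      hw.smooth_ψ).const_mul _)).add
    ((isSmoothTwoFormFamily_formWedge B hv.smooth_ψ
      (hc.smooth_ψ.comp (hc.smooth_J.comp hw.smooth_J))).const_mul _)).add
    ((isSmoothTwoFormFamily_formWedge B (hc.smooth_ψ.comp hv.smooth_J)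
      (hc.smooth_ψ.comp hw.smooth_J)).const_mul _)

theorem SurfaceIntegrable.const_mul [T2Space S] [SigmaCompactSpace S] (r : ℝ)
    {η : ∀ x : S, TangentSpace (𝓡 2) x → TangentSpace (𝓡 2) x → ℝ} (hη : SurfaceIntegrable η) :
    SurfaceIntegrable fun x u v => r * η x u v := fun i => by
  rw [localIntegrand_smul]; exact (hη i).const_mul r

theorem sigmaI_eq_surfaceIntegral [T2Space S] [CompactSpace S] (p : Config P) (v w : Tangent p) :
    sigmaI B p v w = surfaceIntegral (sigmaDensity B p v w) := by
  have h := fun a b : OneForm P => surfaceIntegrable_formWedge B a b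
  have hm := fun (r : ℝ) (a b : OneForm P) => (h a b).const_mul r
  have h1 := (h v.2.1 w.2.1).add (hm (-1) v.2.2 w.2.2)
  have h2 := h1.add (hm (-(1 / 2)) (p.ψ.comp (p.J.toEnd.comp v.1)) w.2.2)
  have h3 := h2.add (hm (-(1 / 2)) v.2.2 (p.ψ.comp (p.J.toEnd.comp w.1)))
  have h4 := surfaceIntegral_add h3 (hm (-(1 / 2)) (p.ψ.comp v.1) (p.ψ.comp w.1))
  refine Eq.trans ?_ h4.symm
  rw [surfaceIntegral_add h2 (hm _ _ _), surfaceIntegral_add h1 (hm _ _ _),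
    surfaceIntegral_add (h _ _) (hm _ _ _), surfaceIntegral_smul, surfaceIntegral_smul,
    surfaceIntegral_smul, surfaceIntegral_smul, sigmaI_eq']
  simp only [pairing_eq]
  ring

/-- The bilinear form `(a, b) ↦ B(a ∧ b)(y, z)` on linear maps from the plane to the Lie algebra. -/
noncomputable def wedgeForm (y z : Plane) :
    (Plane →L[ℝ] EK) →L[ℝ] (Plane →L[ℝ] EK) →L[ℝ] ℝ :=
  let ev : Plane → (Plane →L[ℝ] EK) →L[ℝ] EK := fun y => ContinuousLinearMap.apply ℝ EK y
  B.formCLM.bilinearComp (ev y) (ev z) - B.formCLM.bilinearComp (ev z) (ev y)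

/-- The integrand of the coupling form is closed at each point of the surface, since it has a
primitive there. This pointwise primitive need not be the integrand of a one-form on the configuration
space: it involves the potentials of the connection, which depend on the trivialization. -/
theorem cyclic_sum_sigmaDensity {c : Q → Config P} {e : Fin 3 → Q} {v : Fin 3 → ∀ t, Tangent (c t)}
    (hc : IsSmoothFamily c) (hv : ∀ i t, HasVelocity c t (e i) (v i t)) (t : Q) (x : S)
    (y z : TangentSpace (𝓡 2) x) :
    lineDeriv ℝ (fun t => sigmaDensity B (c t) (v 1 t) (v 2 t) x y z) t (e 0) +
      lineDeriv ℝ (fun t => sigmaDensity B (c t) (v 2 t) (v 0 t) x y z) t (e 1) +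
      lineDeriv ℝ (fun t => sigmaDensity B (c t) (v 0 t) (v 1 t) x y z) t (e 2) = 0 := by
  have h := cyclic_sum_density (wedgeForm B (y : Plane) (z : Plane))
    (fun _ _ => wedge_antisymm B.symm _ _ _ _) (fun a d C hC => ?_)
    (hc.smooth_A.contDiff_val x) (hc.smooth_ψ.contDiff_val x) (hc.smooth_J.contDiff_val x)
    (A' := fun i q => (v i q).2.1.val x) (ψ' := fun i q => (v i q).2.2.val x)
    (J' := fun i q => ((v i q).1 : EndField S).val x)
    (fun i q => (hv i q).deriv_A x) (fun i q => (hv i q).deriv_ψ x) (fun i q => (hv i q).deriv_J x)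
    (fun q => (c q).J.val_mul_val x) (fun i q => tangentJ_val (v i q).1 x) t
  · have e : ∀ i j, (fun t => sigmaDensity B (c t) (v i t) (v j t) x y z) = fun q =>
        density (wedgeForm B (y : Plane) (z : Plane)) ((c q).ψ.val x) ((c q).J.toEnd.val x)
          ((v i q).2.1.val x) ((v i q).2.2.val x) (((v i q).1 : EndField S).val x)
          ((v j q).2.1.val x) ((v j q).2.2.val x) (((v j q).1 : EndField S).val x) := fun i j => by
      funext q
      rw [sigmaDensity, density, neg_mul, neg_mul, neg_mul, neg_mul, one_mul, ← sub_eq_add_neg,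
        ← sub_eq_add_neg, ← sub_eq_add_neg, ← sub_eq_add_neg]
      rfl
    rw [e, e, e]
    exact h
  · have h := wedge_comp_add (β := B.form) a d C y z
    rw [hC, zero_mul] at h
    exact eq_neg_of_add_eq_zero_right h

variable [T2Space S] [CompactSpace S]

theorem isClosedForm_sigmaI : IsClosedForm (sigmaI (P := P) B) := by
  intro c v hc hv
  have hsm := fun i => hc.isSmoothVectorFamily (hv i)
  refine ⟨fun i j => ((isTwoForm_sigmaI B).smooth 3 c (v i) (v j) hc (hsm i)
    (hsm j)).differentiable (by simp), fun t => ?_⟩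
  have h := fun i j k => lineDeriv_surfaceIntegral
    (isSmoothTwoFormFamily_sigmaDensity B hc (hsm i) (hsm j)) t (Pi.single k (1 : ℝ))
  simp only [sigmaI_eq_surfaceIntegral]
  rw [(h 1 2 0).2, (h 2 0 1).2, (h 0 1 2).2, ← surfaceIntegral_add (h 1 2 0).1 (h 2 0 1).1,
    ← surfaceIntegral_add ((h 1 2 0).1.add (h 2 0 1).1) (h 0 1 2).1]
  simp only [cyclic_sum_sigmaDensity B hc hv]
  simpa using surfaceIntegral_smul 0 (fun (x : S) (_ _ : TangentSpace (𝓡 2) x) => (0 : ℝ))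

end Closed

end HiggsFibration

theorem propositionp
    {S : Type*} [TopologicalSpace S] [ChartedSpace HiggsFibration.Plane S]
    [IsManifold (𝓡 2) ∞ S] [T2Space S] [CompactSpace S] (hS : HiggsFibration.IsOrientedAtlas S)
    {EK : Type*} [NormedAddCommGroup EK] [NormedSpace ℝ EK] [FiniteDimensional ℝ EK]
    {K : Type*} [TopologicalSpace K] [ChartedSpace EK K] [Group K] [LieGroup 𝓘(ℝ, EK) ∞ K]
    {ι : Type*} (P : HiggsFibration.PrincipalBundleCore S EK K ι)
    (B : HiggsFibration.InvariantMetric EK K) :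
    HiggsFibration.IsKaehlerConnection B (HiggsFibration.connectionI P) ∧
    HiggsFibration.IsCouplingForm B (HiggsFibration.connectionI P)
      (HiggsFibration.sigmaI (P := P) B) ∧
    ∀ (p : HiggsFibration.Config P) (v w : HiggsFibration.Tangent p),
      HiggsFibration.sigmaI B p v w =
        HiggsFibration.pairing B v.2.1 w.2.1 -
        HiggsFibration.pairing B
          (v.2.2 + (1 / 2 : ℝ) • p.ψ.comp (p.J.toEnd.comp v.1))
          (w.2.2 + (1 / 2 : ℝ) • p.ψ.comp (p.J.toEnd.comp w.1)) -
        1 / 4 * HiggsFibration.pairing B (p.ψ.comp v.1) (p.ψ.comp w.1) ∧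
      HiggsFibration.sigmaI B p v w =
        HiggsFibration.pairing B v.2.1 w.2.1 - HiggsFibration.pairing B v.2.2 w.2.2 -
        1 / 2 * HiggsFibration.pairing B (p.ψ.comp (p.J.toEnd.comp v.1)) w.2.2 -
        1 / 2 * HiggsFibration.pairing B v.2.2 (p.ψ.comp (p.J.toEnd.comp w.1)) -
        1 / 2 * HiggsFibration.pairing B (p.ψ.comp v.1) (p.ψ.comp w.1) := by
  refine ⟨HiggsFibration.isKaehlerConnection_connectionI B,
    ⟨HiggsFibration.isTwoForm_sigmaI B, HiggsFibration.isClosedForm_sigmaI B,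
      HiggsFibration.isType11_sigmaI B, HiggsFibration.sigmaI_restrict B,
      HiggsFibration.mem_horizontal_iff_sigmaI B hS⟩, fun p v w => ⟨?_, ?_⟩⟩
  · exact HiggsFibration.sigmaI_eq B p v w
  · exact HiggsFibration.sigmaI_eq' B p v w
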